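/- A *map* is a cellular embedding of a finite connected graph (loops and multiple edges allowed) in a closed connected surface. It is *rooted* by distinguishing an end and a side of one edge; the vertex at this end is the root-vertex. Rooted maps are considered up to homeomorphism preserving the root-end and root-side. The degree of a vertex counts loops twice, and $e(M)$ is the number of edges of $M$. By convention the map on the sphere consisting of a single vertex and no edge is a rooted map whose root-vertex has degree $0$. A *$k$-marked near-cubic map* is a rooted map with $k$ marked vertices distinct from the root-vertex such that every non-root, non-marked vertex has degree $3$. Given a canonical (i.e. isomorphism-invariant) order of the marked vertices of each such map $M$, let $d(M)$ be the degree of the root-vertex and $d_1(M),\ldots,d_k(M)$ the degrees of the marked vertices in this order, and set $$\mathbf O_{g,k}(x,x_1,\ldots,x_k)=\sum_{M\in\mathcal O_{g,k}} x^{d(M)}x_1^{d_1(M)}\cdots x_k^{d_k(M)}z^{e(M)},\qquad \mathbf P_{g,k}(x,x_1,\ldots,x_k)=\sum_{M\in\mathcal P_{g,k}} x^{d(M)}x_1^{d_1(M)}\cdots x_k^{d_k(M)}z^{e(M)},$$ where $\mathcal O_{g,k}$ (resp. $\mathcal P_{g,k}$) is the set of $k$-marked near-cubic maps on the orientable surface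 of genus $g$, of Euler characteristic $2-2g$ (resp. on the non-orientable surface of genus $g\ge1$, of Euler characteristic $2-g$; $\mathcal P_{0,k}=\emptyset$). Let $\mathbf Q_{g,k}=\mathbf O_{g/2,k}+\mathbf P_{g,k}$, where $\mathbf O_{g/2,k}$ is $0$ if $g$ is odd. Series with a negative index are $0$. **Proposition.** There is a canonical order of the marked vertices of $k$-marked near-cubic maps for which the following holds. (1) The series $(\mathbf O_{g,k})_{g,k\in\mathbb N}$ are the unique family of power series in $z$ with polynomial coefficients (over $\mathbb Q$) in $x,x_1,\ldots,x_k$ satisfying, for all $g,k\ge0$, $$\begin{aligned}\mathbf O_{g,k}(x,x_1,\ldots,x_k)={}&c_0+\frac zx\Big(\mathbf O_{g,k}(x,x_1,\ldots,x_k)-c_0-x[x^1]\mathbf O_{g,k}(x,x_1,\ldots,x_k)\Big)\\&+\frac{x x_k z}{x-x_k}\Big(x\,\mathbf O_{g,k-1}(x,x_1,\ldots,x_{k-1})-x_k\,\mathbf O_{g,k-1}(x_k,x_1,\ldots,x_{k-1})\Big)\\&+x^2z\sum_{i=0}^g\sum_{j=0}^k\mathbf O_{i,j}(x,x_1,\ldots,x_j)\,\mathbf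 O_{g-i,k-j}(x,x_{j+1},\ldots,x_k)\\&+x^3z\sum_{j=1}^{k+1}\Big(\frac{\partial}{\partial x_j}\mathbf O_{g-1,k+1}(x,x_1,\ldots,x_{k+1})\Big)\bigg|_{x_j=x}\bigg|_{x_{j+1}=x_j}\cdots\bigg|_{x_{k+1}=x_k},\end{aligned}$$ where $c_0$ is $1$ if $g=k=0$ and $0$ otherwise (the third summand being $0$ for $k=0$). Moreover $[x^0]\mathbf O_{g,k}=c_0$. (2) The series $(\mathbf Q_{g,k})_{g,k\in\mathbb N}$ are the unique family of power series in $z$ with polynomial coefficients in $x,x_1,\ldots,x_k$ satisfying, for all $g,k\ge0$, with the same $c_0$, $$\begin{aligned}\mathbf Q_{g,k}(x,x_1,\ldots,x_k)={}&c_0+\frac zx\Big(\mathbf Q_{g,k}(x,x_1,\ldots,x_k)-c_0-x[x^1]\mathbf Q_{g,k}(x,x_1,\ldots,x_k)\Big)\\&+\frac{x x_k z}{x-x_k}\Big(x\,\mathbf Q_{g,k-1}(x,x_1,\ldots,x_{k-1})-x_k\,\mathbf Q_{g,k-1}(x_k,x_1,\ldots,x_{k-1})\Big)\\&+x^2z\sum_{i=0}^g\sum_{j=0}^k\mathbf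 Q_{i,j}(x,x_1,\ldots,x_j)\,\mathbf Q_{g-i,k-j}(x,x_{j+1},\ldots,x_k)\\&+2x^3z\sum_{j=1}^{k+1}\Big(\frac{\partial}{\partial x_j}\mathbf Q_{g-2,k+1}(x,x_1,\ldots,x_{k+1})\Big)\bigg|_{x_j=x}\bigg|_{x_{j+1}=x_j}\cdots\bigg|_{x_{k+1}=x_k}\\&+x^2z\,\frac{\partial}{\partial x}\Big(x\,\mathbf Q_{g-1,k}(x,x_1,\ldots,x_k)\Big).\end{aligned}$$ Moreover $[x^0]\mathbf Q_{g,k}=c_0$. (3) Let $\mathbb S$ be a compact connected surface with $\beta\ge1$ boundary components, distinct from the disc, let $\chi(\mathbb S)$ be its Euler characteristic and $\overline{\mathbb S}$ the closed surface obtained by gluing a disc along each boundary component. Let $a(\mathbb S)$ be the number of cubic schemes of $\mathbb S$, that is, of rooted maps on $\overline{\mathbb S}$ with $\beta$ faces whose root-vertex has degree $1$ and whose other vertices all have degree $3$. Then $a(\mathbb S)=[x^1z^{2-3\chi(\mathbb S)}]\mathbf O_{1-\chi(\overline{\mathbb S})/2,\,0}$ if $\mathbb S$ is orientable, and $a(\mathbb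 S)=[x^1z^{2-3\chi(\mathbb S)}]\mathbf P_{2-\chi(\overline{\mathbb S}),\,0}$ otherwise. -/

import Mathlib

namespace NearCubic

/-! ## Rooted maps on closed surfaces -/

/-- A rooted map with `n ≥ 1` edges on a closed connected surface, orientable or not, encoded by its
flags. A flag is a triple of mutually incident (edge, end of that edge, side of that edge), so each
edge carries four flags. `σ₀` changes the end, `σ₂` changes the side, and `σ₁` passes to the other
flag of the same corner (same vertex, same face, next edge). The root is a flag, that is, an edge
with a distinguished end and a distinguished side. There is no such structure for `n = 0`. -/
structure RootedMap (n : ℕ) where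
  σ₀ : Equiv.Perm (Fin (4 * n))
  σ₁ : Equiv.Perm (Fin (4 * n))
  σ₂ : Equiv.Perm (Fin (4 * n))
  root : Fin (4 * n)
  invol₀ : ∀ f, σ₀ (σ₀ f) = f
  invol₁ : ∀ f, σ₁ (σ₁ f) = f
  invol₂ : ∀ f, σ₂ (σ₂ f) = f
  ne₀ : ∀ f, σ₀ f ≠ f
  ne₁ : ∀ f, σ₁ f ≠ f
  ne₂ : ∀ f, σ₂ f ≠ f
  comm : ∀ f, σ₀ (σ₂ f) = σ₂ (σ₀ f)
  ne₀₂ : ∀ f, σ₀ (σ₂ f) ≠ f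
  connected : ∀ f f', ∃ τ ∈ Subgroup.closure {σ₀, σ₁, σ₂}, τ f = f'

namespace RootedMap

variable {n : ℕ}

/-- The vertex incident to the flag `f`, as the set of all flags incident to it. -/
def vertexAt (M : RootedMap n) (f : Fin (4 * n)) : Set (Fin (4 * n)) :=
  {f' | ∃ τ ∈ Subgroup.closure {M.σ₁, M.σ₂}, τ f = f'}

/-- The face incident to the flag `f`, as the set of all flags incident to it. -/
def faceAt (M : RootedMap n) (f : Fin (4 * n)) : Set (Fin (4 * n)) :=
  {f' | ∃ τ ∈ Subgroup.closure {M.σ₀, M.σ₁}, τ f = f'}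

def vertices (M : RootedMap n) : Set (Set (Fin (4 * n))) := Set.range M.vertexAt

def faces (M : RootedMap n) : Set (Set (Fin (4 * n))) := Set.range M.faceAt

def rootVertex (M : RootedMap n) : Set (Fin (4 * n)) := M.vertexAt M.root

/-- The Euler characteristic of the underlying surface. -/
noncomputable def eulerChar (M : RootedMap n) : ℤ :=
  (M.vertices.ncard : ℤ) - n + M.faces.ncard

/-- The underlying surface is orientable: the flags can be 2-coloured so that each of
`σ₀`, `σ₁`, `σ₂` exchanges the colours. -/
def IsOrientable (M : RootedMap n) : Prop :=
  ∃ color : Fin (4 * n) → Bool, ∀ f,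
    color (M.σ₀ f) = !color f ∧ color (M.σ₁ f) = !color f ∧ color (M.σ₂ f) = !color f

/-- `M` is a map on the closed connected surface which has Euler characteristic `χ` and is
orientable if and only if `ori` is true. -/
def IsOn (M : RootedMap n) (ori : Bool) (χ : ℤ) : Prop :=
  (M.IsOrientable ↔ ori = true) ∧ M.eulerChar = χ

/-- `φ` is an isomorphism of rooted maps. -/
def IsIso (M M' : RootedMap n) (φ : Equiv.Perm (Fin (4 * n))) : Prop :=
  (∀ f, φ (M.σ₀ f) = M'.σ₀ (φ f)) ∧ (∀ f, φ (M.σ₁ f) = M'.σ₁ (φ f)) ∧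
  (∀ f, φ (M.σ₂ f) = M'.σ₂ (φ f)) ∧ φ M.root = M'.root

theorem isIso_refl (M : RootedMap n) : IsIso M M 1 := by simp [IsIso]

theorem IsIso.symm {M M' : RootedMap n} {φ : Equiv.Perm (Fin (4 * n))} (h : IsIso M M' φ) :
    IsIso M' M φ⁻¹ := by
  obtain ⟨h0, h1, h2, h3⟩ := h
  refine ⟨fun f => ?_, fun f => ?_, fun f => ?_, ?_⟩
  · rw [Equiv.Perm.inv_eq_iff_eq, h0]; simp
  · rw [Equiv.Perm.inv_eq_iff_eq, h1]; simp
  · rw [Equiv.Perm.inv_eq_iff_eq, h2]; simp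
  · rw [Equiv.Perm.inv_eq_iff_eq, h3]

theorem IsIso.trans {M M' M'' : RootedMap n} {φ ψ : Equiv.Perm (Fin (4 * n))}
    (h : IsIso M M' φ) (h' : IsIso M' M'' ψ) : IsIso M M'' (ψ * φ) := by
  obtain ⟨h0, h1, h2, h3⟩ := h
  obtain ⟨k0, k1, k2, k3⟩ := h'
  exact ⟨fun f => by simp [h0, k0], fun f => by simp [h1, k1], fun f => by simp [h2, k2],
    by simp [h3, k3]⟩

instance isoSetoid (n : ℕ) : Setoid (RootedMap n) where
  r M M' := ∃ φ, IsIso M M' φ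
  iseqv := ⟨fun M => ⟨1, isIso_refl M⟩, fun ⟨_, h⟩ => ⟨_, h.symm⟩,
    fun ⟨_, h⟩ ⟨_, h'⟩ => ⟨_, h.trans h'⟩⟩

instance finite (n : ℕ) : Finite (RootedMap n) :=
  Finite.of_injective (fun M : RootedMap n => (M.σ₀, M.σ₁, M.σ₂, M.root)) (by
    intro M M' h
    cases M; cases M'
    simp only [Prod.mk.injEq] at h
    obtain ⟨rfl, rfl, rfl, rfl⟩ := h
    rfl)

end RootedMap

/-- The degree of a vertex `v` given as its set of flags: each of the edge-ends at `v` (a loop has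
two) consists of exactly two flags. -/
noncomputable def degree {n : ℕ} (v : Set (Fin (4 * n))) : ℕ := v.ncard / 2

/-! ## Marked near-cubic maps and their generating functions -/

/-- A `k`-marked near-cubic map with `n ≥ 1` edges: a rooted map with a set of `k` marked vertices
distinct from the root-vertex, every vertex other than the root-vertex and the marked vertices
having degree 3. -/
structure MarkedMap (n k : ℕ) extends RootedMap n where
  marked : Set (Set (Fin (4 * n)))
  marked_subset : marked ⊆ toRootedMap.vertices
  card_marked : marked.ncard = k
  root_notMem : toRootedMap.rootVertex ∉ marked
  nearCubic : ∀ v ∈ toRootedMap.vertices, v ≠ toRootedMap.rootVertex → v ∉ marked → degree v = 3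

namespace MarkedMap

variable {n k : ℕ}

/-- `φ` is an isomorphism of rooted maps that carries the marked vertices to the marked vertices. -/
def IsIso (M M' : MarkedMap n k) (φ : Equiv.Perm (Fin (4 * n))) : Prop :=
  M.toRootedMap.IsIso M'.toRootedMap φ ∧ (fun v => φ '' v) '' M.marked = M'.marked

theorem IsIso.symm {M M' : MarkedMap n k} {φ : Equiv.Perm (Fin (4 * n))} (h : IsIso M M' φ) :
    IsIso M' M φ⁻¹ := by
  refine ⟨h.1.symm, ?_⟩
  rw [← h.2, Set.image_image]
  simp [Set.image_image]

theorem IsIso.trans {M M' M'' : MarkedMap n k} {φ ψ : Equiv.Perm (Fin (4 * n))}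
    (h : IsIso M M' φ) (h' : IsIso M' M'' ψ) : IsIso M M'' (ψ * φ) := by
  refine ⟨h.1.trans h'.1, ?_⟩
  rw [← h'.2, ← h.2, Set.image_image]
  simp [Set.image_image]

instance isoSetoid (n k : ℕ) : Setoid (MarkedMap n k) where
  r M M' := ∃ φ, IsIso M M' φ
  iseqv := ⟨fun M => ⟨1, M.toRootedMap.isIso_refl, by simp⟩, fun ⟨_, h⟩ => ⟨_, h.symm⟩,
    fun ⟨_, h⟩ ⟨_, h'⟩ => ⟨_, h.trans h'⟩⟩

instance finite (n k : ℕ) : Finite (MarkedMap n k) :=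
  Finite.of_injective (fun M : MarkedMap n k => (M.toRootedMap, M.marked)) (by
    intro M M' h
    cases M; cases M'
    simp only [Prod.mk.injEq] at h
    obtain ⟨rfl, rfl⟩ := h
    rfl)

end MarkedMap

/-- A canonical order of the marked vertices: for every marked near-cubic map an enumeration without
repetition of its marked vertices, invariant under isomorphisms. -/
structure CanonicalOrder where
  enum : ∀ {n k : ℕ}, MarkedMap n k → Fin k → Set (Fin (4 * n))
  enum_injective : ∀ {n k : ℕ} (M : MarkedMap n k), Function.Injective (enum M)
  range_enum : ∀ {n k : ℕ} (M : MarkedMap n k), Set.range (enum M) = M.marked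
  equivariant : ∀ {n k : ℕ} (M M' : MarkedMap n k) (φ : Equiv.Perm (Fin (4 * n))),
    M.IsIso M' φ → ∀ i, enum M' i = φ '' enum M i

/-- Power series in `z` whose coefficients are polynomials in `x, x₁, …, x_k`; the variable of
index `0` is `x` and the variable of index `i ≥ 1` is `x_i`. -/
abbrev Series (k : ℕ) : Type := PowerSeries (MvPolynomial (Fin (k + 1)) ℚ)

/-- The generating function `∑ x ^ d(M) * x₁ ^ d₁(M) * ⋯ * x_k ^ d_k(M) * z ^ e(M)`, where `M` runs
over the `k`-marked near-cubic maps, up to isomorphism, on the closed connected surface which has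
Euler characteristic `χ` and is orientable if and only if `ori` is true. The first summand accounts
for the map on the sphere made of a single vertex (the root-vertex, of degree 0) and no edge. -/
noncomputable def mapSeries (c : CanonicalOrder) (ori : Bool) (χ : ℤ) (k : ℕ) : Series k :=
  PowerSeries.mk fun n =>
    (if n = 0 ∧ k = 0 ∧ ori = true ∧ χ = 2 then 1 else 0) +
    ∑ᶠ (M : Quotient (MarkedMap.isoSetoid n k)) (_ : M.out.IsOn ori χ),
      MvPolynomial.X 0 ^ degree M.out.rootVertex *
        ∏ i : Fin k, MvPolynomial.X i.succ ^ degree (c.enum M.out i)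

/-- `O_{g,k}`: the orientable surface of genus `g`. -/
noncomputable def seriesO (c : CanonicalOrder) (g k : ℕ) : Series k :=
  mapSeries c true (2 - 2 * (g : ℤ)) k

/-- `P_{g,k}`: the non-orientable surface of genus `g` (there is none for `g = 0`, and then the
series is zero). -/
noncomputable def seriesP (c : CanonicalOrder) (g k : ℕ) : Series k :=
  mapSeries c false (2 - (g : ℤ)) k

/-- `Q_{g,k} = O_{g/2,k} + P_{g,k}`, where `O_{g/2,k}` is `0` if `g` is odd. -/
noncomputable def seriesQ (c : CanonicalOrder) (g k : ℕ) : Series k :=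
  (if Even g then seriesO c (g / 2) k else 0) + seriesP c g k

/-! ## The functional equations -/

/-- The field of fractions of the ring of series, in which the equations are written. -/
abbrev Frac (k : ℕ) : Type := FractionRing (Series k)

/-- The variable `x` (for `i = 0`) or `x_i` (for `i ≥ 1`). -/
noncomputable def xvar {k : ℕ} (i : Fin (k + 1)) : Series k := PowerSeries.C (MvPolynomial.X i)

/-- `F(x_{s 0}, x_{s 1}, …, x_{s m})`, where `x_0` stands for `x`. -/
noncomputable def substVars {m k : ℕ} (s : Fin (m + 1) → Fin (k + 1)) (F : Series m) : Series k :=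
  PowerSeries.map (MvPolynomial.rename (R := ℚ) s).toRingHom F

/-- The partial derivative with respect to the variable of index `i`. -/
noncomputable def derivVar {k : ℕ} (i : Fin (k + 1)) (F : Series k) : Series k :=
  PowerSeries.mk fun n => MvPolynomial.pderiv i (PowerSeries.coeff n F)

/-- `[x^d] F`, a series in `z` with polynomial coefficients in `x₁, …, x_k`. -/
noncomputable def coeffX {k : ℕ} (d : ℕ) (F : Series k) : Series k :=
  PowerSeries.mk fun n => MvPolynomial.rename Fin.succ
    ((MvPolynomial.finSuccEquiv ℚ k (PowerSeries.coeff n F)).coeff d)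

/-- `c₀`, equal to `1` if `g = k = 0` and to `0` otherwise. -/
noncomputable def c₀ (g k : ℕ) : Series k := if g = 0 ∧ k = 0 then 1 else 0

/-- `(z / x) * (F_{g,k} - c₀ - x [x^1] F_{g,k})` -/
noncomputable def cubicTerm (F : ∀ _ k : ℕ, Series k) (g k : ℕ) : Frac k :=
  algebraMap (Series k) (Frac k) PowerSeries.X / algebraMap (Series k) (Frac k) (xvar 0) *
    algebraMap (Series k) (Frac k) (F g k - c₀ g k - xvar 0 * coeffX 1 (F g k))

/-- `(x x_k z / (x - x_k)) * (x F_{g,k-1}(x, x₁, …, x_{k-1}) - x_k F_{g,k-1}(x_k, x₁, …, x_{k-1}))`,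
which is `0` for `k = 0`. -/
noncomputable def markedTerm (F : ∀ _ k : ℕ, Series k) (g : ℕ) : ∀ k : ℕ, Frac k
  | 0 => 0
  | k + 1 =>
    let x : Series (k + 1) := xvar 0
    let xk : Series (k + 1) := xvar (Fin.last (k + 1))
    algebraMap (Series (k + 1)) (Frac (k + 1)) (x * xk * PowerSeries.X) /
        algebraMap (Series (k + 1)) (Frac (k + 1)) (x - xk) *
      algebraMap (Series (k + 1)) (Frac (k + 1))
        (x * substVars Fin.castSucc (F g k) -
          xk * substVars (fun i => if i = 0 then Fin.last (k + 1) else i.castSucc) (F g k))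

/-- `x² z ∑_{i=0}^g ∑_{j=0}^k F_{i,j}(x, x₁, …, x_j) F_{g-i,k-j}(x, x_{j+1}, …, x_k)` -/
noncomputable def productTerm (F : ∀ _ k : ℕ, Series k) (g k : ℕ) : Series k :=
  xvar 0 ^ 2 * PowerSeries.X * ∑ i ∈ Finset.range (g + 1), ∑ j : Fin (k + 1),
    substVars (fun m : Fin (j.val + 1) => (⟨m.val, by omega⟩ : Fin (k + 1))) (F i j.val) *
    substVars (fun m : Fin (k - j.val + 1) =>
      if m = 0 then 0 else (⟨j.val + m.val, by omega⟩ : Fin (k + 1))) (F (g - i) (k - j.val))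

/-- `x³ z ∑_{j=1}^{k+1} (∂G/∂x_j)(x, x₁, …, x_{j-1}, x, x_j, …, x_k)` for a series `G` in the
variables `x, x₁, …, x_{k+1}`, that is, `∂G/∂x_j` with `x_j` replaced by `x`, then `x_{j+1}` by
`x_j`, …, and `x_{k+1}` by `x_k`. -/
noncomputable def handleTerm {k : ℕ} (G : Series (k + 1)) : Series k :=
  xvar 0 ^ 3 * PowerSeries.X * ∑ j : Fin (k + 1),
    substVars (Fin.insertNth j.succ 0 id) (derivVar j.succ G)

/-- `x² z ∂(x G)/∂x = x³ z ∂G/∂x + x² z G` -/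
noncomputable def crossCapTerm {k : ℕ} (G : Series k) : Series k :=
  xvar 0 ^ 2 * PowerSeries.X * derivVar 0 (xvar 0 * G)

/-- The system of equations for the series `O_{g,k}`. -/
def SystemO (F : ∀ _ k : ℕ, Series k) : Prop :=
  ∀ g k : ℕ, algebraMap (Series k) (Frac k) (F g k) =
    algebraMap (Series k) (Frac k) (c₀ g k) + cubicTerm F g k + markedTerm F g k +
    algebraMap (Series k) (Frac k) (productTerm F g k) +
    algebraMap (Series k) (Frac k)
      (if 1 ≤ g then handleTerm (F (g - 1) (k + 1)) else 0)

/-- The system of equations for the series `Q_{g,k}`. -/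
def SystemQ (F : ∀ _ k : ℕ, Series k) : Prop :=
  ∀ g k : ℕ, algebraMap (Series k) (Frac k) (F g k) =
    algebraMap (Series k) (Frac k) (c₀ g k) + cubicTerm F g k + markedTerm F g k +
    algebraMap (Series k) (Frac k) (productTerm F g k) +
    algebraMap (Series k) (Frac k)
      (if 2 ≤ g then 2 * handleTerm (F (g - 2) (k + 1)) else 0) +
    algebraMap (Series k) (Frac k)
      (if 1 ≤ g then crossCapTerm (F (g - 1) k) else 0)

/-! ## Cubic schemes -/

/-- `M` is a cubic scheme of the surface `S` with `β` boundary components, where the closed surface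
obtained by gluing a disc along each boundary component of `S` is given by `ori` and its Euler
characteristic `χ`: a leaf-rooted map on this closed surface which has `β` faces and all of whose
non-root vertices have degree 3. -/
def IsCubicScheme (ori : Bool) (χ : ℤ) (β : ℕ) {n : ℕ} (M : RootedMap n) : Prop :=
  M.IsOn ori χ ∧ M.faces.ncard = β ∧ degree M.rootVertex = 1 ∧
    ∀ v ∈ M.vertices, v ≠ M.rootVertex → degree v = 3

/-- `a(S)`: the number of cubic schemes of `S`, with any number of edges, up to isomorphism. -/
noncomputable def numCubicSchemes (ori : Bool) (χ : ℤ) (β : ℕ) : ℕ :=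
  Nat.card {M : Σ n, Quotient (RootedMap.isoSetoid n) // IsCubicScheme ori χ β M.2.out}

/-- `[x^1 z^e] F` for a series `F` in the variables `x` and `z`. -/
noncomputable def coeffXZ (e : ℕ) (F : Series 0) : ℚ :=
  MvPolynomial.coeff (Finsupp.single 0 1) (PowerSeries.coeff e F)

end NearCubic

/-! The equations describe the contraction of the root edge. A map is a triple of involutions on its
flags. Contracting the root edge replaces `σ₂` by `σ₀` on its four flags, so that each side of the
edge becomes a stub: two flags exchanged by both involutions. Faces are orbits of `σ₀` and `σ₁`,
hence do not change; the surgery only concerns vertices and orientability.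

Conversely, if the contracted map is connected, it comes from inserting a second stub at some flag
of a map with a stub at the root. Let `d` be the degree of the root-vertex, counting the first stub.
Of its `2d` flags, `d` split this vertex into vertices of degrees `i + 1` and `d - i`, for `i < d`,
and `d` create a twisted loop, which makes the map non-orientable. The `2b` flags of another vertex
of degree `b` merge it into the root-vertex; for an orientable map, half of them preserve
orientability. These outcomes make up `Profile.step` (`sum_profile_ins`) and change the Euler
characteristic by `0`, `-1` and `-2`. If the contracted map has two components, the map is a join of
two smaller ones (`profile_glue`).

Counting is done with labelled edges: the flags are `E × Bool × Bool`, `σ₀` and `σ₂` are standard,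
and only `σ₁` varies. The contraction gives `rootedAt_eq`, a sum over subsets of `E`; restoring a
stub at the root multiplies by the number of flags (`stubbed_option`). Rooted maps are rigid, so
each class has exactly `n! 4 ^ n` labellings (`RootedMap.card_frame`), and dividing by this number
yields a recursion for the profiles of isomorphism classes (`RootedMap.sum_profiles`).

Marks are then added. A vertex split off the root-vertex is either cubic and unmarked, which gives
the term in `z / x`, or a new mark, which gives the divided difference. A vertex merged into the
root-vertex may be regarded as an extra mark of the smaller map (`marks_pick`), which gives the
derivative in a series with `k + 1` marks.

The canonical order is not described combinatorially. `codes` runs the same recursion with lists of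
marks, a new mark being put last, an absorbed mark erased, and lists concatenated in a join.
Forgetting the order gives the actual count of marked maps (`codes_forget`), so classes of maps can
be matched with lists having the same underlying degrees; the marked vertices of a representative
are numbered accordingly, and the numbering is transported along the unique isomorphisms.

The equations then follow monomial by monomial from the recursion (`codeSeries_solution`). The
solution is unique because every term but `c₀` carries a factor `z` (`eq_of_contracting`). For cubic
schemes, the sum of the degrees and Euler's relation determine the number of edges
(`RootedMap.isCubicScheme_iff`). -/

namespace NearCubic

/-! ### Orbits of involutions and the multiset of their sizes -/

section Joined

variable {Y Z : Type*}

/-- `a` and `b` lie in the same orbit of the transformations `α`, `β`, `γ`. -/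
def Joined (α β γ : Y → Y) (a b : Y) : Prop :=
  ∀ p : Y → Prop, (∀ y, p (α y) ↔ p y) → (∀ y, p (β y) ↔ p y) → (∀ y, p (γ y) ↔ p y) → (p a ↔ p b)

variable {α β γ : Y → Y}

theorem Joined.refl (a : Y) : Joined α β γ a a := fun _ _ _ _ => Iff.rfl

theorem Joined.symm {a b : Y} (h : Joined α β γ a b) : Joined α β γ b a :=
  fun p h1 h2 h3 => (h p h1 h2 h3).symm

theorem Joined.trans {a b c : Y} (h : Joined α β γ a b) (h' : Joined α β γ b c) :
    Joined α β γ a c :=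
  fun p h1 h2 h3 => (h p h1 h2 h3).trans (h' p h1 h2 h3)

theorem joined_fst (a : Y) : Joined α β γ a (α a) := fun _ h1 _ _ => (h1 a).symm
theorem joined_snd (a : Y) : Joined α β γ a (β a) := fun _ _ h2 _ => (h2 a).symm
theorem joined_thd (a : Y) : Joined α β γ a (γ a) := fun _ _ _ h3 => (h3 a).symm

theorem joined_congr_right {a b c : Y} (h : Joined α β γ b c) :
    Joined α β γ a b ↔ Joined α β γ a c :=
  ⟨fun h' => h'.trans h, fun h' => h'.trans h.symm⟩

theorem joined_congr_left {a b c : Y} (h : Joined α β γ b c) :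
    Joined α β γ b a ↔ Joined α β γ c a :=
  ⟨fun h' => h.symm.trans h', fun h' => h.trans h'⟩

/-- `p` is a union of orbits. -/
def Saturated (α β γ : Y → Y) (p : Y → Prop) : Prop := ∀ a b, Joined α β γ a b → (p a ↔ p b)

theorem saturated_iff {p : Y → Prop} : Saturated α β γ p ↔
    (∀ y, p (α y) ↔ p y) ∧ (∀ y, p (β y) ↔ p y) ∧ (∀ y, p (γ y) ↔ p y) :=
  ⟨fun h => ⟨fun y => (h _ _ (joined_fst y)).symm, fun y => (h _ _ (joined_snd y)).symm,
    fun y => (h _ _ (joined_thd y)).symm⟩, fun h _ _ hab => hab p h.1 h.2.1 h.2.2⟩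

theorem saturated_of_forward (hα : Function.Involutive α) (hβ : Function.Involutive β)
    (hγ : Function.Involutive γ) {p : Y → Prop} (h1 : ∀ y, p y → p (α y))
    (h2 : ∀ y, p y → p (β y)) (h3 : ∀ y, p y → p (γ y)) : Saturated α β γ p :=
  saturated_iff.2 ⟨fun y => ⟨fun h => by simpa [hα y] using h1 _ h, h1 y⟩,
    fun y => ⟨fun h => by simpa [hβ y] using h2 _ h, h2 y⟩,
    fun y => ⟨fun h => by simpa [hγ y] using h3 _ h, h3 y⟩⟩

theorem saturated_joined (a : Y) : Saturated α β γ (Joined α β γ a) :=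
  fun _ _ h => joined_congr_right h

theorem saturated_true : Saturated α β γ (fun _ => True) := fun _ _ _ => Iff.rfl

theorem Saturated.not {p : Y → Prop} (h : Saturated α β γ p) : Saturated α β γ (fun y => ¬ p y) :=
  fun a b hab => not_congr (h a b hab)

theorem Saturated.and {p q : Y → Prop} (h : Saturated α β γ p) (h' : Saturated α β γ q) :
    Saturated α β γ (fun y => p y ∧ q y) :=
  fun a b hab => and_congr (h a b hab) (h' a b hab)

/-- Orbits are transported by a map which is injective and equivariant on a saturated set. -/
theorem joined_map_iff {α' β' γ' : Z → Z} (hα : Function.Involutive α')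
    (hβ : Function.Involutive β') (hγ : Function.Involutive γ') {ι : Y → Z}
    {p : Y → Prop} (hp : Saturated α β γ p)
    (h1 : ∀ y, p y → α' (ι y) = ι (α y)) (h2 : ∀ y, p y → β' (ι y) = ι (β y))
    (h3 : ∀ y, p y → γ' (ι y) = ι (γ y)) {a : Y} (ha : p a) (z : Z) :
    Joined α' β' γ' (ι a) z ↔ ∃ b, Joined α β γ a b ∧ ι b = z := by
  constructor
  · intro h
    have hs : Saturated α' β' γ' (fun z => ∃ b, Joined α β γ a b ∧ ι b = z) := by
      apply saturated_of_forward hα hβ hγ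
      · rintro _ ⟨b, hb, rfl⟩
        exact ⟨α b, hb.trans (joined_fst b), (h1 b ((hp _ _ hb).1 ha)).symm⟩
      · rintro _ ⟨b, hb, rfl⟩
        exact ⟨β b, hb.trans (joined_snd b), (h2 b ((hp _ _ hb).1 ha)).symm⟩
      · rintro _ ⟨b, hb, rfl⟩
        exact ⟨γ b, hb.trans (joined_thd b), (h3 b ((hp _ _ hb).1 ha)).symm⟩
    exact (hs _ _ h).1 ⟨a, Joined.refl a, rfl⟩
  · rintro ⟨b, hb, rfl⟩ q q1 q2 q3
    obtain ⟨p1, p2, p3⟩ := saturated_iff.1 hp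
    have hb' := (hp _ _ hb).1 ha
    -- The predicate is cut down to `p`, since equivariance of `ι` is only known there.
    have key := hb (fun y => p y ∧ q (ι y))
      (fun y => by rw [p1]; exact and_congr_right fun hy => by rw [← h1 y hy, q1])
      (fun y => by rw [p2]; exact and_congr_right fun hy => by rw [← h2 y hy, q2])
      (fun y => by rw [p3]; exact and_congr_right fun hy => by rw [← h3 y hy, q3])
    simpa [ha, hb'] using key

-- The constant 1 sums to zero modulo 2 over pairs exchanged by the involution.
open Classical in
theorem even_card_of_involution {s : Finset Y} {α : Y → Y} (hα : Function.Involutive α)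
    (hne : ∀ y ∈ s, α y ≠ y) (hs : ∀ y ∈ s, α y ∈ s) : Even s.card := by
  have h : ∑ _y ∈ s, (1 : ZMod 2) = 0 :=
    Finset.sum_involution (fun y _ => α y) (fun _ _ => by decide) (fun y hy _ => hne y hy)
      (fun y hy => hs y hy) (fun y _ => hα y)
  rw [Finset.sum_const, nsmul_one] at h
  exact (ZMod.natCast_eq_zero_iff_even).1 h

section Classes

variable [Fintype Y] [Fintype Z]

open Classical in
/-- The orbit of `a`. -/
noncomputable def cls (α β γ : Y → Y) (a : Y) : Finset Y := Finset.univ.filter (Joined α β γ a)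

@[simp] theorem mem_cls {a b : Y} : b ∈ cls α β γ a ↔ Joined α β γ a b := by simp [cls]

theorem cls_eq_iff {a b : Y} : cls α β γ a = cls α β γ b ↔ Joined α β γ a b := by
  constructor
  · intro h
    have : b ∈ cls α β γ b := mem_cls.2 (Joined.refl b)
    rwa [← h, mem_cls] at this
  · intro h
    ext c
    rw [mem_cls, mem_cls, joined_congr_left h]

open Classical in
/-- The orbits contained in a saturated set. -/
noncomputable def orbits (α β γ : Y → Y) (p : Y → Prop) : Finset (Finset Y) :=
  (Finset.univ.filter p).image (cls α β γ)

theorem mem_orbits {p : Y → Prop} {c : Finset Y} :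
    c ∈ orbits α β γ p ↔ ∃ y, p y ∧ cls α β γ y = c := by
  classical
  simp [orbits]

/-- The multiset of the sizes of the orbits contained in a saturated set. -/
noncomputable def sizes (α β γ : Y → Y) (p : Y → Prop) : Multiset ℕ :=
  (orbits α β γ p).val.map Finset.card

theorem sizes_congr {p q : Y → Prop} (h : ∀ y, p y ↔ q y) : sizes α β γ p = sizes α β γ q := by
  rw [show p = q from funext fun y => propext (h y)]

theorem sizes_or {p q r : Y → Prop} (hr : ∀ y, r y ↔ p y ∨ q y)
    (hd : ∀ a b, p a → q b → ¬ Joined α β γ a b) :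
    sizes α β γ r = sizes α β γ p + sizes α β γ q := by
  classical
  have h : orbits α β γ r = (orbits α β γ p).disjUnion (orbits α β γ q) (by
      rw [Finset.disjoint_left]
      intro c hc hc'
      obtain ⟨a, ha, rfl⟩ := mem_orbits.1 hc
      obtain ⟨b, hb, hab⟩ := mem_orbits.1 hc'
      exact hd a b ha hb (cls_eq_iff.1 hab.symm)) := by
    ext c
    simp only [Finset.mem_disjUnion, mem_orbits, hr]
    constructor
    · rintro ⟨y, h | h, rfl⟩
      exacts [Or.inl ⟨y, h, rfl⟩, Or.inr ⟨y, h, rfl⟩]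
    · rintro (⟨y, h, rfl⟩ | ⟨y, h, rfl⟩)
      exacts [⟨y, Or.inl h, rfl⟩, ⟨y, Or.inr h, rfl⟩]
  rw [sizes, h, Finset.disjUnion_val, Multiset.map_add, sizes, sizes]

theorem sizes_joined (a : Y) : sizes α β γ (Joined α β γ a) = {(cls α β γ a).card} := by
  have h : orbits α β γ (Joined α β γ a) = {cls α β γ a} := by
    ext c
    rw [mem_orbits, Finset.mem_singleton]
    constructor
    · rintro ⟨y, h, rfl⟩
      exact (cls_eq_iff.2 h).symm
    · rintro rfl
      exact ⟨a, Joined.refl a, rfl⟩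
  rw [sizes, h]
  rfl

theorem sizes_false {p : Y → Prop} (h : ∀ y, ¬ p y) : sizes α β γ p = 0 := by
  have h : orbits α β γ p = ∅ := by
    ext c
    simp [mem_orbits, h]
  rw [sizes, h]
  rfl

/-- The orbits in a saturated set, one of them being singled out. -/
theorem sizes_eq_cons {p : Y → Prop} (hp : Saturated α β γ p) {a : Y} (ha : p a) :
    sizes α β γ p = (cls α β γ a).card ::ₘ sizes α β γ (fun y => p y ∧ ¬ Joined α β γ a y) := by
  rw [sizes_or (p := Joined α β γ a) (q := fun y => p y ∧ ¬ Joined α β γ a y), sizes_joined,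
    Multiset.singleton_add]
  · intro y
    constructor
    · intro h
      by_cases h' : Joined α β γ a y
      exacts [Or.inl h', Or.inr ⟨h, h'⟩]
    · rintro (h | h)
      exacts [(hp _ _ h).1 ha, h.1]
  · intro b c h1 h2 h3
    exact h2.2 (h1.trans h3)

/-- A surgery alters the involutions at a few flags only. On the orbits avoiding these flags the
inclusion is equivariant, and their sizes carry over. -/
theorem sizes_map {α' β' γ' : Z → Z} (hα : Function.Involutive α')
    (hβ : Function.Involutive β') (hγ : Function.Involutive γ') {ι : Y → Z}
    (hι : Function.Injective ι) {p : Y → Prop} {q : Z → Prop} (hp : Saturated α β γ p)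
    (h1 : ∀ y, p y → α' (ι y) = ι (α y)) (h2 : ∀ y, p y → β' (ι y) = ι (β y))
    (h3 : ∀ y, p y → γ' (ι y) = ι (γ y)) (hq : ∀ z, q z ↔ ∃ y, p y ∧ ι y = z) :
    sizes α' β' γ' q = sizes α β γ p := by
  classical
  have hc : ∀ a, p a → cls α' β' γ' (ι a) = (cls α β γ a).map ⟨ι, hι⟩ := by
    intro a ha
    ext z
    simp [joined_map_iff hα hβ hγ hp h1 h2 h3 ha z]
  have h : orbits α' β' γ' q = (orbits α β γ p).map
      ⟨fun c => c.map ⟨ι, hι⟩, Finset.map_injective _⟩ := by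
    ext c
    simp only [Finset.mem_map, mem_orbits, hq, Function.Embedding.coeFn_mk]
    constructor
    · rintro ⟨_, ⟨y, hy, rfl⟩, rfl⟩
      exact ⟨_, ⟨y, hy, rfl⟩, (hc y hy).symm⟩
    · rintro ⟨_, ⟨y, hy, rfl⟩, rfl⟩
      exact ⟨_, ⟨y, hy, rfl⟩, hc y hy⟩
  rw [sizes, h, sizes]
  simp

theorem card_cls_map {α' β' γ' : Z → Z} (hα : Function.Involutive α')
    (hβ : Function.Involutive β') (hγ : Function.Involutive γ') {ι : Y → Z}
    (hι : Function.Injective ι) {p : Y → Prop} (hp : Saturated α β γ p)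
    (h1 : ∀ y, p y → α' (ι y) = ι (α y)) (h2 : ∀ y, p y → β' (ι y) = ι (β y))
    (h3 : ∀ y, p y → γ' (ι y) = ι (γ y)) {a : Y} (ha : p a) :
    cls α' β' γ' (ι a) = (cls α β γ a).map ⟨ι, hι⟩ := by
  classical
  ext z
  simp [joined_map_iff hα hβ hγ hp h1 h2 h3 ha z]

-- Turns a sum over flags into a sum over vertices when the contribution of a vertex depends on its
-- size alone.
open Classical in
theorem sum_by_orbits {M : Type*} [AddCommMonoid M] {p : Y → Prop} (hp : Saturated α β γ p)
    (h : Y → M) (H : ℕ → M)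
    (hH : ∀ y, p y → ∑ f ∈ cls α β γ y, h f = H (cls α β γ y).card) :
    ∑ f ∈ Finset.univ.filter p, h f = ((sizes α β γ p).map H).sum := by
  rw [sizes, Multiset.map_map, ← Finset.sum_fiberwise_of_maps_to (t := orbits α β γ p)
    (g := cls α β γ) (fun y hy => mem_orbits.2 ⟨y, (Finset.mem_filter.1 hy).2, rfl⟩)]
  refine Finset.sum_congr rfl fun c hc => ?_
  obtain ⟨y, hy, rfl⟩ := mem_orbits.1 hc
  rw [Function.comp_apply, ← hH y hy]
  refine Finset.sum_congr ?_ fun _ _ => rfl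
  ext f
  simp only [Finset.mem_filter, Finset.mem_univ, true_and, mem_cls, cls_eq_iff]
  exact ⟨fun hf => hf.2.symm, fun hf => ⟨(hp _ _ hf).1 hy, hf.symm⟩⟩

theorem even_card_cls (hα : Function.Involutive α) (hne : ∀ y, α y ≠ y) (a : Y) :
    Even (cls α β γ a).card :=
  even_card_of_involution hα (fun y _ => hne y)
    (fun y hy => mem_cls.2 ((mem_cls.1 hy).trans (joined_fst y)))

end Classes

end Joined

/-! ## Profiles -/

/-- Orientability, number of faces, degree of the root-vertex and degrees of the other vertices of
a rooted map. -/
@[ext] structure Profile where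
  ori : Bool
  faces : ℕ
  deg : ℕ
  others : Multiset ℕ

section Profile

variable {Y Z : Type*}

/-- A 2-colouring of the flags exchanged by `σ₀`, `σ₁`, `σ₂`. -/
def IsColouring (σ₀ σ₁ σ₂ : Y → Y) (col : Y → Bool) : Prop :=
  ∀ y, col (σ₀ y) = !col y ∧ col (σ₁ y) = !col y ∧ col (σ₂ y) = !col y

/-- All flags are joined to `y`. -/
def Connected (σ₀ σ₁ σ₂ : Y → Y) (y : Y) : Prop := ∀ z, Joined σ₀ σ₁ σ₂ y z

/-- The set where two colourings agree is stable under the three involutions. On a connected map the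
colouring is thus unique up to exchanging the colours. -/
theorem IsColouring.eq_or_eq_not {σ₀ σ₁ σ₂ : Y → Y} {col col' : Y → Bool}
    (h : IsColouring σ₀ σ₁ σ₂ col) (h' : IsColouring σ₀ σ₁ σ₂ col') {a b : Y}
    (hab : Joined σ₀ σ₁ σ₂ a b) : (col a = col' a ↔ col b = col' b) := by
  refine hab (fun y => col y = col' y) ?_ ?_ ?_
  · intro y; rw [(h y).1, (h' y).1]; simp
  · intro y; rw [(h y).2.1, (h' y).2.1]; simp
  · intro y; rw [(h y).2.2, (h' y).2.2]; simp

theorem connected_equiv (e : Y ≃ Z) {σ₀ σ₁ σ₂ : Y → Y} {τ₀ τ₁ τ₂ : Z → Z}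
    (i₀ : Function.Involutive τ₀) (i₁ : Function.Involutive τ₁) (i₂ : Function.Involutive τ₂)
    (h₀ : ∀ y, τ₀ (e y) = e (σ₀ y)) (h₁ : ∀ y, τ₁ (e y) = e (σ₁ y))
    (h₂ : ∀ y, τ₂ (e y) = e (σ₂ y)) (y : Y) :
    Connected τ₀ τ₁ τ₂ (e y) ↔ Connected σ₀ σ₁ σ₂ y := by
  have hj : ∀ z, Joined τ₀ τ₁ τ₂ (e y) (e z) ↔ Joined σ₀ σ₁ σ₂ y z := by
    intro z
    rw [joined_map_iff i₀ i₁ i₂ saturated_true (fun y _ => h₀ y) (fun y _ => h₁ y)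
      (fun y _ => h₂ y) trivial]
    simp
  constructor
  · intro h z
    exact (hj z).1 (h (e z))
  · intro h z
    obtain ⟨y, rfl⟩ := e.surjective z
    exact (hj y).2 (h y)

variable [Fintype Y] [Fintype Z]

open Classical in
/-- The profile of the map with flags `Y` whose root-vertex is the one at `y`. -/
noncomputable def profile (σ₀ σ₁ σ₂ : Y → Y) (y : Y) : Profile where
  ori := decide (∃ col, IsColouring σ₀ σ₁ σ₂ col)
  faces := (sizes σ₁ σ₀ σ₀ (fun _ => True)).card
  deg := (cls σ₁ σ₂ σ₂ y).card / 2
  others := (sizes σ₁ σ₂ σ₂ (fun z => ¬ Joined σ₁ σ₂ σ₂ y z)).map (· / 2)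

theorem profile_ori (σ₀ σ₁ σ₂ : Y → Y) (y : Y) :
    (profile σ₀ σ₁ σ₂ y).ori = true ↔ ∃ col, IsColouring σ₀ σ₁ σ₂ col := by
  simp [profile]

theorem profile_equiv (e : Y ≃ Z) {σ₀ σ₁ σ₂ : Y → Y} {τ₀ τ₁ τ₂ : Z → Z}
    (i₀ : Function.Involutive τ₀) (i₁ : Function.Involutive τ₁) (i₂ : Function.Involutive τ₂)
    (h₀ : ∀ y, τ₀ (e y) = e (σ₀ y)) (h₁ : ∀ y, τ₁ (e y) = e (σ₁ y))
    (h₂ : ∀ y, τ₂ (e y) = e (σ₂ y)) (y : Y) :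
    profile τ₀ τ₁ τ₂ (e y) = profile σ₀ σ₁ σ₂ y := by
  have hj : ∀ z, Joined τ₁ τ₂ τ₂ (e y) (e z) ↔ Joined σ₁ σ₂ σ₂ y z := by
    intro z
    rw [joined_map_iff i₁ i₂ i₂ saturated_true (fun y _ => h₁ y) (fun y _ => h₂ y)
      (fun y _ => h₂ y) trivial]
    simp
  ext1
  · simp only [profile, decide_eq_decide]
    constructor
    · rintro ⟨col, h⟩
      refine ⟨fun y => col (e y), fun y => ?_⟩
      have h' := h (e y)
      rw [h₀, h₁, h₂] at h'
      exact h'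
    · rintro ⟨col, h⟩
      refine ⟨fun z => col (e.symm z), fun z => ?_⟩
      obtain ⟨y, rfl⟩ := e.surjective z
      rw [h₀, h₁, h₂]
      simpa using h y
  · simp only [profile]
    rw [sizes_map i₁ i₀ i₀ e.injective saturated_true (fun y _ => h₁ y) (fun y _ => h₀ y)
      (fun y _ => h₀ y) (fun z => ⟨fun _ => ⟨e.symm z, trivial, by simp⟩, fun _ => trivial⟩)]
  · simp only [profile]
    rw [card_cls_map i₁ i₂ i₂ e.injective saturated_true (fun y _ => h₁ y) (fun y _ => h₂ y)
      (fun y _ => h₂ y) (a := y) trivial, Finset.card_map]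
  · simp only [profile]
    rw [sizes_map i₁ i₂ i₂ e.injective (saturated_joined y).not (fun y _ => h₁ y) (fun y _ => h₂ y)
      (fun y _ => h₂ y)]
    intro z
    obtain ⟨y, rfl⟩ := e.surjective z
    simp [hj]

end Profile


/-! ### Walking around a vertex -/

section Dihedral

variable {Y : Type*} {σ τ : Y → Y}

/-- Two flags exchanged by `a` in a cycle alternating between `σ` and `α` remain joined when the
link between them is removed. -/
theorem parity_of_two_involutions [Fintype Y] (hσ : Function.Involutive σ) (nσ : ∀ y, σ y ≠ y)
    (hτ : Function.Involutive τ) (nτ : ∀ y, τ y ≠ y) {q : Y → Prop} {a : Y}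
    (h1 : ∀ z, q (σ z) ↔ q z) (h2 : ∀ z, z ≠ a → z ≠ τ a → (q (τ z) ↔ q z)) : q a ↔ q (τ a) := by
  classical
  have e : Even (Finset.univ.filter q).card :=
    even_card_of_involution hσ (fun y _ => nσ y) (fun y hy => by simpa [h1] using hy)
  -- If `b` satisfied `q` and `τ b` did not, `τ` would pair off the set cut out by `q` without `b`,
  -- while `σ` pairs off the whole set: two consecutive numbers would be even.
  have key : ∀ b, (∀ z, z ≠ b → z ≠ τ b → (q (τ z) ↔ q z)) → q b → q (τ b) := by
    intro b hb qb
    by_contra hn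
    have e' : Even ((Finset.univ.filter q).erase b).card := by
      apply even_card_of_involution hτ (fun y _ => nτ y)
      intro y hy
      simp only [Finset.mem_erase, Finset.mem_filter, Finset.mem_univ, true_and] at hy ⊢
      have hy' : y ≠ τ b := by rintro rfl; exact hn hy.2
      exact ⟨fun h => hy' (by rw [← h, hτ]), (hb y hy.1 hy').2 hy.2⟩
    have hb' : b ∈ Finset.univ.filter q := by simpa using qb
    have := Finset.card_erase_add_one hb'
    rw [← this] at e
    exact (Nat.even_add_one.1 e) e'
  refine ⟨key a h2, fun h => ?_⟩
  have := key (τ a) (fun z h3 h4 => h2 z (by rwa [hτ] at h4) h3) h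
  rwa [hτ] at this

/-- The number of flags at distance two steps of each other around the vertex at `y`, that is,
the degree of this vertex. -/
noncomputable def period (σ τ : Y → Y) (y : Y) : ℕ := Function.minimalPeriod (τ ∘ σ) y

/-- The flags met when turning around a vertex, every other one. -/
def turn (σ τ : Y → Y) (y : Y) (l : ℕ) : Y := (τ ∘ σ)^[l] y

theorem turn_zero (y : Y) : turn σ τ y 0 = y := rfl

theorem turn_succ (y : Y) (l : ℕ) : turn σ τ y (l + 1) = τ (σ (turn σ τ y l)) := by
  rw [turn, Function.iterate_succ_apply']; rfl

theorem turn_add (y : Y) (i j : ℕ) : turn σ τ y (i + j) = turn σ τ (turn σ τ y j) i :=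
  Function.iterate_add_apply _ _ _ _

theorem period_pos [Finite Y] (hσ : Function.Involutive σ) (hτ : Function.Involutive τ) (y : Y) :
    0 < period σ τ y :=
  Function.minimalPeriod_pos_of_mem_periodicPts
    (Function.Injective.mem_periodicPts (hτ.injective.comp hσ.injective) y)

theorem turn_period (y : Y) : turn σ τ y (period σ τ y) = y :=
  Function.iterate_minimalPeriod

theorem turn_injOn {y : Y} {i j : ℕ} (hi : i < period σ τ y) (hj : j < period σ τ y)
    (h : turn σ τ y i = turn σ τ y j) : i = j :=
  Function.iterate_injOn_Iio_minimalPeriod hi hj h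

/-- A reflection never acts as a rotation. The equality for `N + 2` at `y` is the equality for `N`
at `τ (σ y)`, and descent by two ends with a fixed point of `σ` or of `τ`. -/
theorem involution_ne_iterate (hσ : Function.Involutive σ) (nσ : ∀ y, σ y ≠ y)
    (hτ : Function.Involutive τ) (nτ : ∀ y, τ y ≠ y) (N : ℕ) :
    ∀ y, σ y ≠ turn σ τ y N := by
  induction N using Nat.strong_induction_on with
  | _ N ih =>
    match N with
    | 0 => exact nσ
    | 1 => intro y h; exact nτ (σ y) h.symm
    | N + 2 =>
      intro y h
      rw [turn_succ, turn, Function.iterate_succ_apply] at h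
      apply ih N (by omega) ((τ ∘ σ) y)
      rw [turn]
      have h2 := congrArg (fun z => σ (τ z)) h
      simp only [hτ _, hσ _] at h2
      exact h2

theorem turn_ne (hσ : Function.Involutive σ) (nσ : ∀ y, σ y ≠ y)
    (hτ : Function.Involutive τ) (nτ : ∀ y, τ y ≠ y) {y : Y} {i j : ℕ} :
    turn σ τ y i ≠ σ (turn σ τ y j) := by
  intro h
  rcases le_total j i with hij | hij
  · obtain ⟨d, rfl⟩ := Nat.exists_eq_add_of_le hij
    apply involution_ne_iterate hσ nσ hτ nτ d (turn σ τ y j)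
    rw [← h, add_comm, turn_add]
  · obtain ⟨d, rfl⟩ := Nat.exists_eq_add_of_le hij
    apply involution_ne_iterate hσ nσ hτ nτ d (turn σ τ y i)
    rw [← turn_add, add_comm d i, ← hσ (turn σ τ y (i + d)), ← h]

theorem joined_turn (y : Y) (l : ℕ) : Joined σ τ τ y (turn σ τ y l) := by
  induction l with
  | zero => exact Joined.refl y
  | succ l ih =>
    rw [turn_succ]
    exact (ih.trans (joined_fst _)).trans (joined_snd _)

theorem exists_turn_eq [Finite Y] (hσ : Function.Involutive σ) (hτ : Function.Involutive τ) (y : Y) {i : ℕ} :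
    ∃ j < period σ τ y, turn σ τ y j = turn σ τ y i :=
  ⟨i % period σ τ y, Nat.mod_lt _ (period_pos hσ hτ y), Function.iterate_mod_minimalPeriod_eq⟩

theorem joined_iff_turn [Finite Y] (hσ : Function.Involutive σ) (hτ : Function.Involutive τ) (y z : Y) :
    Joined σ τ τ y z ↔
      ∃ l < period σ τ y, z = turn σ τ y l ∨ z = σ (turn σ τ y l) := by
  have hpos := period_pos hσ hτ y
  constructor
  · intro h
    have hτ' : ∀ z, (∃ l < period σ τ y, z = turn σ τ y l ∨ z = σ (turn σ τ y l)) →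
        ∃ l < period σ τ y, τ z = turn σ τ y l ∨ τ z = σ (turn σ τ y l) := by
      rintro z ⟨l, hl, rfl | rfl⟩
      -- From `y` itself, `τ` leads backwards to the end of the walk.
      · rcases l with _ | l
        · refine ⟨period σ τ y - 1, by omega, Or.inr ?_⟩
          have h1 : turn σ τ y (period σ τ y - 1 + 1) = y := by
            rw [Nat.sub_add_cancel hpos, turn_period]
          rw [turn_succ] at h1
          rw [turn_zero]
          nth_rewrite 1 [← h1]
          rw [hτ]
        · exact ⟨l, by omega, Or.inr (by rw [turn_succ, hτ])⟩
      · obtain ⟨j, hj, h'⟩ := exists_turn_eq hσ hτ y (i := l + 1)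
        exact ⟨j, hj, Or.inl (by rw [h', turn_succ])⟩
    have hs : Saturated σ τ τ
        (fun z => ∃ l < period σ τ y, z = turn σ τ y l ∨ z = σ (turn σ τ y l)) := by
      apply saturated_of_forward hσ hτ hτ _ hτ' hτ'
      rintro z ⟨l, hl, rfl | rfl⟩
      · exact ⟨l, hl, Or.inr rfl⟩
      · exact ⟨l, hl, Or.inl (hσ _)⟩
    exact (hs _ _ h).1 ⟨0, hpos, Or.inl rfl⟩
  · rintro ⟨l, -, rfl | rfl⟩
    · exact joined_turn y l
    · exact (joined_turn y l).trans (joined_fst _)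

/-- A vertex has as many flags reached by rotations as by a rotation followed by `σ`. The two
families have opposite local orientations; later they separate untwisted from twisted insertions. -/
theorem sum_cls_eq [Fintype Y] {M : Type*} [AddCommMonoid M] (hσ : Function.Involutive σ) (nσ : ∀ y, σ y ≠ y)
    (hτ : Function.Involutive τ) (nτ : ∀ y, τ y ≠ y) (y : Y) (h : Y → M) :
    ∑ f ∈ cls σ τ τ y, h f = ∑ l ∈ Finset.range (period σ τ y), h (turn σ τ y l) +
      ∑ l ∈ Finset.range (period σ τ y), h (σ (turn σ τ y l)) := by
  classical
  have i1 : Set.InjOn (turn σ τ y) (Finset.range (period σ τ y)) := by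
    intro i hi j hj hij
    exact turn_injOn (by simpa using hi) (by simpa using hj) hij
  have i2 : Set.InjOn (fun l => σ (turn σ τ y l)) (Finset.range (period σ τ y)) := by
    intro i hi j hj hij
    exact i1 hi hj (hσ.injective hij)
  have e : cls σ τ τ y = (Finset.range (period σ τ y)).image (turn σ τ y) ∪
      (Finset.range (period σ τ y)).image (fun l => σ (turn σ τ y l)) := by
    ext z
    rw [mem_cls, joined_iff_turn hσ hτ]
    simp only [Finset.mem_union, Finset.mem_image, Finset.mem_range]
    constructor
    · rintro ⟨l, hl, rfl | rfl⟩
      exacts [Or.inl ⟨l, hl, rfl⟩, Or.inr ⟨l, hl, rfl⟩]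
    · rintro (⟨l, hl, rfl⟩ | ⟨l, hl, rfl⟩)
      exacts [⟨l, hl, Or.inl rfl⟩, ⟨l, hl, Or.inr rfl⟩]
  rw [e, Finset.sum_union, Finset.sum_image i1, Finset.sum_image i2]
  rw [Finset.disjoint_left]
  intro z hz hz'
  obtain ⟨i, -, rfl⟩ := Finset.mem_image.1 hz
  obtain ⟨j, -, hj⟩ := Finset.mem_image.1 hz'
  exact turn_ne hσ nσ hτ nτ hj.symm

theorem card_cls_eq [Fintype Y] (hσ : Function.Involutive σ) (nσ : ∀ y, σ y ≠ y)
    (hτ : Function.Involutive τ) (nτ : ∀ y, τ y ≠ y) (y : Y) :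
    (cls σ τ τ y).card = 2 * period σ τ y := by
  rw [Finset.card_eq_sum_ones, sum_cls_eq hσ nσ hτ nτ]
  simp [two_mul]

/-- The last flag met before coming back to `y`. -/
theorem turn_last [Finite Y] (hσ : Function.Involutive σ) (hτ : Function.Involutive τ) (y : Y) :
    σ (turn σ τ y (period σ τ y - 1)) = τ y := by
  have h1 : turn σ τ y (period σ τ y - 1 + 1) = y := by
    rw [Nat.sub_add_cancel (period_pos hσ hτ y), turn_period]
  rw [turn_succ] at h1
  rw [← hτ (σ _), h1]

/-- A colouring alternates around a vertex. -/
theorem colour_turn {col : Y → Bool} (h1 : ∀ y, col (σ y) = !col y) (h2 : ∀ y, col (τ y) = !col y)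
    (y : Y) (l : ℕ) : col (turn σ τ y l) = col y := by
  induction l with
  | zero => rfl
  | succ l ih => rw [turn_succ, h2, h1, ih, Bool.not_not]

end Dihedral

/-! ## Inserting a stub -/

section Stub

variable {Y : Type*}

/-- The fixed-point-free involutions of `Y`. -/
abbrev Inv (Y : Type*) : Type _ := {σ : Y → Y // Function.Involutive σ ∧ ∀ y, σ y ≠ y}

noncomputable instance [Finite Y] : Fintype (Inv Y) :=
  haveI : Finite (Inv Y) := Subtype.finite
  Fintype.ofFinite _

theorem Inv.invol (σ : Inv Y) : Function.Involutive σ.1 := σ.2.1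
theorem Inv.ne (σ : Inv Y) (y : Y) : σ.1 y ≠ y := σ.2.2 y

/-- The extension of `τ` to two more flags, exchanged with each other. -/
def stub (τ : Y → Y) : Y ⊕ Bool → Y ⊕ Bool := Sum.map τ not

@[simp] theorem stub_inl (τ : Y → Y) (y : Y) : stub τ (Sum.inl y) = Sum.inl (τ y) := rfl
@[simp] theorem stub_inr (τ : Y → Y) (b : Bool) : stub τ (Sum.inr b) = Sum.inr (!b) := rfl

theorem stub_involutive {τ : Y → Y} (h : Function.Involutive τ) :
    Function.Involutive (stub τ) := by
  rintro (y | b)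
  · simp [h y]
  · simp

theorem stub_ne {τ : Y → Y} (h : ∀ y, τ y ≠ y) (y : Y ⊕ Bool) : stub τ y ≠ y := by
  rcases y with y | b
  · simpa using h y
  · simp

open Classical in
/-- Insertion of the two flags of a stub between `f` and `σ f`. -/
noncomputable def insFun (σ : Y → Y) (f : Y) : Y ⊕ Bool → Y ⊕ Bool
  | Sum.inl y => if y = f then Sum.inr false else if y = σ f then Sum.inr true else Sum.inl (σ y)
  | Sum.inr b => Sum.inl (bif b then σ f else f)

@[simp] theorem insFun_inr (σ : Y → Y) (f : Y) (b : Bool) :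
    insFun σ f (Sum.inr b) = Sum.inl (bif b then σ f else f) := rfl

theorem insFun_self (σ : Y → Y) (f : Y) : insFun σ f (Sum.inl f) = Sum.inr false := by
  simp [insFun]

theorem insFun_image {σ : Y → Y} {f : Y} (h : σ f ≠ f) :
    insFun σ f (Sum.inl (σ f)) = Sum.inr true := by
  simp [insFun, h]

theorem insFun_of_ne {σ : Y → Y} {f y : Y} (h : y ≠ f) (h' : y ≠ σ f) :
    insFun σ f (Sum.inl y) = Sum.inl (σ y) := by
  simp [insFun, h, h']

/-- Insertion of a stub in a fixed-point-free involution. -/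
noncomputable def ins (σ : Inv Y) (f : Y) : Inv (Y ⊕ Bool) :=
  ⟨insFun σ.1 f, by
    rintro (y | b)
    · by_cases h : y = f
      · subst h; rw [insFun_self, insFun_inr]; rfl
      · by_cases h' : y = σ.1 f
        · subst h'; rw [insFun_image (σ.ne f), insFun_inr]; rfl
        · rw [insFun_of_ne h h', insFun_of_ne, σ.invol]
          · rintro rfl; exact h' (σ.invol y).symm
          · exact fun h1 => h (σ.invol.injective h1)
    · cases b
      · rw [insFun_inr]; exact insFun_self _ _
      · rw [insFun_inr]; exact insFun_image (σ.ne f), by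
    rintro (y | b)
    · by_cases h : y = f
      · subst h; rw [insFun_self]; simp
      · by_cases h' : y = σ.1 f
        · subst h'; rw [insFun_image (σ.ne f)]; simp
        · rw [insFun_of_ne h h']; simpa using σ.ne y
    · simp⟩

theorem ins_val (σ : Inv Y) (f : Y) : (ins σ f).1 = insFun σ.1 f := rfl

/-- A stub whose flags are not exchanged with each other sits in a corner: the partners `f` and `g`
of its two flags become exchanged when it is removed, and `f` remembers the place. -/
theorem ins_bijective : Function.Bijective (fun q : Inv Y × Y =>
    (⟨ins q.1 q.2, by simp [ins_val]⟩ :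
      {σ : Inv (Y ⊕ Bool) // σ.1 (Sum.inr false) ≠ Sum.inr true})) := by
  constructor
  · rintro ⟨σ, f⟩ ⟨σ', f'⟩ h
    have h1 : ∀ z, insFun σ.1 f z = insFun σ'.1 f' z := fun z =>
      congrFun (congrArg Subtype.val (congrArg Subtype.val h)) z
    have hf : f = f' := by simpa using h1 (Sum.inr false)
    subst hf
    have hf' : σ.1 f = σ'.1 f := by simpa using h1 (Sum.inr true)
    congr 1
    apply Subtype.ext
    funext y
    by_cases h2 : y = f
    · rw [h2, hf']
    · by_cases h3 : y = σ.1 f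
      · rw [h3, σ.invol, hf', σ'.invol]
      · have := h1 (Sum.inl y)
        rw [insFun_of_ne h2 h3, insFun_of_ne h2 (hf' ▸ h3)] at this
        exact Sum.inl.inj this
  · rintro ⟨⟨ω, hω, nω⟩, hne⟩
    have h0 : ∃ f, ω (Sum.inr false) = Sum.inl f := by
      rcases h : ω (Sum.inr false) with f | b
      · exact ⟨f, rfl⟩
      · cases b
        · exact absurd h (nω _)
        · exact absurd h hne
    have h1 : ∃ f, ω (Sum.inr true) = Sum.inl f := by
      rcases h : ω (Sum.inr true) with f | b
      · exact ⟨f, rfl⟩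
      · cases b
        · exact absurd (h ▸ hω (Sum.inr true)) hne
        · exact absurd h (nω _)
    obtain ⟨f, h0⟩ := h0
    obtain ⟨g, h1⟩ := h1
    have h0' : ω (Sum.inl f) = Sum.inr false := by rw [← h0, hω]
    have h1' : ω (Sum.inl g) = Sum.inr true := by rw [← h1, hω]
    have hfg : g ≠ f := by rintro rfl; rw [h0'] at h1'; simp at h1'
    have h2 : ∀ y, y ≠ f → y ≠ g → ∃ y', ω (Sum.inl y) = Sum.inl y' := by
      intro y hy hy'
      rcases h : ω (Sum.inl y) with y' | b
      · exact ⟨y', rfl⟩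
      · exfalso
        have h3 := hω (Sum.inl y)
        rw [h] at h3
        cases b
        · rw [h0] at h3; exact hy (Sum.inl.inj h3).symm
        · rw [h1] at h3; exact hy' (Sum.inl.inj h3).symm
    choose! ρ hρ using h2
    classical
    have hρ' : ∀ y, y ≠ f → y ≠ g → ρ y ≠ f ∧ ρ y ≠ g ∧ ρ (ρ y) = y ∧ ρ y ≠ y := by
      intro y hy hy'
      have h3 := hρ y hy hy'
      have h4 := hω (Sum.inl y)
      rw [h3] at h4
      have a1 : ρ y ≠ f := by intro h; rw [h, h0'] at h4; simp at h4
      have a2 : ρ y ≠ g := by intro h; rw [h, h1'] at h4; simp at h4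
      refine ⟨a1, a2, ?_, ?_⟩
      · rw [hρ _ a1 a2] at h4; exact Sum.inl.inj h4
      · intro h; rw [h] at h3; exact nω _ h3
    let σ : Y → Y := fun y => if y = f then g else if y = g then f else ρ y
    have sf : σ f = g := by simp [σ]
    have sg : σ g = f := by simp [σ, hfg]
    have sy : ∀ y, y ≠ f → y ≠ g → σ y = ρ y := fun y h h' => by simp [σ, h, h']
    have hσ : Function.Involutive σ ∧ ∀ y, σ y ≠ y := by
      constructor
      · intro y
        by_cases hy : y = f
        · rw [hy, sf, sg]
        · by_cases hy' : y = g
          · rw [hy', sg, sf]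
          · obtain ⟨a1, a2, a3, -⟩ := hρ' y hy hy'
            rw [sy y hy hy', sy _ a1 a2, a3]
      · intro y
        by_cases hy : y = f
        · rw [hy, sf]; exact hfg
        · by_cases hy' : y = g
          · rw [hy', sg]; exact hfg.symm
          · rw [sy y hy hy']; exact (hρ' y hy hy').2.2.2
    refine ⟨(⟨σ, hσ⟩, f), ?_⟩
    apply Subtype.ext
    apply Subtype.ext
    funext z
    change insFun σ f z = ω z
    rcases z with y | b
    · by_cases hy : y = f
      · rw [hy, insFun_self, h0']
      · by_cases hy' : y = g
        · rw [hy', ← sf, insFun_image (hσ.2 f), sf, h1']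
        · rw [insFun_of_ne hy (by rwa [sf]), sy y hy hy', hρ y hy hy']
    · cases b
      · rw [insFun_inr, h0]; rfl
      · rw [insFun_inr, h1]; exact congrArg Sum.inl sf

variable {τ τ' : Y → Y} (σ : Inv Y) (f : Y)

/-- The detour through the stub replaces the link cut between `f` and `σ f`. Conversely, an
invariant predicate extends to the stub by its value at `f`. -/
theorem joined_ins_inl {a b : Y} :
    Joined (ins σ f).1 (stub τ) (stub τ') (Sum.inl a) (Sum.inl b) ↔ Joined σ.1 τ τ' a b := by
  constructor
  · intro h p p1 p2 p3
    refine h (Sum.elim p (fun _ => p f)) ?_ ?_ ?_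
    · rintro (y | c)
      · by_cases hy : y = f
        · rw [hy, ins_val, insFun_self]; rfl
        · by_cases hy' : y = σ.1 f
          · rw [hy', ins_val, insFun_image (σ.ne f)]; exact (p1 f).symm
          · rw [ins_val, insFun_of_ne hy hy']; exact p1 y
      · cases c
        · exact Iff.rfl
        · exact p1 f
    · rintro (y | c)
      · exact p2 y
      · exact Iff.rfl
    · rintro (y | c)
      · exact p3 y
      · exact Iff.rfl
  · intro h p p1 p2 p3
    refine h (fun y => p (Sum.inl y)) ?_ (fun y => p2 (Sum.inl y)) (fun y => p3 (Sum.inl y))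
    have hf : p (Sum.inl f) ↔ p (Sum.inl (σ.1 f)) := by
      have h1 := p1 (Sum.inr false)
      have h2 := p1 (Sum.inr true)
      have h3 := p2 (Sum.inr true)
      rw [ins_val, insFun_inr] at h1 h2
      rw [stub_inr] at h3
      exact h1.trans (h3.trans h2.symm)
    intro y
    by_cases hy : y = f
    · subst hy; exact hf.symm
    · by_cases hy' : y = σ.1 f
      · subst hy'; rw [σ.invol]; exact hf
      · have := p1 (Sum.inl y)
        rwa [ins_val, insFun_of_ne hy hy'] at this

theorem joined_ins_stub : Joined (ins σ f).1 (stub τ) (stub τ') (Sum.inr false) (Sum.inl f) :=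
  joined_fst (α := (ins σ f).1) (Sum.inr false)

theorem joined_stub (ω : Y ⊕ Bool → Y ⊕ Bool) (b c : Bool) :
    Joined ω (stub τ) (stub τ') (Sum.inr b) (Sum.inr c) := by
  by_cases h : b = c
  · rw [h]; exact Joined.refl _
  · have : c = !b := by cases b <;> cases c <;> simp_all
    rw [this]
    exact joined_snd (β := stub τ) (Sum.inr b)

theorem joined_ins_inr {a : Y} {b : Bool} :
    Joined (ins σ f).1 (stub τ) (stub τ') (Sum.inr b) (Sum.inl a) ↔ Joined σ.1 τ τ' f a := by
  rw [joined_congr_left ((joined_stub _ b false).trans (joined_ins_stub σ f)), joined_ins_inl]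

theorem connected_ins_iff {τ₀ τ₂ : Y → Y} (y : Y) :
    Connected (stub τ₀) (ins σ f).1 (stub τ₂) (Sum.inl y) ↔ Connected τ₀ σ.1 τ₂ y := by
  -- The preceding lemmas have the varying involution in first position, connectedness has it in
  -- second.
  have comm : ∀ {Z : Type _} {α β γ : Z → Z} {a b : Z}, Joined α β γ a b → Joined β α γ a b :=
    fun h p p1 p2 p3 => h p p2 p1 p3
  constructor
  · intro h z
    exact comm ((joined_ins_inl σ f).1 (comm (h (Sum.inl z))))
  · intro h z
    rcases z with z | b
    · exact comm ((joined_ins_inl σ f).2 (comm (h z)))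
    · exact comm ((joined_ins_inr σ f).2 (comm (h f)).symm).symm

/-- The colours of the stub are forced: `inr false` is opposite to `f` and `inr true` has the colour
of `f`. The predicate `P` carries along a condition on the old flags. -/
theorem exists_colouring_ins_iff {τ₀ τ₂ : Y → Y} {P : (Y → Bool) → Prop} :
    (∃ col, IsColouring (stub τ₀) (ins σ f).1 (stub τ₂) col ∧ P (fun y => col (Sum.inl y))) ↔
    ∃ col, IsColouring τ₀ σ.1 τ₂ col ∧ P col := by
  constructor
  · rintro ⟨col, h, h'⟩
    refine ⟨fun y => col (Sum.inl y), fun y => ⟨(h (Sum.inl y)).1, ?_, (h (Sum.inl y)).2.2⟩, h'⟩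
    have h1 := (h (Sum.inr false)).2.1
    have h2 := (h (Sum.inr true)).2.1
    have h3 := (h (Sum.inr true)).1
    rw [ins_val, insFun_inr] at h1 h2
    rw [stub_inr] at h3
    simp only [Bool.cond_true, Bool.cond_false, Bool.not_true] at h1 h2 h3
    change col (Sum.inl (σ.1 y)) = !col (Sum.inl y)
    by_cases hy : y = f
    · subst hy; rw [h2, h1, h3]; simp
    · by_cases hy' : y = σ.1 f
      · subst hy'; rw [σ.invol, h2, h1, h3]
      · have := (h (Sum.inl y)).2.1
        rwa [ins_val, insFun_of_ne hy hy'] at this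
  · rintro ⟨col, h, h'⟩
    refine ⟨Sum.elim col (fun c => bif c then col f else !col f), ?_, h'⟩
    rintro (y | c)
    · refine ⟨(h y).1, ?_, (h y).2.2⟩
      by_cases hy : y = f
      · rw [hy, ins_val, insFun_self]; rfl
      · by_cases hy' : y = σ.1 f
        · rw [hy', ins_val, insFun_image (σ.ne f)]
          have := (h f).2.1
          simp [this]
        · rw [ins_val, insFun_of_ne hy hy']; exact (h y).2.1
    · have := (h f).2.1
      cases c <;> simp [ins_val, this]

variable [Fintype Y]

theorem sizes_ins_of_not_joined (hτ : Function.Involutive τ) (hτ' : Function.Involutive τ')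
    {p : Y → Prop} (hp : Saturated σ.1 τ τ' p) (hf : ¬ p f) {q : Y ⊕ Bool → Prop}
    (hq : ∀ z, q z ↔ ∃ y, p y ∧ Sum.inl y = z) :
    sizes (ins σ f).1 (stub τ) (stub τ') q = sizes σ.1 τ τ' p := by
  refine sizes_map (ins σ f).invol (stub_involutive hτ) (stub_involutive hτ') Sum.inl_injective hp
    ?_ (fun _ _ => rfl) (fun _ _ => rfl) hq
  intro y hy
  rw [ins_val, insFun_of_ne]
  · rintro rfl; exact hf hy
  · rintro rfl; exact hf ((hp _ _ (joined_fst f)).2 hy)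

theorem cls_ins_of_not_joined (hτ : Function.Involutive τ) (hτ' : Function.Involutive τ')
    {y : Y} (hf : ¬ Joined σ.1 τ τ' y f) :
    (cls (ins σ f).1 (stub τ) (stub τ') (Sum.inl y)).card = (cls σ.1 τ τ' y).card := by
  rw [card_cls_map (ins σ f).invol (stub_involutive hτ) (stub_involutive hτ') Sum.inl_injective
    (p := Joined σ.1 τ τ' y) (saturated_joined y) _ (fun _ _ => rfl) (fun _ _ => rfl)
    (Joined.refl y), Finset.card_map]
  intro z hz
  rw [ins_val, insFun_of_ne]
  · rintro rfl; exact hf hz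
  · rintro rfl; exact hf (hz.trans (joined_fst f).symm)

theorem card_cls_ins (b : Bool) :
    (cls (ins σ f).1 (stub τ) (stub τ') (Sum.inr b)).card = (cls σ.1 τ τ' f).card + 2 := by
  classical
  have h : cls (ins σ f).1 (stub τ) (stub τ') (Sum.inr b) =
      (cls σ.1 τ τ' f).disjSum Finset.univ := by
    ext z
    rcases z with z | c
    · simp only [mem_cls, Finset.inl_mem_disjSum]
      exact joined_ins_inr σ f
    · simpa using joined_stub (τ := τ) (τ' := τ') (ins σ f).1 b c
  rw [h, Finset.card_disjSum]
  rfl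

/-- Only the orbit through `f` changes, and it stays in one piece. Applied to `σ₁` and `σ₀`, this
says that inserting a stub creates no face. -/
theorem card_sizes_ins (hτ : Function.Involutive τ) (hτ' : Function.Involutive τ') :
    (sizes (ins σ f).1 (stub τ) (stub τ') (fun _ => True)).card =
      (sizes σ.1 τ τ' (fun _ => True)).card := by
  rw [sizes_eq_cons saturated_true (a := Sum.inr false) trivial,
    sizes_eq_cons saturated_true (a := f) trivial, Multiset.card_cons, Multiset.card_cons,
    sizes_ins_of_not_joined σ f hτ hτ' (p := fun y => True ∧ ¬ Joined σ.1 τ τ' f y)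
      (saturated_true.and (saturated_joined f).not) (fun h => h.2 (Joined.refl f))]
  rintro (z | c)
  · simp [joined_ins_inr]
  · simpa using joined_stub (τ := τ) (τ' := τ') (ins σ f).1 false c

end Stub


/-! ### Joining two stubs into an edge -/

section Surgery

variable {X : Type*}

/-- The side change of the map obtained from two stubs, of flags `inl (inr b)` and `inr b`, by
joining them into one edge. -/
def cross (τ : X → X) : (X ⊕ Bool) ⊕ Bool → (X ⊕ Bool) ⊕ Bool
  | Sum.inl (Sum.inl x) => Sum.inl (Sum.inl (τ x))
  | Sum.inl (Sum.inr b) => Sum.inr b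
  | Sum.inr b => Sum.inl (Sum.inr b)

@[simp] theorem cross_inl_inl (τ : X → X) (x : X) :
    cross τ (Sum.inl (Sum.inl x)) = Sum.inl (Sum.inl (τ x)) := rfl
@[simp] theorem cross_inl_inr (τ : X → X) (b : Bool) :
    cross τ (Sum.inl (Sum.inr b)) = Sum.inr b := rfl
@[simp] theorem cross_inr (τ : X → X) (b : Bool) :
    cross τ (Sum.inr b) = Sum.inl (Sum.inr b) := rfl

theorem cross_involutive {τ : X → X} (h : Function.Involutive τ) :
    Function.Involutive (cross τ) := by
  rintro ((x | b) | b)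
  · simp [h x]
  · simp
  · simp

theorem cross_ne {τ : X → X} (h : ∀ x, τ x ≠ x) (z : (X ⊕ Bool) ⊕ Bool) : cross τ z ≠ z := by
  rcases z with (x | b) | b
  · simpa using h x
  · simp
  · simp

theorem cross_inl (τ : X → X) {y : X ⊕ Bool} (hy : ∀ b, y ≠ Sum.inr b) :
    cross τ (Sum.inl y) = Sum.inl (stub τ y) := by
  rcases y with x | b
  · rfl
  · exact absurd rfl (hy b)

/-- Colours alternate along each stub because of the change of end. The side change of the joined
edge only adds that the two stubs be coloured oppositely, and one pair of flags decides this. -/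
theorem exists_colouring_cross_iff {τ₀ τ₂ : X → X} (ω : (X ⊕ Bool) ⊕ Bool → (X ⊕ Bool) ⊕ Bool) :
    (∃ col, IsColouring (stub (stub τ₀)) ω (cross τ₂) col) ↔
    ∃ col, IsColouring (stub (stub τ₀)) ω (stub (stub τ₂)) col ∧
      col (Sum.inr false) = !col (Sum.inl (Sum.inr false)) := by
  refine exists_congr fun col => ⟨fun h => ⟨?_, (h (Sum.inl (Sum.inr false))).2.2⟩, fun h => ?_⟩
  · rintro ((x | b) | b)
    · exact h _
    · exact ⟨(h _).1, (h _).2.1, (h (Sum.inl (Sum.inr b))).1⟩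
    · exact ⟨(h _).1, (h _).2.1, (h (Sum.inr b)).1⟩
  · obtain ⟨h, h'⟩ := h
    have h1 : ∀ b, col (Sum.inr b) = !col (Sum.inl (Sum.inr b)) := by
      intro b
      cases b
      · exact h'
      · have a1 := (h (Sum.inr false)).1
        have a2 := (h (Sum.inl (Sum.inr false))).1
        simp only [stub_inl, stub_inr, Bool.not_false] at a1 a2
        rw [a1, a2, h']
    rintro ((x | b) | b)
    · exact h _
    · exact ⟨(h _).1, (h _).2.1, h1 b⟩
    · refine ⟨(h _).1, (h _).2.1, ?_⟩
      rw [cross_inr, h1 b, Bool.not_not]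

variable {τ₀ τ₂ : X → X}

section Merge

variable (ω : Inv ((X ⊕ Bool) ⊕ Bool))

theorem joined_stubs_iff {z : (X ⊕ Bool) ⊕ Bool} (b : Bool) :
    Joined ω.1 (stub (stub τ₂)) (stub (stub τ₂)) (Sum.inl (Sum.inr b)) z ↔
    Joined ω.1 (stub (stub τ₂)) (stub (stub τ₂)) (Sum.inl (Sum.inr false)) z := by
  cases b
  · exact Iff.rfl
  · exact joined_congr_left (joined_snd (β := stub (stub τ₂)) (Sum.inl (Sum.inr true)))

/-- Joining stubs at different vertices merges these vertices. The delicate inclusion asks to pass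
from one flag of a stub to the other without using the stub: the other links around the vertex form
a path between them, which the parity lemma detects. -/
theorem joined_cross_iff [Fintype X] (i₂ : Function.Involutive τ₂) (n₂ : ∀ x, τ₂ x ≠ x)
    (h : ¬ Joined ω.1 (stub (stub τ₂)) (stub (stub τ₂)) (Sum.inl (Sum.inr false)) (Sum.inr false))
    (z : (X ⊕ Bool) ⊕ Bool) :
    Joined ω.1 (cross τ₂) (cross τ₂) (Sum.inl (Sum.inr false)) z ↔
      Joined ω.1 (stub (stub τ₂)) (stub (stub τ₂)) (Sum.inl (Sum.inr false)) z ∨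
      Joined ω.1 (stub (stub τ₂)) (stub (stub τ₂)) (Sum.inr false) z := by
  have iC := stub_involutive (stub_involutive i₂)
  have nC := stub_ne (stub_ne n₂)
  constructor
  · intro hz
    have hs : Saturated ω.1 (cross τ₂) (cross τ₂) (fun z =>
        Joined ω.1 (stub (stub τ₂)) (stub (stub τ₂)) (Sum.inl (Sum.inr false)) z ∨
        Joined ω.1 (stub (stub τ₂)) (stub (stub τ₂)) (Sum.inr false) z) := by
      have hc : ∀ z, (Joined ω.1 (stub (stub τ₂)) (stub (stub τ₂)) (Sum.inl (Sum.inr false)) z ∨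
          Joined ω.1 (stub (stub τ₂)) (stub (stub τ₂)) (Sum.inr false) z) →
        (Joined ω.1 (stub (stub τ₂)) (stub (stub τ₂)) (Sum.inl (Sum.inr false)) (cross τ₂ z) ∨
          Joined ω.1 (stub (stub τ₂)) (stub (stub τ₂)) (Sum.inr false) (cross τ₂ z)) := by
        rintro ((x | b) | b) hz
        · exact hz.imp (fun h => h.trans (joined_snd (β := stub (stub τ₂)) _))
            (fun h => h.trans (joined_snd (β := stub (stub τ₂)) _))
        · exact Or.inr (joined_stub _ _ _)
        · exact Or.inl (((joined_stubs_iff ω b).1 (Joined.refl _)))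
      refine saturated_of_forward ω.invol (cross_involutive i₂) (cross_involutive i₂) ?_ hc hc
      intro z hz
      exact hz.imp (fun h => h.trans (joined_fst _)) (fun h => h.trans (joined_fst _))
    exact (hs _ _ hz).1 (Or.inl (Joined.refl _))
  · intro hz p p1 p2 _
    have ht : p (Sum.inr false) ↔ p (Sum.inr true) := by
      have := parity_of_two_involutions ω.invol ω.ne iC nC (a := Sum.inr false)
        (q := fun z => Joined ω.1 (stub (stub τ₂)) (stub (stub τ₂)) (Sum.inr false) z ∧ p z)
        (fun z => and_congr (joined_congr_right (joined_fst z)).symm (p1 z)) (by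
          rintro ((x | b) | b) h1 h2
          · exact and_congr (joined_congr_right (joined_snd (β := stub (stub τ₂)) _)).symm
              (p2 (Sum.inl (Sum.inl x)))
          · have h3 : ¬ Joined ω.1 (stub (stub τ₂)) (stub (stub τ₂)) (Sum.inr false)
                (Sum.inl (Sum.inr b)) := fun h' =>
              h ((joined_stubs_iff ω b).1 h'.symm)
            have h4 : ¬ Joined ω.1 (stub (stub τ₂)) (stub (stub τ₂)) (Sum.inr false)
                (Sum.inl (Sum.inr !b)) := fun h' =>
              h ((joined_stubs_iff ω _).1 h'.symm)
            simp [h3, h4]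
          · cases b
            · exact absurd rfl h1
            · exact absurd rfl h2)
      simpa [Joined.refl, joined_stub] using this
    have hs : p (Sum.inl (Sum.inr false)) ↔ p (Sum.inl (Sum.inr true)) := by
      exact (p2 (Sum.inl (Sum.inr false))).symm.trans
        (ht.trans (p2 (Sum.inl (Sum.inr true))))
    have h2 : ∀ z, p (stub (stub τ₂) z) ↔ p z := by
      rintro ((x | b) | b)
      · exact p2 (Sum.inl (Sum.inl x))
      · cases b
        · exact hs.symm
        · exact hs
      · cases b
        · exact ht.symm
        · exact ht
    rcases hz with hz | hz
    · exact hz p p1 h2 h2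
    · exact (p2 (Sum.inl (Sum.inr false))).symm.trans (hz p p1 h2 h2)

theorem profile_cross_of_not_joined [Fintype X] (i₂ : Function.Involutive τ₂) (n₂ : ∀ x, τ₂ x ≠ x)
    (h : ¬ Joined ω.1 (stub (stub τ₂)) (stub (stub τ₂)) (Sum.inl (Sum.inr false))
      (Sum.inr false)) :
    (cls ω.1 (cross τ₂) (cross τ₂) (Sum.inl (Sum.inr false))).card =
      (cls ω.1 (stub (stub τ₂)) (stub (stub τ₂)) (Sum.inl (Sum.inr false))).card +
      (cls ω.1 (stub (stub τ₂)) (stub (stub τ₂)) (Sum.inr false)).card ∧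
    sizes ω.1 (cross τ₂) (cross τ₂)
      (fun z => ¬ Joined ω.1 (cross τ₂) (cross τ₂) (Sum.inl (Sum.inr false)) z) =
    sizes ω.1 (stub (stub τ₂)) (stub (stub τ₂)) (fun z =>
      ¬ Joined ω.1 (stub (stub τ₂)) (stub (stub τ₂)) (Sum.inl (Sum.inr false)) z ∧
      ¬ Joined ω.1 (stub (stub τ₂)) (stub (stub τ₂)) (Sum.inr false) z) := by
  classical
  have hj := joined_cross_iff ω i₂ n₂ h
  constructor
  · rw [← Finset.card_union_of_disjoint]
    · congr 1
      ext z
      simp only [Finset.mem_union, mem_cls, hj]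
    · rw [Finset.disjoint_left]
      intro z h1 h2
      exact h ((mem_cls.1 h1).trans (mem_cls.1 h2).symm)
  · refine sizes_map (ι := id) ω.invol (cross_involutive i₂) (cross_involutive i₂)
      Function.injective_id ((saturated_joined _).not.and (saturated_joined _).not)
      (fun _ _ => rfl) ?_ ?_ ?_
    rotate_left 2
    · intro z
      simp [hj]
    all_goals
      rintro ((x | b) | b) hy
      · rfl
      · exact absurd ((joined_stubs_iff ω b).1 (Joined.refl _)) hy.1
      · exact absurd (joined_stub _ _ _) hy.2

end Merge

section SameVertex

variable (σ : Inv (X ⊕ Bool)) (f : X ⊕ Bool)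

/-- The flag `inr false` of the inserted stub is opposite to `f`, and joining makes it opposite to
the root flag; so `f` and the root flag must share their colour. -/
theorem exists_colouring_ins_cross_iff :
    (∃ col, IsColouring (stub (stub τ₀)) (ins σ f).1 (cross τ₂) col) ↔
    ∃ col, IsColouring (stub τ₀) σ.1 (stub τ₂) col ∧ col f = col (Sum.inr false) := by
  rw [exists_colouring_cross_iff, ← exists_colouring_ins_iff σ f
    (P := fun col => col f = col (Sum.inr false))]
  refine exists_congr fun col => and_congr_right fun h => ?_
  have := (h (Sum.inr false)).2.1
  rw [ins_val, insFun_inr, Bool.cond_false] at this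
  change _ ↔ col (Sum.inl f) = col (Sum.inl (Sum.inr false))
  rw [this]
  cases col (Sum.inr false) <;> cases col (Sum.inl (Sum.inr false)) <;> decide

/-- An insertion at the root-vertex affects no other vertex: the flags of the old root-vertex and of
the new stub form whole vertices of the new map. It remains to see how many. -/
theorem saturated_sumElim_joined
    (i₂ : Function.Involutive τ₂)
    (hf : Joined σ.1 (stub τ₂) (stub τ₂) (Sum.inr false) f) :
    Saturated (ins σ f).1 (cross τ₂) (cross τ₂)
      (Sum.elim (Joined σ.1 (stub τ₂) (stub τ₂) (Sum.inr false)) (fun _ => True)) := by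
  have hc : ∀ z, Sum.elim (Joined σ.1 (stub τ₂) (stub τ₂) (Sum.inr false)) (fun _ => True) z →
      Sum.elim (Joined σ.1 (stub τ₂) (stub τ₂) (Sum.inr false)) (fun _ => True) (cross τ₂ z) := by
    rintro ((x | b) | b) h
    · exact Joined.trans h (joined_snd (β := stub τ₂) _)
    · trivial
    · exact joined_stub _ _ _
  refine saturated_of_forward (ins σ f).invol (cross_involutive i₂) (cross_involutive i₂) ?_ hc hc
  rintro (y | b) h
  · by_cases h1 : y = f
    · rw [h1, ins_val, insFun_self]; trivial
    · by_cases h2 : y = σ.1 f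
      · rw [h2, ins_val, insFun_image (σ.ne f)]; trivial
      · rw [ins_val, insFun_of_ne h1 h2]
        exact Joined.trans h (joined_fst _)
  · cases b
    · exact hf
    · exact hf.trans (joined_fst _)

theorem sizes_ins_cross_not [Fintype X] (i₂ : Function.Involutive τ₂)
    (hf : Joined σ.1 (stub τ₂) (stub τ₂) (Sum.inr false) f) :
    sizes (ins σ f).1 (cross τ₂) (cross τ₂) (fun z => ¬ Sum.elim
      (Joined σ.1 (stub τ₂) (stub τ₂) (Sum.inr false)) (fun _ => True) z) =
    sizes σ.1 (stub τ₂) (stub τ₂)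
      (fun z => ¬ Joined σ.1 (stub τ₂) (stub τ₂) (Sum.inr false) z) := by
  have hc : ∀ y, ¬ Joined σ.1 (stub τ₂) (stub τ₂) (Sum.inr false) y →
      cross τ₂ (Sum.inl y) = Sum.inl (stub τ₂ y) := by
    intro y hy
    apply cross_inl
    rintro b rfl
    exact hy (joined_stub _ _ _)
  refine sizes_map (ins σ f).invol (cross_involutive i₂) (cross_involutive i₂) Sum.inl_injective
    (saturated_joined _).not ?_ hc hc ?_
  · intro y hy
    rw [ins_val, insFun_of_ne]
    · rintro rfl; exact hy hf
    · rintro rfl; exact hy (hf.trans (joined_fst f))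
  · rintro (y | b)
    · simp
    · simp

theorem card_cls_sumElim [Fintype X] :
    (Finset.disjSum (cls σ.1 (stub τ₂) (stub τ₂) (Sum.inr false)) (Finset.univ : Finset Bool)).card
      = (cls σ.1 (stub τ₂) (stub τ₂) (Sum.inr false)).card + 2 := by
  rw [Finset.card_disjSum]; rfl

variable {σ f} {i : ℕ}

local notation "root" => (Sum.inr false : X ⊕ Bool)

theorem ins_turn (i₂ : Function.Involutive τ₂) (n₂ : ∀ x, τ₂ x ≠ x)
    (hi : i < period σ.1 (stub τ₂) root)
    (hf : f = turn σ.1 (stub τ₂) root i ∨ f = σ.1 (turn σ.1 (stub τ₂) root i))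
    {l : ℕ} (hl : l < period σ.1 (stub τ₂) root) (hli : l ≠ i) :
    (ins σ f).1 (Sum.inl (turn σ.1 (stub τ₂) root l)) =
      Sum.inl (σ.1 (turn σ.1 (stub τ₂) root l)) := by
  have h1 : turn σ.1 (stub τ₂) root l ≠ turn σ.1 (stub τ₂) root i :=
    fun h => hli (turn_injOn hl hi h)
  have h2 : turn σ.1 (stub τ₂) root l ≠ σ.1 (turn σ.1 (stub τ₂) root i) :=
    turn_ne σ.invol σ.ne (stub_involutive i₂) (stub_ne n₂)
  rw [ins_val]
  rcases hf with rfl | rfl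
  · exact insFun_of_ne h1 h2
  · exact insFun_of_ne h2 (by rwa [σ.invol])

/-- `cross τ₂` departs from `stub τ₂` only at the flags of the root stub, which the walk meets at
its start and at its very end. -/
theorem cross_turn [Fintype X] (i₂ : Function.Involutive τ₂) (n₂ : ∀ x, τ₂ x ≠ x)
    {l : ℕ} (hl : l + 1 < period σ.1 (stub τ₂) root) :
    cross τ₂ (Sum.inl (σ.1 (turn σ.1 (stub τ₂) root l))) =
      Sum.inl (turn σ.1 (stub τ₂) root (l + 1)) := by
  rw [turn_succ, cross_inl]
  intro b h
  cases b
  · exact turn_ne σ.invol σ.ne (stub_involutive i₂) (stub_ne n₂) (i := 0) h.symm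
  · have h1 := turn_last σ.invol (stub_involutive i₂) root
    rw [stub_inr, Bool.not_false, ← h] at h1
    have h2 := turn_injOn (by omega) (by omega) (σ.invol.injective h1)
    omega

theorem joined_cross_turn_after [Fintype X] (i₂ : Function.Involutive τ₂) (n₂ : ∀ x, τ₂ x ≠ x)
    (hi : i < period σ.1 (stub τ₂) root)
    (hf : f = turn σ.1 (stub τ₂) root i ∨ f = σ.1 (turn σ.1 (stub τ₂) root i))
    {l : ℕ} (hl : l < period σ.1 (stub τ₂) root) (hil : i ≤ l) :
    Joined (ins σ f).1 (cross τ₂) (cross τ₂) (Sum.inl (σ.1 (turn σ.1 (stub τ₂) root i)))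
      (Sum.inl (σ.1 (turn σ.1 (stub τ₂) root l))) ∧
    (i < l → Joined (ins σ f).1 (cross τ₂) (cross τ₂)
      (Sum.inl (σ.1 (turn σ.1 (stub τ₂) root i))) (Sum.inl (turn σ.1 (stub τ₂) root l))) := by
  induction l, hil using Nat.le_induction with
  | base => exact ⟨Joined.refl _, fun h => absurd h (lt_irrefl _)⟩
  | succ l hil ih =>
    have h1 := (ih (by omega)).1
    have h2 := h1.trans (joined_snd (β := cross τ₂) _)
    rw [cross_turn i₂ n₂ hl] at h2
    have h3 := h2.trans (joined_fst _)
    rw [ins_turn i₂ n₂ hi hf hl (by omega)] at h3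
    exact ⟨h3, fun _ => h2⟩

theorem turn_cross_before [Fintype X] (i₂ : Function.Involutive τ₂) (n₂ : ∀ x, τ₂ x ≠ x)
    (hi : i < period σ.1 (stub τ₂) root)
    (hf : f = turn σ.1 (stub τ₂) root i ∨ f = σ.1 (turn σ.1 (stub τ₂) root i))
    {l : ℕ} (hl : l ≤ i) :
    turn (ins σ f).1 (cross τ₂) (Sum.inl root) l = Sum.inl (turn σ.1 (stub τ₂) root l) := by
  induction l with
  | zero => rfl
  | succ l ih =>
    rw [turn_succ, ih (by omega), ins_turn i₂ n₂ hi hf (by omega) (by omega),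
      cross_turn i₂ n₂ (by omega)]

theorem joined_cross_last [Fintype X] (i₂ : Function.Involutive τ₂) (n₂ : ∀ x, τ₂ x ≠ x)
    (hi : i < period σ.1 (stub τ₂) root)
    (hf : f = turn σ.1 (stub τ₂) root i ∨ f = σ.1 (turn σ.1 (stub τ₂) root i)) :
    Joined (ins σ f).1 (cross τ₂) (cross τ₂) (Sum.inl (σ.1 (turn σ.1 (stub τ₂) root i)))
      (Sum.inr true) := by
  have h := (joined_cross_turn_after i₂ n₂ hi hf
    (l := period σ.1 (stub τ₂) root - 1) (by omega) (by omega)).1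
  rw [turn_last σ.invol (stub_involutive i₂)] at h
  exact h.trans (joined_snd (β := cross τ₂) (Sum.inl (Sum.inr true)))

theorem joined_root_turn {i : ℕ}
    (hf : f = turn σ.1 (stub τ₂) root i ∨ f = σ.1 (turn σ.1 (stub τ₂) root i)) :
    Joined σ.1 (stub τ₂) (stub τ₂) root f := by
  rcases hf with rfl | rfl
  · exact joined_turn _ _
  · exact (joined_turn _ _).trans (joined_fst _)

/-- The new walk follows the old one for `i` steps; then `σ₁` enters the inserted stub, and the side
change leads back to the root flag. -/
theorem period_cross_turn [Fintype X] (i₂ : Function.Involutive τ₂) (n₂ : ∀ x, τ₂ x ≠ x)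
    (hi : i < period σ.1 (stub τ₂) root) (hf : f = turn σ.1 (stub τ₂) root i) :
    period (ins σ f).1 (cross τ₂) (Sum.inl root) = i + 1 := by
  have h1 : turn (ins σ f).1 (cross τ₂) (Sum.inl root) (i + 1) = Sum.inl root := by
    rw [turn_succ, turn_cross_before i₂ n₂ hi (Or.inl hf) le_rfl, ← hf, ins_val, insFun_self]
    rfl
  have h2 : period (ins σ f).1 (cross τ₂) (Sum.inl root) ≤ i + 1 :=
    Function.IsPeriodicPt.minimalPeriod_le (Nat.succ_pos i) h1
  have h3 := period_pos (ins σ f).invol (cross_involutive i₂) (Sum.inl root)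
  by_contra hne
  have h4 := turn_period (σ := (ins σ f).1) (τ := cross τ₂) (Sum.inl root)
  rw [turn_cross_before i₂ n₂ hi (Or.inl hf) (by omega)] at h4
  have h5 := turn_injOn (j := 0) (by omega) (by omega) (Sum.inl.inj h4)
  omega

/-- Untwisted insertion in the root-vertex. The walk from the root closes up early, the rest of the
old walk forms a second vertex, and its size is found by subtraction. Colours are constant along
rotations, so orientability is preserved. -/
theorem profile_ins_cross_turn [Fintype X] (i₀ : Function.Involutive τ₀) (i₂ : Function.Involutive τ₂)
    (n₂ : ∀ x, τ₂ x ≠ x)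
    (hi : i < period σ.1 (stub τ₂) root) :
    profile (stub (stub τ₀)) (ins σ (turn σ.1 (stub τ₂) root i)).1 (cross τ₂) (Sum.inl root) =
      ⟨(profile (stub τ₀) σ.1 (stub τ₂) root).ori, (profile (stub τ₀) σ.1 (stub τ₂) root).faces,
        i + 1, (period σ.1 (stub τ₂) root - i) ::ₘ
          (profile (stub τ₀) σ.1 (stub τ₂) root).others⟩ := by
  classical
  obtain ⟨f, hf⟩ : ∃ f, f = turn σ.1 (stub τ₂) root i := ⟨_, rfl⟩
  rw [← hf]
  have hj := joined_root_turn (Or.inl hf)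
  have iY := stub_involutive i₂
  have hper := period_cross_turn i₂ n₂ hi hf
  have hJ := joined_iff_turn (ins σ f).invol (cross_involutive i₂) (Sum.inl root)
  rw [hper] at hJ
  have hns : ¬ Joined (ins σ f).1 (cross τ₂) (cross τ₂) (Sum.inl root) (Sum.inr true) := by
    rw [hJ]
    rintro ⟨l, hl, h | h⟩
    · rw [turn_cross_before i₂ n₂ hi (Or.inl hf) (by omega)] at h
      simp at h
    · rw [turn_cross_before i₂ n₂ hi (Or.inl hf) (by omega)] at h
      by_cases hli : l = i
      · rw [hli, ← hf, ins_val, insFun_self] at h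
        simp at h
      · rw [ins_turn i₂ n₂ hi (Or.inl hf) (by omega) hli] at h
        simp at h
  have hsat := saturated_sumElim_joined σ f i₂ hj
  have hcov : ∀ z, Sum.elim (Joined σ.1 (stub τ₂) (stub τ₂) root) (fun _ => True) z ↔
      Joined (ins σ f).1 (cross τ₂) (cross τ₂) (Sum.inl root) z ∨
      Joined (ins σ f).1 (cross τ₂) (cross τ₂) (Sum.inr true) z := by
    intro z
    constructor
    · intro hz
      rcases z with y | b
      · obtain ⟨l, hl, h⟩ := (joined_iff_turn σ.invol iY _ _).1 hz
        have hb : l ≤ i → Joined (ins σ f).1 (cross τ₂) (cross τ₂) (Sum.inl root)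
            (Sum.inl (turn σ.1 (stub τ₂) root l)) := by
          intro hli
          rw [← turn_cross_before i₂ n₂ hi (Or.inl hf) hli]
          exact joined_turn _ _
        have ha := joined_cross_last i₂ n₂ hi (Or.inl hf)
        rcases h with rfl | rfl
        · rcases le_or_gt l i with hli | hli
          · exact Or.inl (hb hli)
          · exact Or.inr (ha.symm.trans
              ((joined_cross_turn_after i₂ n₂ hi (Or.inl hf) hl hli.le).2 hli))
        · rcases lt_or_ge l i with hli | hli
          · left
            have := (hb hli.le).trans (joined_fst _)
            rwa [ins_turn i₂ n₂ hi (Or.inl hf) hl hli.ne] at this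
          · exact Or.inr (ha.symm.trans
              ((joined_cross_turn_after i₂ n₂ hi (Or.inl hf) hl hli).1))
      · cases b
        · exact Or.inl (joined_snd (β := cross τ₂) (Sum.inl root))
        · exact Or.inr (Joined.refl _)
    · rintro (h | h)
      · exact (hsat _ _ h).1 (Joined.refl _)
      · exact (hsat _ _ h).1 trivial
  have hcard0 : (cls (ins σ f).1 (cross τ₂) (cross τ₂) (Sum.inl root)).card = 2 * (i + 1) := by
    rw [card_cls_eq (ins σ f).invol (ins σ f).ne (cross_involutive i₂) (cross_ne n₂), hper]
  have hcard1 : (cls (ins σ f).1 (cross τ₂) (cross τ₂) (Sum.inr true)).card =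
      2 * (period σ.1 (stub τ₂) root - i) := by
    have h1 : (cls (ins σ f).1 (cross τ₂) (cross τ₂) (Sum.inl root)).card +
        (cls (ins σ f).1 (cross τ₂) (cross τ₂) (Sum.inr true)).card =
        2 * period σ.1 (stub τ₂) root + 2 := by
      rw [← card_cls_eq σ.invol σ.ne iY (stub_ne n₂), ← card_cls_sumElim,
        ← Finset.card_union_of_disjoint]
      · congr 1
        ext z
        rw [Finset.mem_union, mem_cls, mem_cls, ← hcov]
        rcases z with y | b
        · simp
        · simp
      · rw [Finset.disjoint_left]
        intro z h1 h2
        exact hns ((mem_cls.1 h1).trans (mem_cls.1 h2).symm)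
    rw [hcard0] at h1
    omega
  ext1
  · simp only [profile, decide_eq_decide]
    rw [exists_colouring_ins_cross_iff]
    constructor
    · rintro ⟨col, h, -⟩
      exact ⟨col, h⟩
    · rintro ⟨col, h⟩
      refine ⟨col, h, ?_⟩
      rw [hf]
      exact colour_turn (fun y => (h y).2.1) (fun y => (h y).2.2) _ _
  · simp only [profile]
    exact card_sizes_ins σ f (stub_involutive i₀) (stub_involutive i₀)
  · simp only [profile]
    omega
  · simp only [profile]
    rw [sizes_or (p := Joined (ins σ f).1 (cross τ₂) (cross τ₂) (Sum.inr true))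
      (q := fun z => ¬ Sum.elim (Joined σ.1 (stub τ₂) (stub τ₂) root) (fun _ => True) z),
      sizes_joined, hcard1, sizes_ins_cross_not σ f i₂ hj, Multiset.map_add,
      Multiset.map_singleton, Multiset.singleton_add, Nat.mul_div_cancel_left _ two_pos]
    · intro z
      rw [hcov]
      constructor
      · intro h
        by_cases h' : Joined (ins σ f).1 (cross τ₂) (cross τ₂) (Sum.inr true) z
        · exact Or.inl h'
        · exact Or.inr (by tauto)
      · rintro (h | h) h'
        · exact hns (h'.trans h.symm)
        · exact h (Or.inl h')
    · intro a b ha hb hab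
      exact hb ((hcov b).2 (Or.inr (ha.trans hab)))

/-- Twisted insertion in the root-vertex. The flag `inr true` of the new stub is now attached to the
first part of the walk and, through the side change, to the last part, so a single vertex remains.
Here `f` would be coloured oppositely to the root flag, which rules out a colouring. -/
theorem profile_ins_cross_twisted [Fintype X] (i₀ : Function.Involutive τ₀) (i₂ : Function.Involutive τ₂)
    (n₂ : ∀ x, τ₂ x ≠ x)
    (hi : i < period σ.1 (stub τ₂) root) :
    profile (stub (stub τ₀)) (ins σ (σ.1 (turn σ.1 (stub τ₂) root i))).1 (cross τ₂)
        (Sum.inl root) =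
      ⟨false, (profile (stub τ₀) σ.1 (stub τ₂) root).faces,
        period σ.1 (stub τ₂) root + 1, (profile (stub τ₀) σ.1 (stub τ₂) root).others⟩ := by
  classical
  obtain ⟨f, hf⟩ : ∃ f, f = σ.1 (turn σ.1 (stub τ₂) root i) := ⟨_, rfl⟩
  rw [← hf]
  have hj := joined_root_turn (Or.inr hf)
  have iY := stub_involutive i₂
  have hsat := saturated_sumElim_joined σ f i₂ hj
  have hb : ∀ {l}, l ≤ i → Joined (ins σ f).1 (cross τ₂) (cross τ₂) (Sum.inl root)
      (Sum.inl (turn σ.1 (stub τ₂) root l)) := by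
    intro l hli
    rw [← turn_cross_before i₂ n₂ hi (Or.inr hf) hli]
    exact joined_turn _ _
  have ha := joined_cross_last i₂ n₂ hi (Or.inr hf)
  have ht0 : Joined (ins σ f).1 (cross τ₂) (cross τ₂) (Sum.inl root) (Sum.inr false) :=
    joined_snd (β := cross τ₂) (Sum.inl root)
  have ht1 : Joined (ins σ f).1 (cross τ₂) (cross τ₂) (Sum.inl root) (Sum.inr true) := by
    have h1 := joined_fst (α := (ins σ f).1) (β := cross τ₂) (γ := cross τ₂) (Sum.inr true)
    rw [ins_val, insFun_inr, Bool.cond_true, hf, σ.invol, ← hf] at h1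
    exact (hb le_rfl).trans h1.symm
  have hcov : ∀ z, Joined (ins σ f).1 (cross τ₂) (cross τ₂) (Sum.inl root) z ↔
      Sum.elim (Joined σ.1 (stub τ₂) (stub τ₂) root) (fun _ => True) z := by
    intro z
    constructor
    · intro h
      exact (hsat _ _ h).1 (Joined.refl _)
    · intro hz
      rcases z with y | b
      · obtain ⟨l, hl, h⟩ := (joined_iff_turn σ.invol iY _ _).1 hz
        have hafter := fun hli => joined_cross_turn_after i₂ n₂ hi (Or.inr hf) hl hli
        rcases h with rfl | rfl
        · rcases le_or_gt l i with hli | hli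
          · exact hb hli
          · exact ht1.trans (ha.symm.trans ((hafter hli.le).2 hli))
        · rcases lt_or_ge l i with hli | hli
          · have := (hb hli.le).trans (joined_fst _)
            rwa [ins_turn i₂ n₂ hi (Or.inr hf) hl hli.ne] at this
          · exact ht1.trans (ha.symm.trans ((hafter hli).1))
      · cases b
        · exact ht0
        · exact ht1
  ext1
  · simp only [profile]
    rw [decide_eq_false_iff_not, exists_colouring_ins_cross_iff]
    rintro ⟨col, h, h'⟩
    rw [hf, (h _).2.1, colour_turn (fun y => (h y).2.1) (fun y => (h y).2.2)] at h'
    simp at h'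
  · simp only [profile]
    exact card_sizes_ins σ f (stub_involutive i₀) (stub_involutive i₀)
  · simp only [profile]
    have h1 : cls (ins σ f).1 (cross τ₂) (cross τ₂) (Sum.inl root) =
        Finset.disjSum (cls σ.1 (stub τ₂) (stub τ₂) root) Finset.univ := by
      ext z
      rw [mem_cls, hcov]
      rcases z with y | b
      · simp
      · simp
    rw [h1, card_cls_sumElim, card_cls_eq σ.invol σ.ne iY (stub_ne n₂)]
    omega
  · simp only [profile]
    rw [sizes_congr (fun z => not_congr (hcov z)), sizes_ins_cross_not σ f i₂ hj]

/-- The profile of the map with one more edge when the two ends of this edge come from different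
vertices. -/
theorem profile_ins_cross_other [Fintype X] (i₀ : Function.Involutive τ₀) (i₂ : Function.Involutive τ₂)
    (n₂ : ∀ x, τ₂ x ≠ x) (hf : ¬ Joined σ.1 (stub τ₂) (stub τ₂) root f) (o : Bool)
    (ho : o = true ↔ ∃ col, IsColouring (stub τ₀) σ.1 (stub τ₂) col ∧ col f = col root) :
    profile (stub (stub τ₀)) (ins σ f).1 (cross τ₂) (Sum.inl root) =
      ⟨o, (profile (stub τ₀) σ.1 (stub τ₂) root).faces,
        (profile (stub τ₀) σ.1 (stub τ₂) root).deg + (cls σ.1 (stub τ₂) (stub τ₂) f).card / 2 + 1,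
        (profile (stub τ₀) σ.1 (stub τ₂) root).others.erase
          ((cls σ.1 (stub τ₂) (stub τ₂) f).card / 2)⟩ := by
  have iY := stub_involutive i₂
  have hne : ¬ Joined (ins σ f).1 (stub (stub τ₂)) (stub (stub τ₂)) (Sum.inl root)
      (Sum.inr false) := fun h => hf ((joined_ins_inr σ f).1 h.symm).symm
  obtain ⟨h1, h2⟩ := profile_cross_of_not_joined (ins σ f) i₂ n₂ hne
  ext1
  · rw [Bool.eq_iff_iff, profile_ori, exists_colouring_ins_cross_iff, ho]
  · simp only [profile]
    exact card_sizes_ins σ f (stub_involutive i₀) (stub_involutive i₀)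
  · simp only [profile]
    rw [h1, card_cls_ins, cls_ins_of_not_joined σ f iY iY hf]
    obtain ⟨a, ha⟩ := even_card_cls (β := stub τ₂) (γ := stub τ₂) σ.invol σ.ne root
    obtain ⟨b, hb⟩ := even_card_cls (β := stub τ₂) (γ := stub τ₂) σ.invol σ.ne f
    omega
  · simp only [profile]
    rw [h2, sizes_eq_cons (saturated_joined root).not hf, Multiset.map_cons,
      Multiset.erase_cons_head,
      sizes_ins_of_not_joined σ f iY iY (p := fun y =>
        ¬ Joined σ.1 (stub τ₂) (stub τ₂) root y ∧ ¬ Joined σ.1 (stub τ₂) (stub τ₂) f y)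
        ((saturated_joined root).not.and (saturated_joined f).not)
        (fun h => h.2 (Joined.refl f))]
    rintro (y | b)
    · simp [joined_ins_inl, joined_ins_inr]
    · simpa using fun _ => joined_stub _ _ _

end SameVertex

end Surgery


/-! ## One more edge -/

/-- The profiles of the maps obtained by adding an edge to a map of profile `q`, both ends of the
edge being inserted in this map (the degree in `q` counts the stub at the root). -/
noncomputable def Profile.step (q : Profile) : Multiset Profile :=
  ∑ i ∈ Finset.range q.deg, {⟨q.ori, q.faces, i + 1, (q.deg - i) ::ₘ q.others⟩} +
  q.deg • {⟨false, q.faces, q.deg + 1, q.others⟩} +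
  (q.others.map fun b => b • ({⟨q.ori, q.faces, q.deg + b + 1, q.others.erase b⟩} +
    {⟨false, q.faces, q.deg + b + 1, q.others.erase b⟩} : Multiset Profile)).sum

/-- The profile of the map obtained by joining two maps by an edge whose contraction disconnects
them. -/
def Profile.join (q r : Profile) : Profile :=
  ⟨q.ori && r.ori, q.faces + r.faces, q.deg + r.deg, q.others + r.others⟩

section Step

variable {X : Type*} [Fintype X] {τ₀ τ₂ : X → X}

/-- Sorting the insertion flags by vertex: at the root-vertex, rotations give the splittings and
reflections the twisted loops. At any other vertex all flags give the same degrees, and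
orientability distinguishes its two families of flags. -/
theorem sum_profile_ins (i₀ : Function.Involutive τ₀) (i₂ : Function.Involutive τ₂)
    (n₂ : ∀ x, τ₂ x ≠ x) (σ : Inv (X ⊕ Bool))
    (hc : Connected (stub τ₀) σ.1 (stub τ₂) (Sum.inr false)) :
    ∑ f, ({profile (stub (stub τ₀)) (ins σ f).1 (cross τ₂) (Sum.inl (Sum.inr false))} :
      Multiset Profile) = (profile (stub τ₀) σ.1 (stub τ₂) (Sum.inr false)).step := by
  classical
  have iY := stub_involutive i₂
  have nY := stub_ne n₂
  have hdeg : (profile (stub τ₀) σ.1 (stub τ₂) (Sum.inr false)).deg =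
      period σ.1 (stub τ₂) (Sum.inr false) := by
    simp only [profile]
    rw [card_cls_eq σ.invol σ.ne iY nY]
    omega
  rw [← Finset.sum_filter_add_sum_filter_not Finset.univ
    (Joined σ.1 (stub τ₂) (stub τ₂) (Sum.inr false)), Profile.step]
  congr 1
  · rw [show Finset.univ.filter (Joined σ.1 (stub τ₂) (stub τ₂) (Sum.inr false)) =
      cls σ.1 (stub τ₂) (stub τ₂) (Sum.inr false) by ext; simp,
      sum_cls_eq σ.invol σ.ne iY nY, hdeg]
    congr 1
    · refine Finset.sum_congr rfl fun i hi => ?_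
      rw [profile_ins_cross_turn i₀ i₂ n₂ (Finset.mem_range.1 hi)]
    · rw [Finset.sum_congr rfl (fun i hi => by
        rw [profile_ins_cross_twisted i₀ i₂ n₂ (Finset.mem_range.1 hi)]),
        Finset.sum_const, Finset.card_range]
  · have key := sum_by_orbits (saturated_joined (α := σ.1) (β := stub τ₂) (γ := stub τ₂)
      (Sum.inr false)).not
      (fun f => ({profile (stub (stub τ₀)) (ins σ f).1 (cross τ₂) (Sum.inl (Sum.inr false))} :
        Multiset Profile))
      (fun c => (c / 2) • ({⟨(profile (stub τ₀) σ.1 (stub τ₂) (Sum.inr false)).ori,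
          (profile (stub τ₀) σ.1 (stub τ₂) (Sum.inr false)).faces,
          (profile (stub τ₀) σ.1 (stub τ₂) (Sum.inr false)).deg + c / 2 + 1,
          (profile (stub τ₀) σ.1 (stub τ₂) (Sum.inr false)).others.erase (c / 2)⟩} +
        {⟨false,
          (profile (stub τ₀) σ.1 (stub τ₂) (Sum.inr false)).faces,
          (profile (stub τ₀) σ.1 (stub τ₂) (Sum.inr false)).deg + c / 2 + 1,
          (profile (stub τ₀) σ.1 (stub τ₂) (Sum.inr false)).others.erase (c / 2)⟩} :
            Multiset Profile)) ?_
    · refine (Finset.sum_congr (by ext; simp) fun _ _ => rfl).trans (key.trans ?_)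
      conv_rhs => rw [show (profile (stub τ₀) σ.1 (stub τ₂) (Sum.inr false)).others =
        (sizes σ.1 (stub τ₂) (stub τ₂) (fun z => ¬ Joined σ.1 (stub τ₂) (stub τ₂)
          (Sum.inr false) z)).map (· / 2) from rfl]
      rw [Multiset.map_map]
      rfl
    · intro y hy
      have hprof : ∀ o f, Joined σ.1 (stub τ₂) (stub τ₂) y f →
          (o = true ↔ ∃ col, IsColouring (stub τ₀) σ.1 (stub τ₂) col ∧
            col f = col (Sum.inr false)) →
          profile (stub (stub τ₀)) (ins σ f).1 (cross τ₂) (Sum.inl (Sum.inr false)) =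
          ⟨o, (profile (stub τ₀) σ.1 (stub τ₂) (Sum.inr false)).faces,
          (profile (stub τ₀) σ.1 (stub τ₂) (Sum.inr false)).deg +
            (cls σ.1 (stub τ₂) (stub τ₂) y).card / 2 + 1,
          (profile (stub τ₀) σ.1 (stub τ₂) (Sum.inr false)).others.erase
            ((cls σ.1 (stub τ₂) (stub τ₂) y).card / 2)⟩ := by
        intro o f hf ho
        rw [profile_ins_cross_other i₀ i₂ n₂ (fun h => hy (h.trans hf.symm)) o ho,
          cls_eq_iff.2 hf]
      have hcard : (cls σ.1 (stub τ₂) (stub τ₂) y).card / 2 = period σ.1 (stub τ₂) y := by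
        rw [card_cls_eq σ.invol σ.ne iY nY]
        omega
      have hsum : ∀ (o : Bool) (g : ℕ → X ⊕ Bool),
          (∀ l, Joined σ.1 (stub τ₂) (stub τ₂) y (g l)) →
          (∀ l, o = true ↔ ∃ col, IsColouring (stub τ₀) σ.1 (stub τ₂) col ∧
            col (g l) = col (Sum.inr false)) →
          ∑ l ∈ Finset.range (period σ.1 (stub τ₂) y), ({profile (stub (stub τ₀)) (ins σ (g l)).1
            (cross τ₂) (Sum.inl (Sum.inr false))} : Multiset Profile) =
          ((cls σ.1 (stub τ₂) (stub τ₂) y).card / 2) • {⟨o,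
          (profile (stub τ₀) σ.1 (stub τ₂) (Sum.inr false)).faces,
          (profile (stub τ₀) σ.1 (stub τ₂) (Sum.inr false)).deg +
            (cls σ.1 (stub τ₂) (stub τ₂) y).card / 2 + 1,
          (profile (stub τ₀) σ.1 (stub τ₂) (Sum.inr false)).others.erase
            ((cls σ.1 (stub τ₂) (stub τ₂) y).card / 2)⟩} := by
        intro o g hg ho
        rw [Finset.sum_congr rfl (fun l _ => by rw [hprof o _ (hg l) (ho l)]), Finset.sum_const,
          Finset.card_range, hcard]
      rw [sum_cls_eq σ.invol σ.ne iY nY, nsmul_add]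
      have j1 : ∀ l, Joined σ.1 (stub τ₂) (stub τ₂) y (turn σ.1 (stub τ₂) y l) := joined_turn y
      have j2 : ∀ l, Joined σ.1 (stub τ₂) (stub τ₂) y (σ.1 (turn σ.1 (stub τ₂) y l)) :=
        fun l => (joined_turn y l).trans (joined_fst _)
      by_cases ho : ∃ col, IsColouring (stub τ₀) σ.1 (stub τ₂) col
      · obtain ⟨col, hcol⟩ := ho
        have hori : (profile (stub τ₀) σ.1 (stub τ₂) (Sum.inr false)).ori = true :=
          (profile_ori _ _ _ _).2 ⟨col, hcol⟩
        -- By uniqueness up to exchange, the single colouring `col` decides the condition for every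
        -- flag.
        have hu : ∀ f, (∃ col, IsColouring (stub τ₀) σ.1 (stub τ₂) col ∧
            col f = col (Sum.inr false)) ↔ col f = col (Sum.inr false) := by
          intro f
          constructor
          · rintro ⟨col', h, h'⟩
            have := hcol.eq_or_eq_not h (hc f)
            rw [h'] at this
            by_cases h1 : col (Sum.inr false) = col' (Sum.inr false)
            · rw [this.1 h1, h1]
            · have h2 : ¬ col f = col' (Sum.inr false) := fun h => h1 (this.2 h)
              revert h1 h2
              cases col (Sum.inr false) <;> cases col f <;> cases col' (Sum.inr false) <;> simp
          · exact fun h => ⟨col, hcol, h⟩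
        have c1 : ∀ l, col (turn σ.1 (stub τ₂) y l) = col y :=
          colour_turn (fun y => (hcol y).2.1) (fun y => (hcol y).2.2) y
        have c2 : ∀ l, col (σ.1 (turn σ.1 (stub τ₂) y l)) = !col y := fun l => by
          rw [(hcol _).2.1, c1]
        -- Whichever family around `y` has the colour of the root preserves orientability; both
        -- families have the same number of flags.
        by_cases hy' : col y = col (Sum.inr false)
        · rw [hsum true _ j1 (fun l => by rw [hu, c1]; simp [hy']),
            hsum false _ j2 (fun l => by rw [hu, c2]; simp [hy']), hori]
        · have hy'' : (!col y) = col (Sum.inr false) := by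
            revert hy'
            cases col y <;> cases col (Sum.inr false) <;> simp
          rw [hsum false _ j1 (fun l => by rw [hu, c1]; simp [hy']),
            hsum true _ j2 (fun l => by rw [hu, c2]; simp [hy'']), hori, add_comm]
      · have hori : (profile (stub τ₀) σ.1 (stub τ₂) (Sum.inr false)).ori = false := by
          rw [← Bool.not_eq_true, profile_ori]
          exact ho
        have hu : ∀ f, false = true ↔ (∃ col, IsColouring (stub τ₀) σ.1 (stub τ₂) col ∧
            col f = col (Sum.inr false)) := by
          intro f
          constructor
          · simp
          · rintro ⟨col, h, -⟩
            exact absurd ⟨col, h⟩ ho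
        rw [hsum false _ j1 (fun l => hu _), hsum false _ j2 (fun l => hu _), hori]

end Step

/-! ## Gluing two maps -/

section Glue

variable {Y₁ Y₂ Z : Type*} (e : Y₁ ⊕ Y₂ ≃ Z)

/-- The involution of `Z` made of involutions of two complementary parts. -/
def glue (σ₁ : Inv Y₁) (σ₂ : Inv Y₂) : Inv Z :=
  ⟨fun z => e (Sum.map σ₁.1 σ₂.1 (e.symm z)), by
    intro z
    obtain ⟨y | y, rfl⟩ := e.surjective z
    · simp [σ₁.invol y]
    · simp [σ₂.invol y], by
    intro z
    obtain ⟨y | y, rfl⟩ := e.surjective z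
    · simpa using σ₁.ne y
    · simpa using σ₂.ne y⟩

theorem glue_apply (σ₁ : Inv Y₁) (σ₂ : Inv Y₂) (y : Y₁ ⊕ Y₂) :
    (glue e σ₁ σ₂).1 (e y) = e (Sum.map σ₁.1 σ₂.1 y) := by simp [glue]

theorem glue_injective {σ₁ σ₁' : Inv Y₁} {σ₂ σ₂' : Inv Y₂} (h : glue e σ₁ σ₂ = glue e σ₁' σ₂') :
    σ₁ = σ₁' ∧ σ₂ = σ₂' := by
  have h' : ∀ y, Sum.map σ₁.1 σ₂.1 y = Sum.map σ₁'.1 σ₂'.1 y := by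
    intro y
    apply e.injective
    rw [← glue_apply, ← glue_apply, h]
  constructor
  · exact Subtype.ext (funext fun y => Sum.inl.inj (h' (Sum.inl y)))
  · exact Subtype.ext (funext fun y => Sum.inr.inj (h' (Sum.inr y)))

theorem exists_glue_eq (ω : Inv Z) (h₁ : ∀ y, ∃ y', ω.1 (e (Sum.inl y)) = e (Sum.inl y'))
    (h₂ : ∀ y, ∃ y', ω.1 (e (Sum.inr y)) = e (Sum.inr y')) :
    ∃ σ₁ σ₂, glue e σ₁ σ₂ = ω := by
  choose s₁ hs₁ using h₁
  choose s₂ hs₂ using h₂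
  refine ⟨⟨s₁, fun y => ?_, fun y h => ?_⟩, ⟨s₂, fun y => ?_, fun y h => ?_⟩, ?_⟩
  · have := ω.invol (e (Sum.inl y))
    rw [hs₁, hs₁] at this
    exact Sum.inl.inj (e.injective this)
  · exact ω.ne (e (Sum.inl y)) (by rw [hs₁, h])
  · have := ω.invol (e (Sum.inr y))
    rw [hs₂, hs₂] at this
    exact Sum.inr.inj (e.injective this)
  · exact ω.ne (e (Sum.inr y)) (by rw [hs₂, h])
  · apply Subtype.ext
    funext z
    obtain ⟨y | y, rfl⟩ := e.surjective z
    · rw [glue_apply, hs₁]; rfl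
    · rw [glue_apply, hs₂]; rfl

variable {e} {α β γ : Z → Z} {α₁ β₁ γ₁ : Y₁ → Y₁} {α₂ β₂ γ₂ : Y₂ → Y₂}
  (hα : Function.Involutive α) (hβ : Function.Involutive β) (hγ : Function.Involutive γ)
  (eα : ∀ y, α (e y) = e (Sum.map α₁ α₂ y)) (eβ : ∀ y, β (e y) = e (Sum.map β₁ β₂ y))
  (eγ : ∀ y, γ (e y) = e (Sum.map γ₁ γ₂ y))

include hα hβ hγ eα eβ eγ

theorem joined_glue_inl (a : Y₁) (y : Y₁ ⊕ Y₂) :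
    Joined α β γ (e (Sum.inl a)) (e y) ↔ Sum.elim (Joined α₁ β₁ γ₁ a) (fun _ => False) y := by
  rw [joined_map_iff (ι := fun a => e (Sum.inl a)) hα hβ hγ saturated_true (fun y _ => eα _)
    (fun y _ => eβ _) (fun y _ => eγ _) trivial]
  rcases y with y | y <;> simp

theorem joined_glue_inr (a : Y₂) (y : Y₁ ⊕ Y₂) :
    Joined α β γ (e (Sum.inr a)) (e y) ↔ Sum.elim (fun _ => False) (Joined α₂ β₂ γ₂ a) y := by
  rw [joined_map_iff (ι := fun a => e (Sum.inr a)) hα hβ hγ saturated_true (fun y _ => eα _)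
    (fun y _ => eβ _) (fun y _ => eγ _) trivial]
  rcases y with y | y <;> simp

theorem sizes_glue [Fintype Y₁] [Fintype Y₂] [Fintype Z] {p₁ : Y₁ → Prop} {p₂ : Y₂ → Prop}
    {q : Z → Prop}
    (hp₁ : Saturated α₁ β₁ γ₁ p₁) (hp₂ : Saturated α₂ β₂ γ₂ p₂)
    (hq : ∀ y, q (e y) ↔ Sum.elim p₁ p₂ y) :
    sizes α β γ q = sizes α₁ β₁ γ₁ p₁ + sizes α₂ β₂ γ₂ p₂ := by
  rw [sizes_or (p := fun z => ∃ y, p₁ y ∧ e (Sum.inl y) = z)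
    (q := fun z => ∃ y, p₂ y ∧ e (Sum.inr y) = z)]
  · congr 1
    · exact sizes_map hα hβ hγ (e.injective.comp Sum.inl_injective) hp₁ (fun y _ => eα _)
        (fun y _ => eβ _) (fun y _ => eγ _) (fun _ => Iff.rfl)
    · exact sizes_map hα hβ hγ (e.injective.comp Sum.inr_injective) hp₂ (fun y _ => eα _)
        (fun y _ => eβ _) (fun y _ => eγ _) (fun _ => Iff.rfl)
  · intro z
    obtain ⟨y | y, rfl⟩ := e.surjective z
    · simp [hq]
    · simp [hq]
  · rintro _ _ ⟨a, -, rfl⟩ ⟨b, -, rfl⟩ h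
    exact (joined_glue_inl hα hβ hγ eα eβ eγ a (Sum.inr b)).1 h

theorem card_cls_glue_inl [Fintype Y₁] [Fintype Z] (a : Y₁) :
    (cls α β γ (e (Sum.inl a))).card = (cls α₁ β₁ γ₁ a).card := by
  rw [card_cls_map (ι := fun a => e (Sum.inl a)) hα hβ hγ (e.injective.comp Sum.inl_injective)
    saturated_true (fun y _ => eα _) (fun y _ => eβ _) (fun y _ => eγ _) trivial,
    Finset.card_map]

theorem card_cls_glue_inr [Fintype Y₂] [Fintype Z] (a : Y₂) :
    (cls α β γ (e (Sum.inr a))).card = (cls α₂ β₂ γ₂ a).card := by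
  rw [card_cls_map (ι := fun a => e (Sum.inr a)) hα hβ hγ (e.injective.comp Sum.inr_injective)
    saturated_true (fun y _ => eα _) (fun y _ => eβ _) (fun y _ => eγ _) trivial,
    Finset.card_map]

end Glue

section GlueProfile

variable {X X₁ X₂ : Type*} [Fintype X] [Fintype X₁] [Fintype X₂]
  {e : (X₁ ⊕ Bool) ⊕ (X₂ ⊕ Bool) ≃ (X ⊕ Bool) ⊕ Bool}
  {τ₀ τ₂ : X → X} {a₀ a₂ : X₁ → X₁} {b₀ b₂ : X₂ → X₂}

/-- All faces and vertices lie in one of the two parts, except that `cross` merges the two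
root-vertices. -/
theorem profile_glue (i₀ : Function.Involutive τ₀) (i₂ : Function.Involutive τ₂)
    (n₂ : ∀ x, τ₂ x ≠ x)
    (e₀ : ∀ y, stub (stub τ₀) (e y) = e (Sum.map (stub a₀) (stub b₀) y))
    (e₂ : ∀ y, stub (stub τ₂) (e y) = e (Sum.map (stub a₂) (stub b₂) y))
    (es : e (Sum.inl (Sum.inr false)) = Sum.inl (Sum.inr false))
    (et : e (Sum.inr (Sum.inr false)) = Sum.inr false)
    (σ₁ : Inv (X₁ ⊕ Bool)) (σ₂ : Inv (X₂ ⊕ Bool)) :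
    profile (stub (stub τ₀)) (glue e σ₁ σ₂).1 (cross τ₂) (Sum.inl (Sum.inr false)) =
      (profile (stub a₀) σ₁.1 (stub a₂) (Sum.inr false)).join
        (profile (stub b₀) σ₂.1 (stub b₂) (Sum.inr false)) := by
  have j₀ := stub_involutive (stub_involutive i₀)
  have j₂ := stub_involutive (stub_involutive i₂)
  have hg := glue_apply e σ₁ σ₂
  have hi := (glue e σ₁ σ₂).invol
  have hs := joined_glue_inl hi j₂ j₂ hg e₂ e₂ (Sum.inr false)
  have ht := joined_glue_inr hi j₂ j₂ hg e₂ e₂ (Sum.inr false)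
  have hn : ¬ Joined (glue e σ₁ σ₂).1 (stub (stub τ₂)) (stub (stub τ₂)) (Sum.inl (Sum.inr false))
      (Sum.inr false) := by
    rw [← es, ← et, hs]
    exact id
  obtain ⟨h1, h2⟩ := profile_cross_of_not_joined (glue e σ₁ σ₂) i₂ n₂ hn
  rw [es] at hs
  rw [et] at ht
  have k1 := card_cls_glue_inl hi j₂ j₂ hg e₂ e₂ (Sum.inr false)
  have k2 := card_cls_glue_inr hi j₂ j₂ hg e₂ e₂ (Sum.inr false)
  rw [es] at k1
  rw [et] at k2
  ext1
  · rw [Bool.eq_iff_iff, profile_ori, exists_colouring_cross_iff, Profile.join, Bool.and_eq_true,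
      profile_ori, profile_ori]
    constructor
    · rintro ⟨col, h, -⟩
      refine ⟨⟨fun y => col (e (Sum.inl y)), fun y => ?_⟩,
        ⟨fun y => col (e (Sum.inr y)), fun y => ?_⟩⟩
      · have h' := h (e (Sum.inl y))
        rw [e₀, hg, e₂] at h'
        exact h'
      · have h' := h (e (Sum.inr y))
        rw [e₀, hg, e₂] at h'
        exact h'
    · rintro ⟨⟨c₁, hc₁⟩, ⟨c₂, hc₂⟩⟩
      obtain ⟨c₃, hc₃, hc₃'⟩ : ∃ c₃, IsColouring (stub b₀) σ₂.1 (stub b₂) c₃ ∧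
          c₃ (Sum.inr false) = !c₁ (Sum.inr false) := by
        by_cases h : c₂ (Sum.inr false) = !c₁ (Sum.inr false)
        · exact ⟨c₂, hc₂, h⟩
        · refine ⟨fun y => !c₂ y, fun y => ?_, ?_⟩
          · simp only [(hc₂ y).1, (hc₂ y).2.1, (hc₂ y).2.2, and_self]
          · have hb : ∀ a b : Bool, ¬ a = !b → (!a) = !b := by decide
            exact hb _ _ h
      refine ⟨fun z => Sum.elim c₁ c₃ (e.symm z), fun z => ?_, ?_⟩
      · obtain ⟨y, rfl⟩ := e.surjective z
        rw [e₀, hg, e₂]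
        rcases y with y | y
        · simpa using hc₁ y
        · simpa using hc₃ y
      · change Sum.elim c₁ c₃ (e.symm (Sum.inr false)) =
          !Sum.elim c₁ c₃ (e.symm (Sum.inl (Sum.inr false)))
        rw [← es, ← et]
        simpa using hc₃'
  · simp only [profile, Profile.join]
    rw [sizes_glue hi j₀ j₀ hg e₀ e₀ saturated_true saturated_true, Multiset.card_add]
    rintro (y | y) <;> simp
  · simp only [profile, Profile.join]
    rw [h1, k1, k2]
    obtain ⟨c, hc⟩ := even_card_cls (β := stub a₂) (γ := stub a₂) σ₁.invol σ₁.ne (Sum.inr false)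
    obtain ⟨d, hd⟩ := even_card_cls (β := stub b₂) (γ := stub b₂) σ₂.invol σ₂.ne (Sum.inr false)
    omega
  · simp only [profile, Profile.join]
    rw [h2, sizes_glue hi j₂ j₂ hg e₂ e₂ (saturated_joined (Sum.inr false)).not
      (saturated_joined (Sum.inr false)).not, Multiset.map_add]
    rintro (y | y)
    · simp [hs, ht]
    · simp [hs, ht]

end GlueProfile


/-! ## Counting labelled maps -/

section Labelled

variable {Y Z : Type*} [Fintype Y] [Fintype Z]

open Classical in
/-- The profiles of the connected maps with prescribed edges. -/
noncomputable def labelled (τ₀ τ₂ : Y → Y) (y : Y) : Multiset Profile :=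
  ∑ σ ∈ Finset.univ.filter (fun σ : Inv Y => Connected τ₀ σ.1 τ₂ y), {profile τ₀ σ.1 τ₂ y}

theorem bind_sum_singleton {ι α β : Type*} (s : Finset ι) (f : ι → α) (g : α → Multiset β) :
    (∑ i ∈ s, ({f i} : Multiset α)).bind g = ∑ i ∈ s, g (f i) := by
  classical
  induction s using Finset.induction_on with
  | empty => simp
  | insert a s ha ih => rw [Finset.sum_insert ha, Finset.sum_insert ha, Multiset.add_bind, ih,
      Multiset.singleton_bind]

theorem bind_sum {ι α β : Type*} (s : Finset ι) (f : ι → Multiset α) (g : α → Multiset β) :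
    (∑ i ∈ s, f i).bind g = ∑ i ∈ s, (f i).bind g := by
  classical
  induction s using Finset.induction_on with
  | empty => simp
  | insert a s ha ih => rw [Finset.sum_insert ha, Finset.sum_insert ha, Multiset.add_bind, ih]

theorem map_sum_singleton {ι α β : Type*} (s : Finset ι) (f : ι → α) (g : α → β) :
    (∑ i ∈ s, ({f i} : Multiset α)).map g = ∑ i ∈ s, {g (f i)} := by
  classical
  induction s using Finset.induction_on with
  | empty => simp
  | insert a s ha ih => rw [Finset.sum_insert ha, Finset.sum_insert ha, Multiset.map_add, ih,
      Multiset.map_singleton]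

/-- Transport of a fixed-point-free involution. -/
def Inv.conj (e : Y ≃ Z) (σ : Inv Y) : Inv Z :=
  ⟨fun z => e (σ.1 (e.symm z)), fun z => by simp [σ.invol _],
    fun z h => σ.ne (e.symm z) (by simpa using congrArg e.symm h)⟩

theorem labelled_equiv (e : Y ≃ Z) {τ₀ τ₂ : Y → Y} {υ₀ υ₂ : Z → Z}
    (i₀ : Function.Involutive υ₀) (i₂ : Function.Involutive υ₂)
    (h₀ : ∀ y, υ₀ (e y) = e (τ₀ y)) (h₂ : ∀ y, υ₂ (e y) = e (τ₂ y)) (y : Y) :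
    labelled υ₀ υ₂ (e y) = labelled τ₀ τ₂ y := by
  have hc : ∀ (σ : Inv Y) y, (σ.conj e).1 (e y) = e (σ.1 y) := fun σ y => by simp [Inv.conj]
  symm
  refine Finset.sum_bij (fun σ _ => σ.conj e) ?_ ?_ ?_ ?_
  · intro σ hσ
    simp only [Finset.mem_filter, Finset.mem_univ, true_and] at hσ ⊢
    exact (connected_equiv e i₀ (σ.conj e).invol i₂ h₀ (hc σ) h₂ y).2 hσ
  · intro σ _ σ' _ h
    apply Subtype.ext
    funext x
    apply e.injective
    rw [← hc, ← hc, h]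
  · intro ω hω
    simp only [Finset.mem_filter, Finset.mem_univ, true_and] at hω
    have h : (ω.conj e.symm).conj e = ω := by
      apply Subtype.ext
      funext z
      simp [Inv.conj]
    refine ⟨ω.conj e.symm, ?_, h⟩
    simp only [Finset.mem_filter, Finset.mem_univ, true_and]
    rw [← h] at hω
    exact (connected_equiv e i₀ ((ω.conj e.symm).conj e).invol i₂ h₀ (hc _) h₂ y).1 hω
  · intro σ _
    rw [profile_equiv e i₀ (σ.conj e).invol i₂ h₀ (hc σ) h₂ y]

end Labelled

/-! ### Contracting the root edge: one component or two -/

section Decomposition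

variable {X : Type*} {τ₀ τ₂ : X → X}

/-- Joining the stubs can only connect the components that contain them, so each component of the
contracted map must contain a stub. -/
theorem connected_cross_iff (i₀ : Function.Involutive τ₀) (i₂ : Function.Involutive τ₂)
    (ω : Inv ((X ⊕ Bool) ⊕ Bool)) :
    Connected (stub (stub τ₀)) ω.1 (cross τ₂) (Sum.inl (Sum.inr false)) ↔
    ∀ z, Joined (stub (stub τ₀)) ω.1 (stub (stub τ₂)) (Sum.inl (Sum.inr false)) z ∨
      Joined (stub (stub τ₀)) ω.1 (stub (stub τ₂)) (Sum.inr false) z := by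
  have hs : ∀ b, Joined (stub (stub τ₀)) ω.1 (stub (stub τ₂)) (Sum.inl (Sum.inr false))
      (Sum.inl (Sum.inr b)) := by
    intro b
    cases b
    · exact Joined.refl _
    · exact joined_fst (α := stub (stub τ₀)) (Sum.inl (Sum.inr false))
  have ht : ∀ b, Joined (stub (stub τ₀)) ω.1 (stub (stub τ₂)) (Sum.inr false) (Sum.inr b) := by
    intro b
    cases b
    · exact Joined.refl _
    · exact joined_fst (α := stub (stub τ₀)) (Sum.inr false)
  constructor
  · intro h z
    refine ((saturated_of_forward (p := fun z =>
      Joined (stub (stub τ₀)) ω.1 (stub (stub τ₂)) (Sum.inl (Sum.inr false)) z ∨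
      Joined (stub (stub τ₀)) ω.1 (stub (stub τ₂)) (Sum.inr false) z)
      (stub_involutive (stub_involutive i₀)) ω.invol
      (cross_involutive i₂) ?_ ?_ ?_) _ _ (h z)).1 (Or.inl (Joined.refl _))
    · exact fun z hz => hz.imp (fun h => h.trans (joined_fst _)) (fun h => h.trans (joined_fst _))
    · exact fun z hz => hz.imp (fun h => h.trans (joined_snd _)) (fun h => h.trans (joined_snd _))
    · rintro ((x | b) | b) hz
      · exact hz.imp (fun h => h.trans (joined_thd (γ := stub (stub τ₂)) _))
          (fun h => h.trans (joined_thd (γ := stub (stub τ₂)) _))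
      · exact Or.inr (ht b)
      · exact Or.inl (hs b)
  · intro h z p p1 p2 p3
    have h3 : ∀ z, p (stub (stub τ₂) z) ↔ p z := by
      rintro ((x | b) | b)
      · exact p3 (Sum.inl (Sum.inl x))
      · exact p1 (Sum.inl (Sum.inr b))
      · exact p1 (Sum.inr b)
    rcases h z with hz | hz
    · exact hz p p1 p2 h3
    · exact (p3 (Sum.inl (Sum.inr false))).symm.trans (hz p p1 p2 h3)

/-- If the flags of the second stub were exchanged with each other, this stub would be a component
on its own. Hence a connected contracted map is an insertion in the sense of `ins_bijective`. -/
theorem joined_stubs_of_ne {τ₀ τ₂ : X → X} {ω : Inv ((X ⊕ Bool) ⊕ Bool)}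
    (h : Joined (stub (stub τ₀)) ω.1 (stub (stub τ₂)) (Sum.inl (Sum.inr false)) (Sum.inr false)) :
    ω.1 (Sum.inr false) ≠ Sum.inr true := by
  intro h0
  have h1 : ω.1 (Sum.inr true) = Sum.inr false := by rw [← h0, ω.invol]
  have hw : ∀ y, ∃ y', ω.1 (Sum.inl y) = Sum.inl y' := by
    intro y
    rcases h2 : ω.1 (Sum.inl y) with y' | b
    · exact ⟨y', rfl⟩
    · exfalso
      have h3 := ω.invol (Sum.inl y)
      rw [h2] at h3
      cases b
      · rw [h0] at h3; simp at h3
      · rw [h1] at h3; simp at h3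
  have := h (fun z => z.isLeft = true) (by rintro (y | b) <;> simp) (by
    rintro (y | b)
    · obtain ⟨y', hy'⟩ := hw y
      simp [hy']
    · cases b
      · simp [h0]
      · simp [h1]) (by rintro (y | b) <;> simp)
  simp at this

theorem joined_ins_stubs (σ : Inv (X ⊕ Bool)) (f : X ⊕ Bool) (h : Connected (stub τ₀) σ.1 (stub τ₂)
    (Sum.inr false)) :
    Connected (stub (stub τ₀)) (ins σ f).1 (stub (stub τ₂)) (Sum.inl (Sum.inr false)) :=
  (connected_ins_iff σ f _).2 h

variable [Fintype X]

open Classical in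
theorem labelled_cross_eq (i₀ : Function.Involutive τ₀) (i₂ : Function.Involutive τ₂)
    (n₂ : ∀ x, τ₂ x ≠ x) :
    labelled (stub (stub τ₀)) (cross τ₂) (Sum.inl (Sum.inr false)) =
      (labelled (stub τ₀) (stub τ₂) (Sum.inr false)).bind Profile.step +
      ∑ ω ∈ Finset.univ.filter (fun ω : Inv ((X ⊕ Bool) ⊕ Bool) =>
          (∀ z, Joined (stub (stub τ₀)) ω.1 (stub (stub τ₂)) (Sum.inl (Sum.inr false)) z ∨
            Joined (stub (stub τ₀)) ω.1 (stub (stub τ₂)) (Sum.inr false) z) ∧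
          ¬ Joined (stub (stub τ₀)) ω.1 (stub (stub τ₂)) (Sum.inl (Sum.inr false))
            (Sum.inr false)),
        {profile (stub (stub τ₀)) ω.1 (cross τ₂) (Sum.inl (Sum.inr false))} := by
  rw [labelled, ← Finset.sum_filter_add_sum_filter_not _ (fun ω : Inv ((X ⊕ Bool) ⊕ Bool) =>
    Joined (stub (stub τ₀)) ω.1 (stub (stub τ₂)) (Sum.inl (Sum.inr false)) (Sum.inr false))]
  congr 1
  · rw [labelled, bind_sum_singleton]
    rw [Finset.sum_congr rfl (fun σ hσ => (sum_profile_ins i₀ i₂ n₂ σ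
      (Finset.mem_filter.1 hσ).2).symm), ← Finset.sum_product']
    symm
    refine Finset.sum_bij (fun q _ => ins q.1 q.2) ?_ ?_ ?_ (fun _ _ => rfl)
    · rintro ⟨σ, f⟩ h
      simp only [Finset.mem_product, Finset.mem_filter, Finset.mem_univ, true_and, and_true] at h ⊢
      have := joined_ins_stubs σ f h
      exact ⟨(connected_cross_iff i₀ i₂ _).2 fun z => Or.inl (this z), this _⟩
    · rintro q _ q' _ h
      exact ins_bijective.1 (Subtype.ext h)
    · intro ω hω
      simp only [Finset.mem_filter, Finset.mem_univ, true_and, connected_cross_iff i₀ i₂] at hω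
      obtain ⟨⟨σ, f⟩, hσ⟩ := ins_bijective.2 ⟨ω, joined_stubs_of_ne hω.2⟩
      have hσ' : ins σ f = ω := congrArg Subtype.val hσ
      refine ⟨(σ, f), ?_, hσ'⟩
      simp only [Finset.mem_product, Finset.mem_filter, Finset.mem_univ, true_and, and_true]
      rw [← connected_ins_iff σ f, hσ']
      exact fun z => (hω.1 z).elim id (fun h => hω.2.trans h)
  · rw [Finset.filter_filter]
    refine Finset.sum_congr ?_ fun _ _ => rfl
    ext ω
    simp only [Finset.mem_filter, Finset.mem_univ, true_and, connected_cross_iff i₀ i₂]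

end Decomposition

/-! ### Standard edges and the splitting of the edge set -/

section Edges

/-- The flags of the edges `E`, given by an edge, an end and a side. -/
abbrev Flags (E : Type*) : Type _ := E × (Bool × Bool)

/-- Change of end. -/
def flip₀ {E : Type*} (x : Flags E) : Flags E := (x.1, (!x.2.1, x.2.2))
/-- Change of side. -/
def flip₂ {E : Type*} (x : Flags E) : Flags E := (x.1, (x.2.1, !x.2.2))

theorem flip₀_involutive {E : Type*} : Function.Involutive (flip₀ : Flags E → Flags E) :=
  fun x => by simp [flip₀]
theorem flip₂_involutive {E : Type*} : Function.Involutive (flip₂ : Flags E → Flags E) :=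
  fun x => by simp [flip₂]
theorem flip₂_ne {E : Type*} (x : Flags E) : flip₂ x ≠ x := by
  intro h
  simpa [flip₂] using congrArg (fun x => x.2.2) h

/-- The profiles of the maps with edges `E` and with a stub at the root. -/
noncomputable def stubbed (E : Type*) [Fintype E] : Multiset Profile :=
  labelled (stub (flip₀ : Flags E → _)) (stub flip₂) (Sum.inr false)

/-- The profiles of the maps with edges `E` and one more edge, the root. -/
noncomputable def rootedAt (E : Type*) [Fintype E] : Multiset Profile :=
  labelled (stub (stub (flip₀ : Flags E → _))) (cross flip₂) (Sum.inl (Sum.inr false))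

theorem stubbed_equiv {E E' : Type*} [Fintype E] [Fintype E'] (e : E ≃ E') :
    stubbed E' = stubbed E := by
  refine labelled_equiv (Equiv.sumCongr (Equiv.prodCongr e (Equiv.refl _)) (Equiv.refl Bool))
    (stub_involutive flip₀_involutive) (stub_involutive flip₂_involutive) ?_ ?_ (Sum.inr false)
  · rintro (x | b) <;> rfl
  · rintro (x | b) <;> rfl

/-- The joins of the members of two multisets of profiles. -/
def joins (s t : Multiset Profile) : Multiset Profile := s.bind fun q => t.map q.join

variable {E : Type*}

/-- The flags of two edge sets with stubs. -/
def splitFun (S : Finset E) : (Flags {e // e ∈ S} ⊕ Bool) ⊕ (Flags {e // e ∉ S} ⊕ Bool) →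
    (Flags E ⊕ Bool) ⊕ Bool
  | Sum.inl (Sum.inl x) => Sum.inl (Sum.inl (x.1.1, x.2))
  | Sum.inl (Sum.inr b) => Sum.inl (Sum.inr b)
  | Sum.inr (Sum.inl x) => Sum.inl (Sum.inl (x.1.1, x.2))
  | Sum.inr (Sum.inr b) => Sum.inr b

theorem splitFun_bijective (S : Finset E) : Function.Bijective (splitFun S) := by
  constructor
  · rintro ((⟨⟨e, he⟩, q⟩ | b) | (⟨⟨e, he⟩, q⟩ | b)) ((⟨⟨e', he'⟩, q'⟩ | b') | (⟨⟨e', he'⟩, q'⟩ | b')) h <;>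
      simp only [splitFun, Sum.inl.injEq, Sum.inr.injEq, Prod.mk.injEq, reduceCtorEq] at h <;>
      (obtain ⟨rfl, rfl⟩ := h; first | rfl | exact absurd he he' | exact absurd he' he)
  · rintro ((⟨e, q⟩ | b) | b)
    · by_cases he : e ∈ S
      · exact ⟨Sum.inl (Sum.inl (⟨e, he⟩, q)), rfl⟩
      · exact ⟨Sum.inr (Sum.inl (⟨e, he⟩, q)), rfl⟩
    · exact ⟨Sum.inl (Sum.inr b), rfl⟩
    · exact ⟨Sum.inr (Sum.inr b), rfl⟩

/-- The flags of two complementary edge sets with stubs, as an equivalence. -/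
noncomputable def splitEquiv (S : Finset E) :
    (Flags {e // e ∈ S} ⊕ Bool) ⊕ (Flags {e // e ∉ S} ⊕ Bool) ≃ (Flags E ⊕ Bool) ⊕ Bool :=
  Equiv.ofBijective _ (splitFun_bijective S)

theorem splitEquiv_flip₀ (S : Finset E) (y) : stub (stub flip₀) (splitEquiv S y) =
    splitEquiv S (Sum.map (stub flip₀) (stub flip₀) y) := by
  rcases y with (y | b) | (y | b) <;> rfl

theorem splitEquiv_flip₂ (S : Finset E) (y) : stub (stub flip₂) (splitEquiv S y) =
    splitEquiv S (Sum.map (stub flip₂) (stub flip₂) y) := by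
  rcases y with (y | b) | (y | b) <;> rfl

variable [Fintype E]

open Classical in
/-- The edges of the component of the first stub. -/
noncomputable def component (ω : Inv ((Flags E ⊕ Bool) ⊕ Bool)) : Finset E :=
  Finset.univ.filter fun e => Joined (stub (stub flip₀)) ω.1 (stub (stub flip₂))
    (Sum.inl (Sum.inr false)) (Sum.inl (Sum.inl (e, (false, false))))

/-- The four flags of an edge lie in one component, so a component is described by its edges. -/
theorem joined_flag_iff (ω : Inv ((Flags E ⊕ Bool) ⊕ Bool)) (e : E) (q : Bool × Bool) :
    Joined (stub (stub flip₀)) ω.1 (stub (stub flip₂))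
    (Sum.inl (Sum.inr false)) (Sum.inl (Sum.inl (e, q))) ↔ e ∈ component ω := by
  simp only [component, Finset.mem_filter, Finset.mem_univ, true_and]
  have h1 : ∀ a b, Joined (stub (stub flip₀)) ω.1 (stub (stub flip₂))
    (Sum.inl (Sum.inl (e, (a, b)))) (Sum.inl (Sum.inl (e, (!a, b)))) := fun a b =>
      joined_fst (α := stub (stub flip₀)) _
  have h2 : ∀ a b, Joined (stub (stub flip₀)) ω.1 (stub (stub flip₂))
    (Sum.inl (Sum.inl (e, (a, b)))) (Sum.inl (Sum.inl (e, (a, !b)))) := fun a b =>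
      joined_thd (γ := stub (stub flip₂)) _
  apply joined_congr_right
  obtain ⟨a, b⟩ := q
  cases a <;> cases b
  · exact Joined.refl _
  · exact h2 _ _
  · exact h1 _ _
  · exact (h2 true true).trans (h1 true false)

open Classical in
theorem rootedAt_eq :
    rootedAt E = (stubbed E).bind Profile.step +
      ∑ S : Finset E, joins (stubbed {e // e ∈ S}) (stubbed {e // e ∉ S}) := by
  rw [rootedAt, labelled_cross_eq flip₀_involutive flip₂_involutive flip₂_ne, stubbed]
  congr 1
  rw [← Finset.sum_fiberwise_of_maps_to (g := component) (t := Finset.univ)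
    (fun _ _ => Finset.mem_univ _)]
  refine Finset.sum_congr rfl fun S _ => ?_
  rw [joins, stubbed, labelled, bind_sum_singleton, stubbed, labelled]
  simp only [map_sum_singleton]
  rw [← Finset.sum_product']
  have j₀ := stub_involutive (stub_involutive (flip₀_involutive (E := E)))
  have j₂ := stub_involutive (stub_involutive (flip₂_involutive (E := E)))
  symm
  refine Finset.sum_bij (fun q _ => glue (splitEquiv S) q.1 q.2) ?_ ?_ ?_ ?_
  · rintro ⟨σ₁, σ₂⟩ h
    simp only [Finset.mem_product, Finset.mem_filter, Finset.mem_univ, true_and] at h ⊢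
    have hi := (glue (splitEquiv S) σ₁ σ₂).invol
    have hs : ∀ y, Joined (stub (stub flip₀)) (glue (splitEquiv S) σ₁ σ₂).1 (stub (stub flip₂))
        (Sum.inl (Sum.inr false)) (splitEquiv S y) ↔ _ :=
      joined_glue_inl j₀ hi j₂ (splitEquiv_flip₀ S) (glue_apply _ σ₁ σ₂) (splitEquiv_flip₂ S)
        (Sum.inr false)
    have ht : ∀ y, Joined (stub (stub flip₀)) (glue (splitEquiv S) σ₁ σ₂).1 (stub (stub flip₂))
        (Sum.inr false) (splitEquiv S y) ↔ _ :=
      joined_glue_inr j₀ hi j₂ (splitEquiv_flip₀ S) (glue_apply _ σ₁ σ₂) (splitEquiv_flip₂ S)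
        (Sum.inr false)
    refine ⟨⟨fun z => ?_, ?_⟩, ?_⟩
    · obtain ⟨y | y, rfl⟩ := (splitEquiv S).surjective z
      · exact Or.inl ((hs _).2 (h.1 y))
      · exact Or.inr ((ht _).2 (h.2 y))
    · exact fun h' => (hs (Sum.inr (Sum.inr false))).1 h'
    · ext e
      rw [← joined_flag_iff _ e (false, false)]
      by_cases he : e ∈ S
      · refine iff_of_true ((hs (Sum.inl (Sum.inl (⟨e, he⟩, (false, false))))).2 (h.1 _)) he
      · refine iff_of_false (fun h' => ?_) he
        exact (hs (Sum.inr (Sum.inl (⟨e, he⟩, (false, false))))).1 h'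
  · rintro ⟨σ₁, σ₂⟩ _ ⟨σ₁', σ₂'⟩ _ h
    obtain ⟨h1, h2⟩ := glue_injective _ h
    exact Prod.ext h1 h2
  · intro ω hω
    simp only [Finset.mem_filter, Finset.mem_univ, true_and] at hω
    obtain ⟨⟨hcov, hne⟩, hS⟩ := hω
    have hmem : ∀ y, Joined (stub (stub flip₀)) ω.1 (stub (stub flip₂))
        (Sum.inl (Sum.inr false)) (splitEquiv S y) ↔ y.isLeft = true := by
      rintro ((⟨⟨e, he⟩, q⟩ | b) | (⟨⟨e, he⟩, q⟩ | b))
      · exact iff_of_true ((joined_flag_iff ω e q).2 (hS ▸ he)) rfl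
      · refine iff_of_true ?_ rfl
        cases b
        · exact Joined.refl _
        · exact joined_fst (α := stub (stub flip₀)) (Sum.inl (Sum.inr false))
      · exact iff_of_false (fun h => he (hS ▸ (joined_flag_iff ω e q).1 h)) (by simp)
      · refine iff_of_false (fun h => hne ?_) (by simp)
        cases b
        · exact h
        · exact h.trans (joined_fst (α := stub (stub flip₀)) (Sum.inr true))
    obtain ⟨σ₁, σ₂, hg⟩ := exists_glue_eq (splitEquiv S) ω (by
        intro y
        obtain ⟨y' | y', hy'⟩ := (splitEquiv S).surjective (ω.1 (splitEquiv S (Sum.inl y)))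
        · exact ⟨y', hy'.symm⟩
        · have h1 := ((hmem (Sum.inl y)).2 rfl).trans (joined_snd _)
          rw [← hy', hmem] at h1
          simp at h1) (by
        intro y
        obtain ⟨y' | y', hy'⟩ := (splitEquiv S).surjective (ω.1 (splitEquiv S (Sum.inr y)))
        · have h1 := ((hmem (Sum.inl y')).2 rfl).trans
            (by rw [hy']; exact (joined_snd _).symm :
              Joined (stub (stub flip₀)) ω.1 (stub (stub flip₂)) _ (splitEquiv S (Sum.inr y)))
          rw [hmem] at h1
          simp at h1
        · exact ⟨y', hy'.symm⟩)
    refine ⟨(σ₁, σ₂), ?_, hg⟩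
    have hs : ∀ y, Joined (stub (stub flip₀)) (glue (splitEquiv S) σ₁ σ₂).1 (stub (stub flip₂))
        (Sum.inl (Sum.inr false)) (splitEquiv S y) ↔ _ :=
      joined_glue_inl j₀ (glue (splitEquiv S) σ₁ σ₂).invol j₂ (splitEquiv_flip₀ S)
        (glue_apply _ σ₁ σ₂) (splitEquiv_flip₂ S) (Sum.inr false)
    have ht : ∀ y, Joined (stub (stub flip₀)) (glue (splitEquiv S) σ₁ σ₂).1 (stub (stub flip₂))
        (Sum.inr false) (splitEquiv S y) ↔ _ :=
      joined_glue_inr j₀ (glue (splitEquiv S) σ₁ σ₂).invol j₂ (splitEquiv_flip₀ S)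
        (glue_apply _ σ₁ σ₂) (splitEquiv_flip₂ S) (Sum.inr false)
    rw [hg] at hs ht
    simp only [Finset.mem_product, Finset.mem_filter, Finset.mem_univ, true_and]
    constructor
    · intro y
      exact (hs (Sum.inl y)).1 ((hmem _).2 rfl)
    · intro y
      refine (ht (Sum.inr y)).1 ((hcov _).resolve_left fun h => ?_)
      rw [hmem] at h
      simp at h
  · rintro ⟨σ₁, σ₂⟩ _
    rw [profile_glue flip₀_involutive flip₂_involutive flip₂_ne (splitEquiv_flip₀ S)
      (splitEquiv_flip₂ S) rfl rfl]

end Edges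


/-! ### Exchanging the root edge for a stub, and the recursion -/

/-- One more edge-end at the root-vertex. -/
def Profile.succ (q : Profile) : Profile := { q with deg := q.deg + 1 }

theorem profile_ins_stub {X : Type*} [Fintype X] {τ₀ τ₂ : X → X} (i₀ : Function.Involutive τ₀)
    (i₂ : Function.Involutive τ₂) (σ : Inv X) (f : X) :
    profile (stub τ₀) (ins σ f).1 (stub τ₂) (Sum.inr false) = (profile τ₀ σ.1 τ₂ f).succ := by
  ext1
  · rw [Bool.eq_iff_iff, profile_ori, Profile.succ, profile_ori]
    simpa using exists_colouring_ins_iff σ f (τ₀ := τ₀) (τ₂ := τ₂) (P := fun _ => True)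
  · simp only [profile, Profile.succ]
    exact card_sizes_ins σ f i₀ i₀
  · simp only [profile, Profile.succ]
    rw [card_cls_ins]
    omega
  · simp only [profile, Profile.succ]
    rw [sizes_ins_of_not_joined σ f i₂ i₂ (saturated_joined f).not (fun h => h (Joined.refl f))]
    rintro (y | b)
    · simp [joined_ins_inr]
    · simpa using joined_stub _ _ _

/-- Removing the stub from its corner leaves a map rooted at the flag `r` where it was attached.
Flags must exist, since a lone stub with its flags exchanged is not an insertion. -/
theorem labelled_stub_eq_sum {X : Type*} [Fintype X] [Nonempty X] {τ₀ τ₂ : X → X}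
    (i₀ : Function.Involutive τ₀) (i₂ : Function.Involutive τ₂) :
    labelled (stub τ₀) (stub τ₂) (Sum.inr false) =
      ∑ r : X, (labelled τ₀ τ₂ r).map Profile.succ := by
  classical
  simp only [labelled, map_sum_singleton]
  rw [Finset.sum_sigma']
  symm
  have hc : ∀ (σ : Inv X) f, Connected (stub τ₀) (ins σ f).1 (stub τ₂) (Sum.inr false) ↔
      Connected τ₀ σ.1 τ₂ f := by
    intro σ f
    rw [← connected_ins_iff σ f]
    have hj : Joined (stub τ₀) (ins σ f).1 (stub τ₂) (Sum.inr false) (Sum.inl f) :=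
      joined_snd (β := (ins σ f).1) (Sum.inr false)
    exact ⟨fun h z => hj.symm.trans (h z), fun h z => hj.trans (h z)⟩
  refine Finset.sum_bij (fun q _ => ins q.2 q.1) ?_ ?_ ?_ ?_
  · rintro ⟨f, σ⟩ h
    simp only [Finset.mem_sigma, Finset.mem_filter, Finset.mem_univ, true_and] at h ⊢
    rwa [hc]
  · rintro ⟨f, σ⟩ _ ⟨f', σ'⟩ _ h
    have := ins_bijective.1 (a₁ := (σ, f)) (a₂ := (σ', f')) (Subtype.ext h)
    simp only [Prod.mk.injEq] at this
    obtain ⟨rfl, rfl⟩ := this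
    rfl
  · intro ω hω
    simp only [Finset.mem_filter, Finset.mem_univ, true_and] at hω
    have hne : ω.1 (Sum.inr false) ≠ Sum.inr true := by
      intro h0
      have h1 : ω.1 (Sum.inr true) = Sum.inr false := by rw [← h0, ω.invol]
      have hs : Saturated (stub τ₀) ω.1 (stub τ₂) (fun z => z.isRight = true) := by
        refine saturated_of_forward (stub_involutive i₀) ω.invol (stub_involutive i₂) ?_ ?_ ?_ <;>
          rintro (x | b) h <;> simp at h ⊢
        cases b
        · simp [h0]
        · simp [h1]
      have := (hs _ _ (hω (Sum.inl (Classical.arbitrary X)))).1 rfl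
      simp at this
    obtain ⟨⟨σ, f⟩, hσ⟩ := ins_bijective.2 ⟨ω, hne⟩
    have hσ' : ins σ f = ω := congrArg Subtype.val hσ
    refine ⟨⟨f, σ⟩, ?_, hσ'⟩
    simp only [Finset.mem_sigma, Finset.mem_filter, Finset.mem_univ, true_and]
    rwa [← hc, hσ']
  · rintro ⟨f, σ⟩ _
    rw [profile_ins_stub i₀ i₂]

section Edges

variable {E : Type*}

/-- Swapping two edges, and flipping all ends or all sides, commutes with `flip₀` and `flip₂`; these
symmetries act transitively on the flags. -/
theorem labelled_flip_eq [Fintype E] (r s : Flags E) :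
    labelled flip₀ flip₂ r = labelled flip₀ flip₂ s := by
  classical
  have h : ∃ e : Flags E ≃ Flags E, (∀ y, flip₀ (e y) = e (flip₀ y)) ∧
      (∀ y, flip₂ (e y) = e (flip₂ y)) ∧ e s = r := by
    refine ⟨Equiv.prodCongr (Equiv.swap s.1 r.1) (Equiv.prodCongr
      (Function.Involutive.toPerm (fun b => xor b (xor s.2.1 r.2.1)) (fun b => by simp))
      (Function.Involutive.toPerm (fun b => xor b (xor s.2.2 r.2.2)) (fun b => by simp))),
      ?_, ?_, ?_⟩
    · exact fun y => Prod.ext rfl (Prod.ext (Bool.not_xor _ _).symm rfl)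
    · exact fun y => Prod.ext rfl (Prod.ext rfl (Bool.not_xor _ _).symm)
    · obtain ⟨s, a, b⟩ := s
      obtain ⟨r, c, d⟩ := r
      have hx : ∀ a c : Bool, xor a (xor a c) = c := by decide
      exact Prod.ext (Equiv.swap_apply_left s r) (Prod.ext (hx a c) (hx b d))
  obtain ⟨e, h₀, h₂, he⟩ := h
  rw [← he, labelled_equiv e flip₀_involutive flip₂_involutive h₀ h₂]

/-- The flags of `E` and of one more edge. -/
def optionFun : Flags (Option E) → (Flags E ⊕ Bool) ⊕ Bool
  | (some e, q) => Sum.inl (Sum.inl (e, q))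
  | (none, (a, false)) => Sum.inl (Sum.inr a)
  | (none, (a, true)) => Sum.inr a

theorem optionFun_bijective : Function.Bijective (optionFun : Flags (Option E) → _) := by
  constructor
  · rintro ⟨_ | e, a, _ | _⟩ ⟨_ | e', a', _ | _⟩ h <;> simp_all [optionFun]
  · rintro ((⟨e, q⟩ | b) | b)
    exacts [⟨(some e, q), rfl⟩, ⟨(none, (b, false)), rfl⟩, ⟨(none, (b, true)), rfl⟩]

theorem labelled_option [Fintype E] :
    labelled flip₀ flip₂ ((none, (false, false)) : Flags (Option E)) = rootedAt E := by
  symm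
  refine labelled_equiv (Equiv.ofBijective _ (optionFun_bijective (E := E)))
    (stub_involutive (stub_involutive flip₀_involutive)) (cross_involutive flip₂_involutive)
    ?_ ?_ (none, (false, false))
  · rintro ⟨_ | e, a, _ | _⟩ <;> rfl
  · rintro ⟨_ | e, a, _ | _⟩ <;> rfl

theorem stubbed_option [Fintype E] :
    stubbed (Option E) = (4 * (Fintype.card E + 1)) • (rootedAt E).map Profile.succ := by
  rw [stubbed, labelled_stub_eq_sum flip₀_involutive flip₂_involutive,
    Finset.sum_congr rfl (fun r _ => by
      rw [labelled_flip_eq r (none, (false, false)), labelled_option]), Finset.sum_const]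
  congr 1
  simp [Flags]
  ring

end Edges

/-- The initial condition is the map with a single vertex and no edge: the only involution exchanges
the flags of the stub, which alone accounts for the degree 1. -/
theorem stubbed_zero : stubbed (Fin 0) = {⟨true, 1, 1, 0⟩} := by
  classical
  let σ₀ : Inv (Flags (Fin 0) ⊕ Bool) :=
    ⟨stub flip₂, stub_involutive flip₂_involutive, stub_ne flip₂_ne⟩
  have hu : ∀ σ : Inv (Flags (Fin 0) ⊕ Bool), σ = σ₀ := by
    intro σ
    apply Subtype.ext
    funext z
    rcases z with x | b
    · exact x.1.elim0
    · change σ.1 (Sum.inr b) = Sum.inr (!b)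
      rcases h : σ.1 (Sum.inr b) with x | c
      · exact x.1.elim0
      · have h1 := σ.ne (Sum.inr b)
        rw [h] at h1
        cases b <;> cases c <;> simp_all
  have hj : ∀ {α β : Flags (Fin 0) ⊕ Bool → Flags (Fin 0) ⊕ Bool} z,
      Joined α (stub flip₂) β (Sum.inr false) z := by
    intro α β z
    rcases z with x | _ | _
    · exact x.1.elim0
    · exact Joined.refl _
    · exact joined_snd (β := stub flip₂) (Sum.inr false)
  have hst : (stub flip₀ : Flags (Fin 0) ⊕ Bool → Flags (Fin 0) ⊕ Bool) = stub flip₂ := by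
    funext z
    rcases z with x | b
    · exact x.1.elim0
    · rfl
  have hcls : ∀ α β : Flags (Fin 0) ⊕ Bool → Flags (Fin 0) ⊕ Bool,
      (cls α (stub flip₂) β (Sum.inr false)).card = 2 := by
    intro α β
    have : cls α (stub flip₂) β (Sum.inr false) = Finset.univ := by
      ext z
      simpa using hj z
    rw [this]
    simp
  have hrest : ∀ α β : Flags (Fin 0) ⊕ Bool → Flags (Fin 0) ⊕ Bool,
      sizes α (stub flip₂) β (fun z => ¬ Joined α (stub flip₂) β (Sum.inr false) z) = 0 :=
    fun α β => sizes_false fun z h => h (hj z)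
  have hp : profile (stub flip₀) σ₀.1 (stub flip₂) (Sum.inr false) = ⟨true, 1, 1, 0⟩ := by
    rw [hst]
    ext1
    · rw [profile_ori]
      refine ⟨Sum.elim (fun _ => false) id, ?_⟩
      rintro (x | b)
      · exact x.1.elim0
      · exact ⟨rfl, rfl, rfl⟩
    · simp only [profile]
      rw [sizes_eq_cons saturated_true (a := Sum.inr false) trivial, sizes_false (fun z h =>
        h.2 (hj z))]
      rfl
    · simp only [profile]
      rw [hcls]
    · simp only [profile]
      rw [hrest]
      rfl
  rw [stubbed, labelled, Finset.sum_eq_single_of_mem σ₀]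
  · rw [hp]
  · simp only [Finset.mem_filter, Finset.mem_univ, true_and]
    intro z
    rw [hst]
    exact hj z
  · intro σ _ h
    exact absurd (hu σ) h

theorem joins_add_right (s t t' : Multiset Profile) :
    joins s (t + t') = joins s t + joins s t' := by
  simp [joins, Multiset.bind_add]

theorem bind_nsmul {α β : Type*} (n : ℕ) (s : Multiset α) (f : α → Multiset β) :
    (n • s).bind f = n • s.bind f := by
  induction n with
  | zero => simp
  | succ n ih => rw [succ_nsmul, succ_nsmul, Multiset.add_bind, ih]

theorem joins_nsmul (a b : ℕ) (s t : Multiset Profile) :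
    joins (a • s) (b • t) = (a * b) • joins s t := by
  have h : ∀ (b : ℕ) t, joins s (b • t) = b • joins s t := by
    intro b t
    induction b with
    | zero => simp [joins]
    | succ b ih => rw [succ_nsmul, succ_nsmul, joins_add_right, ih]
  rw [joins, bind_nsmul, ← joins, h, smul_smul]

/-- Only the cardinalities of the two edge sets matter, so the sum over subsets acquires binomial
coefficients. -/
theorem stubbed_fin_succ (n : ℕ) :
    stubbed (Fin (n + 1)) = (4 * (n + 1)) • ((stubbed (Fin n)).bind Profile.step +
      ∑ i ∈ Finset.range (n + 1), n.choose i • joins (stubbed (Fin i))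
        (stubbed (Fin (n - i)))).map Profile.succ := by
  classical
  rw [stubbed_equiv (finSuccEquiv n).symm, stubbed_option, rootedAt_eq, Fintype.card_fin]
  congr 3
  rw [Finset.sum_congr rfl (g := fun S : Finset (Fin n) => (fun i => joins (stubbed (Fin i))
    (stubbed (Fin (n - i)))) S.card)]
  · rw [← Finset.powerset_univ]
    refine (Finset.sum_powerset_apply_card (fun i => joins (stubbed (Fin i))
      (stubbed (Fin (n - i))))).trans ?_
    rw [Finset.card_univ, Fintype.card_fin]
  · intro S _
    have h1 : {e // e ∈ S} ≃ Fin S.card := S.equivFin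
    have h2 : {e // e ∉ S} ≃ Fin (n - S.card) :=
      Fintype.equivFinOfCardEq (by rw [Fintype.card_subtype_compl]; simp)
    exact congrArg₂ joins (stubbed_equiv h1.symm) (by convert stubbed_equiv h2.symm)

/-- The profiles of the rooted maps with `n` edges (the degree of the root-vertex being increased
by one), defined by their recursion. -/
noncomputable def mapProfiles : ℕ → Multiset Profile
  | 0 => {⟨true, 1, 1, 0⟩}
  | n + 1 => ((mapProfiles n).bind Profile.step +
      ∑ i : Fin (n + 1), joins (mapProfiles i) (mapProfiles (n - i))).map Profile.succ

/-- The passage from exponential to ordinary generating functions: the binomial coefficients cancel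
against the factorials, and `4 (n + 1)` is the quotient of consecutive factors. -/
theorem stubbed_eq_nsmul (n : ℕ) : stubbed (Fin n) = (n.factorial * 4 ^ n) • mapProfiles n := by
  induction n using Nat.strong_induction_on with
  | _ n ih =>
    match n with
    | 0 => rw [stubbed_zero, mapProfiles]; simp
    | n + 1 =>
      rw [stubbed_fin_succ, mapProfiles, ih n (by omega), bind_nsmul]
      rw [Finset.sum_congr rfl (g := fun i =>
        (n.factorial * 4 ^ n) • joins (mapProfiles i) (mapProfiles (n - i)))]
      · rw [← Finset.smul_sum, ← nsmul_add, Multiset.map_nsmul, smul_smul,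
          ← Fin.sum_univ_eq_sum_range (fun i => joins (mapProfiles i) (mapProfiles (n - i)))]
        congr 1
        rw [Nat.factorial_succ, pow_succ]
        ring
      · intro i hi
        have hi' : i ≤ n := by have := Finset.mem_range.1 hi; omega
        rw [ih i (by omega), ih (n - i) (by omega), joins_nsmul, smul_smul]
        congr 1
        rw [← Nat.choose_mul_factorial_mul_factorial hi',
          show 4 ^ n = 4 ^ i * 4 ^ (n - i) by rw [← pow_add]; congr 1; omega]
        ring


/-! ## Rooted maps up to isomorphism -/

theorem joined_iff_closure {Y : Type*} (α β γ : Equiv.Perm Y) (a b : Y) :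
    Joined α β γ a b ↔ ∃ τ ∈ Subgroup.closure {α, β, γ}, τ a = b := by
  constructor
  · intro h
    have hs : ∀ δ ∈ ({α, β, γ} : Set (Equiv.Perm Y)), ∀ y,
        (∃ τ ∈ Subgroup.closure {α, β, γ}, τ a = δ y) ↔
        (∃ τ ∈ Subgroup.closure {α, β, γ}, τ a = y) := by
      intro δ hδ y
      have hδ' := Subgroup.subset_closure hδ
      constructor
      · rintro ⟨τ, hτ, h⟩
        exact ⟨δ⁻¹ * τ, mul_mem (inv_mem hδ') hτ, by simp [h]⟩
      · rintro ⟨τ, hτ, h⟩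
        exact ⟨δ * τ, mul_mem hδ' hτ, by simp [h]⟩
    exact (h (fun b => ∃ τ ∈ Subgroup.closure {α, β, γ}, τ a = b) (hs α (by simp))
      (hs β (by simp)) (hs γ (by simp))).1 ⟨1, one_mem _, rfl⟩
  · rintro ⟨τ, hτ, rfl⟩
    induction hτ using Subgroup.closure_induction generalizing a with
    | mem δ hδ =>
      rcases hδ with rfl | rfl | rfl
      exacts [joined_fst _, joined_snd _, joined_thd _]
    | one => exact Joined.refl _
    | mul x y _ _ hx hy => exact (hy a).trans (hx (y a))
    | inv x _ hx =>
      have := hx (x⁻¹ a)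
      rw [show x (x⁻¹ a) = a by simp] at this
      exact this.symm

theorem joined_iff_closure_pair {Y : Type*} (α β : Equiv.Perm Y) (a b : Y) :
    Joined α β β a b ↔ ∃ τ ∈ Subgroup.closure {α, β}, τ a = b := by
  rw [joined_iff_closure, Set.pair_eq_singleton]

namespace RootedMap

variable {n : ℕ}

/-- The profile of a rooted map. -/
noncomputable def toProfile (M : RootedMap n) : Profile := profile M.σ₀ M.σ₁ M.σ₂ M.root

theorem joined (M : RootedMap n) (a b : Fin (4 * n)) : Joined M.σ₀ M.σ₁ M.σ₂ a b :=
  (joined_iff_closure _ _ _ _ _).2 (M.connected a b)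

theorem IsIso.toProfile_eq {M M' : RootedMap n} {φ : Equiv.Perm (Fin (4 * n))}
    (h : IsIso M M' φ) : M'.toProfile = M.toProfile := by
  rw [toProfile, ← h.2.2.2]
  exact profile_equiv φ M'.invol₀ M'.invol₁ M'.invol₂ (fun y => (h.1 y).symm)
    (fun y => (h.2.1 y).symm) (fun y => (h.2.2.1 y).symm) _

/-- Two maps commuting with the three involutions of a rooted map agree as soon as they agree on
the root. -/
theorem eq_of_equivariant (M : RootedMap n) {Y : Type*} {α β γ : Y → Y}
    {φ ψ : Fin (4 * n) → Y}
    (h₀ : ∀ f, φ (M.σ₀ f) = α (φ f)) (h₁ : ∀ f, φ (M.σ₁ f) = β (φ f))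
    (h₂ : ∀ f, φ (M.σ₂ f) = γ (φ f))
    (k₀ : ∀ f, ψ (M.σ₀ f) = α (ψ f)) (k₁ : ∀ f, ψ (M.σ₁ f) = β (ψ f))
    (k₂ : ∀ f, ψ (M.σ₂ f) = γ (ψ f)) (hr : φ M.root = ψ M.root) (f : Fin (4 * n)) :
    φ f = ψ f := by
  refine ((saturated_of_forward (p := fun f => φ f = ψ f) M.invol₀ M.invol₁ M.invol₂
    ?_ ?_ ?_) _ _ (M.joined M.root f)).1 hr
  · intro f h; rw [h₀, k₀, h]
  · intro f h; rw [h₁, k₁, h]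
  · intro f h; rw [h₂, k₂, h]

/-- Rooted maps are rigid: by connectedness the image of the root determines everything. -/
theorem IsIso.unique {M M' : RootedMap n} {φ ψ : Equiv.Perm (Fin (4 * n))}
    (h : IsIso M M' φ) (h' : IsIso M M' ψ) : φ = ψ :=
  Equiv.ext fun f => eq_of_equivariant M h.1 h.2.1 h.2.2.1 h'.1 h'.2.1 h'.2.2.1
    (h.2.2.2.trans h'.2.2.2.symm) f

/-- The identifications of the edges of `M` with standard edges. -/
def Frame (M : RootedMap n) : Type :=
  {e : Flags (Fin n) ≃ Fin (4 * n) //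
    (∀ x, e (flip₀ x) = M.σ₀ (e x)) ∧ ∀ x, e (flip₂ x) = M.σ₂ (e x)}

instance (M : RootedMap n) : Finite M.Frame := Subtype.finite

end RootedMap

/-! ### The Klein four-group acting on the flags of an edge -/

/-- The action of the pair `q` of changes of end and of side. -/
def quad {Z : Type*} (s t : Z → Z) (q : Bool × Bool) (z : Z) : Z :=
  bif q.1 then s (bif q.2 then t z else z) else (bif q.2 then t z else z)

section Quad

variable {Z : Type*} {s t : Z → Z} (hs : Function.Involutive s) (ht : Function.Involutive t)
  (hst : ∀ z, s (t z) = t (s z))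

include hs ht hst

theorem quad_quad (q r : Bool × Bool) (z : Z) :
    quad s t q (quad s t r z) = quad s t (xor q.1 r.1, xor q.2 r.2) z := by
  obtain ⟨_ | _, _ | _⟩ := q <;> obtain ⟨_ | _, _ | _⟩ := r <;>
    simp [quad, hs _, ht _, ← hst]

theorem quad_eq_self (ns : ∀ z, s z ≠ z) (nt : ∀ z, t z ≠ z) (nst : ∀ z, s (t z) ≠ z)
    {q r : Bool × Bool} {z : Z} (h : quad s t q z = quad s t r z) : q = r := by
  have h1 := congrArg (quad s t r) h
  rw [quad_quad hs ht hst, quad_quad hs ht hst, Bool.xor_self, Bool.xor_self] at h1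
  obtain ⟨_ | _, _ | _⟩ := q <;> obtain ⟨_ | _, _ | _⟩ := r <;>
    first
      | rfl
      | exact absurd h1 (ns _)
      | exact absurd h1 (nt _)
      | exact absurd h1 (nst _)

/-- The changes of end and of side generate a Klein four-group acting freely. Its orbits are the
edges, and a base flag in each orbit gives coordinates. -/
theorem exists_frame {n : ℕ} [Fintype Z] (hZ : Fintype.card Z = 4 * n) (ns : ∀ z, s z ≠ z)
    (nt : ∀ z, t z ≠ z) (nst : ∀ z, s (t z) ≠ z) :
    ∃ e : Flags (Fin n) ≃ Z, (∀ x, e (flip₀ x) = s (e x)) ∧ ∀ x, e (flip₂ x) = t (e x) := by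
  classical
  have hqq := quad_quad hs ht hst
  let S : Setoid Z :=
    { r := fun z w => ∃ q, quad s t q z = w
      iseqv := ⟨fun z => ⟨(false, false), rfl⟩, fun {z w} ⟨q, h⟩ => ⟨q, by
          rw [← h, hqq]; simp [quad]⟩, fun {x y z} ⟨q, h⟩ ⟨r, h'⟩ => ⟨(xor r.1 q.1, xor r.2 q.2), by
          rw [← hqq, h, h']⟩⟩ }
  have hb : Function.Bijective (fun p : Quotient S × (Bool × Bool) => quad s t p.2 p.1.out) := by
    constructor
    · rintro ⟨k, q⟩ ⟨k', q'⟩ h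
      have hk : k = k' := by
        rw [← Quotient.out_eq k, ← Quotient.out_eq k']
        apply Quotient.sound
        refine ⟨(xor q'.1 q.1, xor q'.2 q.2), ?_⟩
        rw [← hqq]
        rw [show quad s t q k.out = quad s t q' k'.out from h, hqq]
        simp [quad]
      subst hk
      exact Prod.ext rfl (quad_eq_self hs ht hst ns nt nst h)
    · intro z
      obtain ⟨q, hq⟩ := Quotient.exact (Quotient.out_eq (Quotient.mk S z))
      exact ⟨(Quotient.mk S z, q), hq⟩
  have hcard : Fintype.card (Quotient S) = n := by
    have h := Fintype.card_of_bijective hb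
    rw [hZ, Fintype.card_prod] at h
    simp at h
    omega
  refine ⟨(Equiv.prodCongr (Fintype.equivFinOfCardEq hcard).symm (Equiv.refl _)).trans
    (Equiv.ofBijective _ hb), ?_, ?_⟩
  · rintro ⟨i, a, b⟩
    cases a <;> cases b <;> simp [quad, hs _, flip₀]
  · rintro ⟨i, a, b⟩
    cases a <;> cases b <;> simp [quad, ht _, ← hst, flip₂]

end Quad

namespace RootedMap

variable {n : ℕ}

/-- Two frames differ by a permutation of the edges together with an element of the Klein four-group
for each edge, and all such changes are allowed. -/
theorem card_frame (M : RootedMap n) : Nat.card M.Frame = n.factorial * 4 ^ n := by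
  classical
  obtain ⟨e, he₀, he₂⟩ := exists_frame (n := n) M.invol₀ M.invol₂ M.comm (by simp)
    M.ne₀ M.ne₂ M.ne₀₂
  have hx : ∀ a b : Bool, xor (xor a b) b = a := by decide
  let A : Equiv.Perm (Fin n) × (Fin n → Bool × Bool) → (Flags (Fin n) ≃ Flags (Fin n)) :=
    fun p =>
      { toFun := fun x => (p.1 x.1, (xor x.2.1 (p.2 x.1).1, xor x.2.2 (p.2 x.1).2))
        invFun := fun x => (p.1.symm x.1, (xor x.2.1 (p.2 (p.1.symm x.1)).1,
          xor x.2.2 (p.2 (p.1.symm x.1)).2))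
        left_inv := fun x => by simp [hx]
        right_inv := fun x => by simp [hx] }
  have hA₀ : ∀ p x, A p (flip₀ x) = flip₀ (A p x) := fun p x => by
    simp [A, flip₀]
  have hA₂ : ∀ p x, A p (flip₂ x) = flip₂ (A p x) := fun p x => by
    simp [A, flip₂]
  let F : Equiv.Perm (Fin n) × (Fin n → Bool × Bool) → M.Frame := fun p =>
    ⟨(A p).trans e, fun x => by simp [hA₀, he₀], fun x => by simp [hA₂, he₂]⟩
  have hF : Function.Bijective F := by
    constructor
    · rintro ⟨π, u⟩ ⟨π', u'⟩ h
      have h1 : ∀ x, A (π, u) x = A (π', u') x := fun x =>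
        e.injective (congrFun (congrArg DFunLike.coe (congrArg Subtype.val h)) x)
      have h2 : ∀ i, π i = π' i ∧ u i = u' i := by
        intro i
        have := h1 (i, (false, false))
        simp only [A, Equiv.coe_fn_mk, Prod.mk.injEq, Bool.false_xor] at this
        exact ⟨this.1, Prod.ext this.2.1 this.2.2⟩
      exact Prod.ext (Equiv.ext fun i => (h2 i).1) (funext fun i => (h2 i).2)
    · rintro ⟨d, hd₀, hd₂⟩
      let ψ : Flags (Fin n) ≃ Flags (Fin n) := d.trans e.symm
      have hψ₀ : ∀ x, ψ (flip₀ x) = flip₀ (ψ x) := fun x => by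
        apply e.injective
        simp [ψ, hd₀, he₀]
      have hψ₂ : ∀ x, ψ (flip₂ x) = flip₂ (ψ x) := fun x => by
        apply e.injective
        simp [ψ, hd₂, he₂]
      -- An equivariant bijection is determined by the images of the base flags.
      have hψ : ∀ i a b, ψ (i, (a, b)) = ((ψ (i, (false, false))).1,
          (xor a (ψ (i, (false, false))).2.1, xor b (ψ (i, (false, false))).2.2)) := by
        intro i a b
        have h10 := hψ₀ (i, (false, false))
        have h01 := hψ₂ (i, (false, false))
        have h11 := hψ₂ (i, (true, false))
        simp only [flip₀, flip₂, Bool.not_false] at h10 h01 h11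
        cases a <;> cases b
        · simp
        · rw [h01]; simp
        · rw [h10]; simp
        · rw [h11, h10]; simp
      have hinj : Function.Injective (fun i => (ψ (i, (false, false))).1) := by
        intro i j hij
        obtain ⟨a, b, hab⟩ : ∃ a b, ψ (j, (a, b)) = ψ (i, (false, false)) := by
          refine ⟨xor (ψ (i, (false, false))).2.1 (ψ (j, (false, false))).2.1,
            xor (ψ (i, (false, false))).2.2 (ψ (j, (false, false))).2.2, ?_⟩
          rw [hψ, hx, hx]
          exact Prod.ext hij.symm rfl
        exact (congrArg Prod.fst (ψ.injective hab)).symm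
      refine ⟨(Equiv.ofBijective _ (Finite.injective_iff_bijective.1 hinj),
        fun i => (ψ (i, (false, false))).2), ?_⟩
      apply Subtype.ext
      apply Equiv.ext
      rintro ⟨i, a, b⟩
      apply e.symm.injective
      have := hψ i a b
      simp only [ψ, Equiv.trans_apply] at this
      rw [this]
      simp [F, A, ψ]
  rw [← Nat.card_congr (Equiv.ofBijective F hF), Nat.card_prod, Nat.card_perm, Nat.card_fun]
  simp

/-- The rooted map given by an involution of standard flags. -/
def ofInv (e : Flags (Fin n) ≃ Fin (4 * n)) (σ : Inv (Flags (Fin n))) (r : Flags (Fin n))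
    (h : Connected flip₀ σ.1 flip₂ r) : RootedMap n where
  σ₀ := e.permCongr (flip₀_involutive.toPerm _)
  σ₁ := e.permCongr (σ.invol.toPerm _)
  σ₂ := e.permCongr (flip₂_involutive.toPerm _)
  root := e r
  invol₀ f := by simp [Equiv.permCongr_apply, flip₀_involutive _]
  invol₁ f := by simp [Equiv.permCongr_apply, σ.invol _]
  invol₂ f := by simp [Equiv.permCongr_apply, flip₂_involutive _]
  ne₀ f h := by
    have := congrArg e.symm h
    simp [Equiv.permCongr_apply, flip₀, Prod.ext_iff] at this
  ne₁ f h := by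
    have := congrArg e.symm h
    simp only [Equiv.permCongr_apply, Function.Involutive.coe_toPerm,
      Equiv.symm_apply_apply] at this
    exact σ.ne _ this
  ne₂ f h := by
    have := congrArg e.symm h
    simp [Equiv.permCongr_apply, flip₂, Prod.ext_iff] at this
  comm f := by simp [Equiv.permCongr_apply, flip₀, flip₂]
  ne₀₂ f h := by
    have := congrArg e.symm h
    simp [Equiv.permCongr_apply, flip₀, flip₂, Prod.ext_iff] at this
  connected f f' := by
    rw [← joined_iff_closure]
    have hj : ∀ z, Joined (e.permCongr (flip₀_involutive.toPerm _))
      (e.permCongr (σ.invol.toPerm _)) (e.permCongr (flip₂_involutive.toPerm _)) (e r) z := by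
      refine (connected_equiv e ?_ ?_ ?_ ?_ ?_ ?_ r).2 h
      · intro f; simp [Equiv.permCongr_apply, flip₀_involutive _]
      · intro f; simp [Equiv.permCongr_apply, σ.invol _]
      · intro f; simp [Equiv.permCongr_apply, flip₂_involutive _]
      all_goals intro f; simp [Equiv.permCongr_apply]
    exact (hj f).symm.trans (hj f')

noncomputable instance (n : ℕ) : Fintype (Quotient (isoSetoid n)) :=
  Fintype.ofFinite _

/-- The profiles of the isomorphism classes of rooted maps. -/
theorem sum_profiles (n : ℕ) :
    ∑ c : Quotient (isoSetoid (n + 1)), ({c.out.toProfile.succ} : Multiset Profile) =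
      mapProfiles (n + 1) := by
  classical
  -- Double counting: a class with a frame of its representative amounts to a root flag with an
  -- involution of the standard flags. Rigidity ensures that distinct frames give distinct data.
  have key : ((n + 1).factorial * 4 ^ (n + 1)) •
      ∑ c : Quotient (isoSetoid (n + 1)), ({c.out.toProfile.succ} : Multiset Profile) =
      stubbed (Fin (n + 1)) := by
    have : ∀ M : RootedMap (n + 1), Fintype M.Frame := fun M => Fintype.ofFinite _
    rw [stubbed, labelled_stub_eq_sum flip₀_involutive flip₂_involutive, Finset.smul_sum,
      Finset.sum_congr rfl (g := fun c : Quotient (isoSetoid (n + 1)) =>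
        ∑ e : c.out.Frame, ({c.out.toProfile.succ} : Multiset Profile))]
    · simp only [labelled, map_sum_singleton]
      rw [Finset.sum_sigma', Finset.sum_sigma']
      refine Finset.sum_bij (fun q _ => ⟨q.2.1.symm q.1.out.root,
        Inv.conj q.2.1.symm ⟨q.1.out.σ₁, q.1.out.invol₁, q.1.out.ne₁⟩⟩) ?_ ?_ ?_ ?_
      · rintro ⟨c, e, he₀, he₂⟩ -
        simp only [Finset.mem_sigma, Finset.mem_filter, Finset.mem_univ, true_and]
        refine (connected_equiv e.symm flip₀_involutive (Inv.invol _) flip₂_involutive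
          (fun y => ?_) (fun y => ?_) (fun y => ?_) c.out.root).2 (c.out.joined _)
        · rw [Equiv.eq_symm_apply, he₀]; simp
        · simp [Inv.conj]
        · rw [Equiv.eq_symm_apply, he₂]; simp
      · rintro ⟨c, e, he₀, he₂⟩ - ⟨c', e', he₀', he₂'⟩ - h
        simp only [Sigma.mk.injEq, heq_eq_eq] at h
        obtain ⟨hr, hσ⟩ := h
        have hσ' : ∀ x, e.symm (c.out.σ₁ (e x)) = e'.symm (c'.out.σ₁ (e' x)) := fun x =>
          congrFun (congrArg Subtype.val hσ) x
        have hi : IsIso c.out c'.out (e.symm.trans e') := by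
          refine ⟨fun f => ?_, fun f => ?_, fun f => ?_, ?_⟩
          · simp only [Equiv.trans_apply]
            rw [← he₀', e'.apply_eq_iff_eq, Equiv.symm_apply_eq, he₀]
            simp
          · have := hσ' (e.symm f)
            rw [Equiv.apply_symm_apply] at this
            simp only [Equiv.trans_apply]
            rw [this]
            simp
          · simp only [Equiv.trans_apply]
            rw [← he₂', e'.apply_eq_iff_eq, Equiv.symm_apply_eq, he₂]
            simp
          · simp only [Equiv.trans_apply]
            rw [hr]
            simp
        have hc : c = c' := by
          rw [← Quotient.out_eq c, ← Quotient.out_eq c']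
          exact Quotient.sound ⟨_, hi⟩
        subst hc
        have h1 := hi.unique (isIso_refl _)
        have h2 : e = e' := by
          apply Equiv.ext
          intro x
          have := congrArg (fun φ : Equiv.Perm _ => φ (e x)) h1
          simpa using this.symm
        subst h2
        rfl
      · rintro ⟨r, σ⟩ h
        simp only [Finset.mem_sigma, Finset.mem_filter, Finset.mem_univ, true_and] at h
        let ε : Flags (Fin (n + 1)) ≃ Fin (4 * (n + 1)) :=
          Fintype.equivFinOfCardEq (by simp [Flags]; ring)
        obtain ⟨φ, h₀, h₁, h₂, hr⟩ := Quotient.exact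
          (Quotient.out_eq (Quotient.mk (isoSetoid (n + 1)) (ofInv ε σ r h))).symm
        refine ⟨⟨Quotient.mk _ (ofInv ε σ r h), ε.trans φ, fun x => ?_, fun x => ?_⟩,
          by simp, ?_⟩
        · rw [Equiv.trans_apply, Equiv.trans_apply, ← h₀]
          simp [ofInv, Equiv.permCongr_apply]
        · rw [Equiv.trans_apply, Equiv.trans_apply, ← h₂]
          simp [ofInv, Equiv.permCongr_apply]
        · simp only [Sigma.mk.injEq, heq_eq_eq]
          constructor
          · rw [← hr]
            simp [ofInv]
          · apply Subtype.ext
            funext x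
            simp only [Inv.conj, Equiv.symm_symm, Equiv.trans_apply]
            rw [← h₁]
            simp [ofInv, Equiv.permCongr_apply]
      · rintro ⟨c, e, he₀, he₂⟩ -
        congr 2
        symm
        refine profile_equiv e.symm flip₀_involutive (Inv.invol _) flip₂_involutive
          (fun y => ?_) (fun y => ?_) (fun y => ?_) c.out.root
        · rw [Equiv.eq_symm_apply, he₀]; simp
        · simp [Inv.conj]
        · rw [Equiv.eq_symm_apply, he₂]; simp
    · intro c _
      rw [Finset.sum_const, Finset.card_univ, ← Nat.card_eq_fintype_card, card_frame]
  rw [stubbed_eq_nsmul] at key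
  -- The common factor is cancelled on multiplicities.
  ext q
  have := congrArg (Multiset.count q) key
  rw [Multiset.count_nsmul, Multiset.count_nsmul] at this
  exact Nat.eq_of_mul_eq_mul_left (by positivity) this

end RootedMap


/-! ## Marks -/

/-- The submultisets of `D` whose complement consists of entries `3` only. -/
noncomputable def marks (D : Multiset ℕ) : Multiset (Multiset ℕ) :=
  (D.antidiagonal.filter fun p => ∀ b ∈ p.1, b = 3).map Prod.snd

@[simp] theorem marks_zero : marks 0 = {0} := by
  rw [marks, Multiset.antidiagonal_zero, Multiset.filter_singleton]
  simp

/-- The entry `a` is either unmarked, which forces `a = 3`, or marked. -/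
theorem marks_cons (a : ℕ) (D : Multiset ℕ) :
    marks (a ::ₘ D) = (if a = 3 then marks D else 0) + (marks D).map (Multiset.cons a) := by
  rw [marks, Multiset.antidiagonal_cons, Multiset.filter_add, Multiset.map_add, add_comm,
    Multiset.filter_map, Multiset.filter_map, Multiset.map_map, Multiset.map_map, marks,
    Multiset.map_map]
  congr 1
  by_cases h : a = 3
  · simp [h]
  · simp [h]

theorem marks_add (D E : Multiset ℕ) :
    marks (D + E) = (marks D).bind fun T => (marks E).map fun U => T + U := by
  induction D using Multiset.induction_on with
  | empty => simp
  | cons a D ih =>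
    rw [Multiset.cons_add, marks_cons, marks_cons, Multiset.add_bind, ih, Multiset.bind_map,
      Multiset.map_bind]
    simp only [Multiset.map_map, Function.comp_def, Multiset.cons_add]
    split_ifs <;> simp

/-- Removing `b` and marking `T` in the rest amounts to marking `b` as well and then picking it
among the marks. A merge with an arbitrary vertex thereby becomes a merge with a marked one. -/
theorem marks_pick (D : Multiset ℕ) :
    (D.bind fun b => (marks (D.erase b)).map fun T => (b, T)) =
      (marks D).bind fun T => T.map fun b => (b, T.erase b) := by
  induction D using Multiset.induction_on with
  | empty => simp
  | cons a D ih =>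
    have h1 : (D.bind fun b => (marks ((a ::ₘ D).erase b)).map fun T => (b, T)) =
        D.bind fun b => ((if a = 3 then (marks (D.erase b)).map fun T => (b, T) else 0) +
          (marks (D.erase b)).map fun T => (b, a ::ₘ T)) := by
      refine Multiset.bind_congr fun b hb => ?_
      have h : (a ::ₘ D).erase b = a ::ₘ D.erase b := by
        by_cases hab : a = b
        · subst hab
          rw [Multiset.erase_cons_head, Multiset.cons_erase hb]
        · rw [Multiset.erase_cons_tail _ hab]
      rw [h, marks_cons, Multiset.map_add, Multiset.map_map]
      split_ifs <;> rfl
    have h2 : ((marks D).bind fun T => (a ::ₘ T).map fun b => (b, (a ::ₘ T).erase b)) =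
        (marks D).bind fun T => ((a, T) ::ₘ (T.map fun b => (b, T.erase b)).map
          fun p => (p.1, a ::ₘ p.2)) := by
      refine Multiset.bind_congr fun T _ => ?_
      rw [Multiset.map_cons, Multiset.erase_cons_head, Multiset.map_map]
      congr 1
      refine Multiset.map_congr rfl fun b hb => ?_
      by_cases hab : a = b
      · subst hab
        simp [Multiset.cons_erase hb]
      · simp [Multiset.erase_cons_tail _ hab]
    rw [Multiset.cons_bind, Multiset.erase_cons_head, h1, Multiset.bind_add, marks_cons,
      Multiset.add_bind, Multiset.bind_map, h2, Multiset.bind_cons, ← Multiset.map_bind, ← ih,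
      Multiset.map_bind]
    simp only [Multiset.map_map, Function.comp_def]
    (split_ifs <;> simp [ih]); abel

/-- Passes from submultisets of degrees to sets of actual vertices; vertices of equal degree count
separately on both sides. -/
theorem marks_map {ι : Type*} [DecidableEq ι] (V : Finset ι) (f : ι → ℕ) :
    marks (V.val.map f) = ∑ S ∈ V.powerset,
      if ∀ v ∈ V \ S, f v = 3 then {S.val.map f} else 0 := by
  induction V using Finset.induction_on with
  | empty => simp
  | insert a V ha ih =>
    rw [Finset.sum_powerset_insert ha, Finset.insert_val_of_notMem ha, Multiset.map_cons,
      marks_cons, ih]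
    congr 1
    · have h : ∀ S ∈ V.powerset, (∀ v ∈ insert a V \ S, f v = 3) ↔
          f a = 3 ∧ ∀ v ∈ V \ S, f v = 3 := by
        intro S hS
        have haS : a ∉ S := fun h => ha (Finset.mem_powerset.1 hS h)
        simp [haS]
      rw [Finset.sum_congr rfl fun S hS => if_congr (h S hS) rfl rfl]
      split_ifs with h3
      · simp [h3]
      · simp [h3]
    · rw [← Multiset.coe_mapAddMonoidHom, map_sum]
      refine Finset.sum_congr rfl fun S hS => ?_
      have haS : a ∉ S := fun h => ha (Finset.mem_powerset.1 hS h)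
      have h : insert a V \ insert a S = V \ S := by
        ext v
        simp only [Finset.mem_sdiff, Finset.mem_insert]
        constructor
        · rintro ⟨h | h, h'⟩
          · exact absurd (Or.inl h) h'
          · exact ⟨h, fun h'' => h' (Or.inr h'')⟩
        · rintro ⟨h, h'⟩
          exact ⟨Or.inr h, fun h'' => h''.elim (fun e => ha (e ▸ h)) h'⟩
      rw [h, Finset.insert_val_of_notMem haS, Multiset.map_cons]
      split_ifs <;> simp

/-! ## Codes -/

/-- Orientability and Euler characteristic of the surface, degree of the root-vertex and degrees of
the marked vertices of a marked near-cubic map. -/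
@[ext] structure Code (α : Type) where
  ori : Bool
  chi : ℤ
  deg : ℕ
  marks : α

/-- The code with unordered marks. -/
def Code.forget (q : Code (List ℕ)) : Code (Multiset ℕ) := ⟨q.ori, q.chi, q.deg, q.marks⟩

/-- The codes with unordered marks obtained by adding an edge. -/
noncomputable def Code.step' (q : Code (Multiset ℕ)) : Multiset (Code (Multiset ℕ)) :=
  (if 2 ≤ q.deg then {⟨q.ori, q.chi, q.deg - 1, q.marks⟩} else 0) +
  ∑ i ∈ Finset.range (q.deg + 1), {⟨q.ori, q.chi, i + 1, (q.deg + 1 - i) ::ₘ q.marks⟩} +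
  (q.deg + 1) • {⟨false, q.chi - 1, q.deg + 2, q.marks⟩} +
  q.marks.bind fun b => b • ({⟨q.ori, q.chi - 2, q.deg + b + 2, q.marks.erase b⟩} +
    {⟨false, q.chi - 2, q.deg + b + 2, q.marks.erase b⟩})

/-- The codes obtained by adding an edge. -/
noncomputable def Code.step (q : Code (List ℕ)) : Multiset (Code (List ℕ)) :=
  (if 2 ≤ q.deg then {⟨q.ori, q.chi, q.deg - 1, q.marks⟩} else 0) +
  ∑ i ∈ Finset.range (q.deg + 1), {⟨q.ori, q.chi, i + 1, q.marks ++ [q.deg + 1 - i]⟩} +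
  (q.deg + 1) • {⟨false, q.chi - 1, q.deg + 2, q.marks⟩} +
  ∑ j : Fin q.marks.length, q.marks[j] •
    ({⟨q.ori, q.chi - 2, q.deg + q.marks[j] + 2, q.marks.eraseIdx j⟩} +
    {⟨false, q.chi - 2, q.deg + q.marks[j] + 2, q.marks.eraseIdx j⟩})

def Code.join' (q r : Code (Multiset ℕ)) : Code (Multiset ℕ) :=
  ⟨q.ori && r.ori, q.chi + r.chi - 2, q.deg + r.deg + 2, q.marks + r.marks⟩

def Code.join (q r : Code (List ℕ)) : Code (List ℕ) :=
  ⟨q.ori && r.ori, q.chi + r.chi - 2, q.deg + r.deg + 2, q.marks ++ r.marks⟩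

/-- The codes of the marked near-cubic maps with `n` edges, by their recursion. -/
noncomputable def codes : ℕ → Multiset (Code (List ℕ))
  | 0 => {⟨true, 2, 0, []⟩}
  | n + 1 => (codes n).bind Code.step +
      ∑ i : Fin (n + 1), (codes i).bind fun q => (codes (n - i)).map q.join

/-- The codes of the marked maps over a map with `n` edges and with profile `q.succ`. -/
noncomputable def weights (n : ℕ) (q : Profile) : Multiset (Code (Multiset ℕ)) :=
  (marks q.others).map fun T => ⟨q.ori, 1 + q.others.card - n + q.faces, q.deg - 1, T⟩

theorem deg_pos_of_mem {n : ℕ} {q : Profile} (h : q ∈ mapProfiles n) : 1 ≤ q.deg := by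
  cases n with
  | zero =>
    rw [mapProfiles, Multiset.mem_singleton] at h
    rw [h]
  | succ n =>
    rw [mapProfiles, Multiset.mem_map] at h
    obtain ⟨r, -, rfl⟩ := h
    exact Nat.le_add_left 1 _

/-- Joining costs one vertex and adds one edge, whence `χ + χ' - 2`. The degree in a profile counts
a stub which the code does not count. -/
theorem weights_join (m n : ℕ) {q r : Profile} (hq : 1 ≤ q.deg) (hr : 1 ≤ r.deg) :
    weights (m + n + 1) (q.join r).succ =
      (weights m q).bind fun a => (weights n r).map a.join' := by
  rw [weights, weights, weights]
  simp only [Profile.join, Profile.succ, marks_add, Multiset.map_bind, Multiset.bind_map,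
    Multiset.map_map, Function.comp_def, Code.join']
  refine Multiset.bind_congr fun T _ => Multiset.map_congr rfl fun U _ => ?_
  ext1
  · rfl
  · simp only [Multiset.card_add]; push_cast; ring
  · simp only; omega
  · rfl

/-- A split-off vertex is either cubic and unmarked or a new mark, which gives the first two terms
of `Code.step'`. A twisted loop adds just an edge; a merge also loses a vertex and is rewritten by
`marks_pick`. -/
theorem weights_step (n : ℕ) {q : Profile} (hq : 1 ≤ q.deg) :
    q.step.bind (fun r => weights (n + 1) r.succ) = (weights n q).bind Code.step' := by
  obtain ⟨o, F, d, D⟩ := q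
  obtain ⟨m, rfl⟩ : ∃ m, d = m + 1 := ⟨d - 1, by simp only at hq; omega⟩
  have e1 : (∑ i ∈ Finset.range (m + 1), ({⟨o, F, i + 1, (m + 1 - i) ::ₘ D⟩} :
        Multiset Profile)).bind (fun r => weights (n + 1) r.succ) =
      ((marks D).bind fun T => if 2 ≤ m then
        {(⟨o, 1 + D.card - n + F, m - 1, T⟩ : Code (Multiset ℕ))} else 0) +
      (marks D).bind fun T => ∑ i ∈ Finset.range (m + 1),
        {(⟨o, 1 + D.card - n + F, i + 1, (m + 1 - i) ::ₘ T⟩ : Code (Multiset ℕ))} := by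
    have h : ∀ i, weights (n + 1) (Profile.succ ⟨o, F, i + 1, (m + 1 - i) ::ₘ D⟩) =
        (if m + 1 - i = 3 then (marks D).map fun T => ⟨o, 1 + D.card - n + F, i + 1, T⟩ else 0) +
        (marks D).map fun T => ⟨o, 1 + D.card - n + F, i + 1, (m + 1 - i) ::ₘ T⟩ := by
      intro i
      have hχ : (1 + ((((m + 1 - i) ::ₘ D).card : ℕ) : ℤ) - ((n + 1 : ℕ) : ℤ) + F) =
          1 + D.card - n + F := by rw [Multiset.card_cons]; push_cast; ring
      simp only [weights, Profile.succ, marks_cons, Multiset.map_add, Multiset.map_map,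
        Function.comp_def, hχ, Nat.add_sub_cancel]
      split_ifs <;> simp
    have h' : ∀ f : ℕ → Multiset ℕ → Code (Multiset ℕ), ((marks D).bind fun T =>
        ∑ i ∈ Finset.range (m + 1), {f i T}) =
        ∑ i ∈ Finset.range (m + 1), (marks D).map (f i) := by
      intro f
      generalize marks D = s
      induction s using Multiset.induction_on with
      | empty => simp
      | cons T s ih =>
        rw [Multiset.cons_bind, ih, ← Finset.sum_add_distrib]
        simp [Multiset.singleton_add]
    rw [bind_sum_singleton, Finset.sum_congr rfl fun i _ => h i, Finset.sum_add_distrib, h']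
    congr 1
    by_cases h2 : 2 ≤ m
    -- Only `i = m - 2` splits off a vertex of degree 3. It leaves degree `m - 1` at the root and
    -- requires `2 ≤ m`.
    · rw [Finset.sum_eq_single (m - 2)]
      · rw [if_pos (by omega), show m - 2 + 1 = m - 1 by omega]
        simp [h2]
      · intro i hi hne
        rw [if_neg]
        have := Finset.mem_range.1 hi
        omega
      · intro h
        exact absurd (Finset.mem_range.2 (by omega)) h
    · rw [Finset.sum_eq_zero]
      · simp [h2]
      · intro i hi
        rw [if_neg]
        omega
  have e2 : ((m + 1) • ({⟨false, F, m + 1 + 1, D⟩} : Multiset Profile)).bind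
        (fun r => weights (n + 1) r.succ) = (marks D).bind fun T =>
        (m + 1) • {(⟨false, 1 + D.card - n + F - 1, m + 2, T⟩ : Code (Multiset ℕ))} := by
    rw [bind_nsmul, Multiset.singleton_bind, weights]
    have hχ : (1 + (D.card : ℤ) - ((n + 1 : ℕ) : ℤ) + F) = 1 + D.card - n + F - 1 := by
      push_cast; ring
    simp only [Profile.succ, Nat.add_sub_cancel, hχ]
    generalize marks D = s
    induction s using Multiset.induction_on with
    | empty => simp
    | cons T s ih => rw [Multiset.cons_bind, ← ih, Multiset.map_cons, ← Multiset.singleton_add,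
        nsmul_add]
  have e3 : (D.bind fun b => b • ({⟨o, F, m + 1 + b + 1, D.erase b⟩} +
        {⟨false, F, m + 1 + b + 1, D.erase b⟩} : Multiset Profile)).bind
        (fun r => weights (n + 1) r.succ) = (marks D).bind fun T => T.bind fun b =>
        b • ({(⟨o, 1 + D.card - n + F - 2, m + b + 2, T.erase b⟩ : Code (Multiset ℕ))} +
          {⟨false, 1 + D.card - n + F - 2, m + b + 2, T.erase b⟩}) := by
    have h := congrArg (fun s : Multiset (ℕ × Multiset ℕ) => s.bind fun p =>
      p.1 • ({(⟨o, 1 + D.card - n + F - 2, m + p.1 + 2, p.2⟩ : Code (Multiset ℕ))} +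
          {⟨false, 1 + D.card - n + F - 2, m + p.1 + 2, p.2⟩})) (marks_pick D)
    simp only [Multiset.bind_assoc, Multiset.bind_map] at h
    rw [← h, Multiset.bind_assoc]
    refine Multiset.bind_congr fun b hb => ?_
    have hc : ((D.erase b).card : ℤ) = D.card - 1 := by
      rw [← Multiset.cons_erase hb, Multiset.card_cons, Multiset.erase_cons_head]
      push_cast; ring
    have hχ : (1 + ((D.erase b).card : ℤ) - ((n + 1 : ℕ) : ℤ) + F) = 1 + D.card - n + F - 2 := by
      rw [hc]; push_cast; ring
    rw [bind_nsmul, Multiset.add_bind, Multiset.singleton_bind, Multiset.singleton_bind]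
    simp only [weights, Profile.succ, Nat.add_sub_cancel, hχ,
      show m + 1 + b + 1 = m + b + 2 by ring]
    generalize marks (D.erase b) = s
    induction s using Multiset.induction_on with
    | empty => simp
    | cons T s ih =>
      rw [Multiset.cons_bind, ← ih, Multiset.map_cons, Multiset.map_cons, ← Multiset.singleton_add,
        ← Multiset.singleton_add, ← nsmul_add]
      congr 1
      abel
  rw [Profile.step, Multiset.add_bind, Multiset.add_bind]
  refine (congrArg₂ _ (congrArg₂ _ e1 e2) e3).trans ?_
  rw [weights, Multiset.bind_map, ← Multiset.bind_add, ← Multiset.bind_add, ← Multiset.bind_add]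
  rfl

/-- Where a new mark is placed and which of two equal marks is erased are invisible in the multiset.
-/
theorem Code.forget_step (q : Code (List ℕ)) : q.step.map Code.forget = q.forget.step' := by
  obtain ⟨o, χ, d, l⟩ := q
  have h : ∀ (G : ℕ → Multiset ℕ → Multiset (Code (Multiset ℕ))),
      ∑ j : Fin l.length, G l[j] (l.eraseIdx j : Multiset ℕ) =
      (l : Multiset ℕ).bind fun b => G b ((l : Multiset ℕ).erase b) := by
    intro G
    have h1 : ∀ j : Fin l.length, ((l.eraseIdx j : List ℕ) : Multiset ℕ) =
        (l : Multiset ℕ).erase l[j] := by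
      intro j
      rw [← Multiset.cons_inj_right l[j], Multiset.cons_erase (by simp), Multiset.cons_coe,
        Multiset.coe_eq_coe]
      exact List.getElem_cons_eraseIdx_perm j.2
    simp only [h1]
    rw [← Finset.sum_map_val]
    change _ = (Multiset.map _ (l : Multiset ℕ)).sum
    have h2 : (Finset.univ : Finset (Fin l.length)).val.map (fun j => l[j]) = (l : Multiset ℕ) := by
      rw [Fin.univ_val_map]
      simp
    conv_rhs => rw [← h2]
    rw [Multiset.map_map]
    rw [h2]
    rfl
  rw [Code.step, Code.step', Multiset.map_add, Multiset.map_add, Multiset.map_add]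
  congr 1
  · congr 1
    · congr 1
      · by_cases h2 : 2 ≤ d <;> simp [Code.forget, h2]
      · rw [map_sum_singleton]
        refine Finset.sum_congr rfl fun i _ => ?_
        simp only [Code.forget]
        congr 2
        rw [← Multiset.coe_add, Multiset.add_comm]
        rfl
    · rw [Multiset.map_nsmul, Multiset.map_singleton]
      rfl
  · rw [← Multiset.coe_mapAddMonoidHom, map_sum]
    refine Eq.trans ?_ (h fun b T => b • ({⟨o, χ - 2, d + b + 2, T⟩} +
      {⟨false, χ - 2, d + b + 2, T⟩}))
    refine Finset.sum_congr rfl fun j _ => ?_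
    rw [map_nsmul]
    rfl

/-- Both sides obey the same recursion, by `weights_step` and `weights_join`. The lists in `codes`
thus have the right multisets, although no list is yet attached to a map. -/
theorem codes_forget (n : ℕ) :
    (codes n).map Code.forget = (mapProfiles n).bind (weights n) := by
  induction n using Nat.strong_induction_on with
  | _ n ih =>
    match n with
    | 0 => simp [codes, mapProfiles, weights, Code.forget]
    | n + 1 =>
      rw [codes, mapProfiles, Multiset.bind_map, Multiset.add_bind, Multiset.map_add]
      congr 1
      · rw [Multiset.map_bind, Multiset.bind_congr fun q _ => Code.forget_step q,
          ← Multiset.bind_map _ Code.step', ih n (by omega), Multiset.bind_assoc,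
          Multiset.bind_assoc]
        exact Multiset.bind_congr fun q hq => (weights_step n (deg_pos_of_mem hq)).symm
      · rw [bind_sum, ← Multiset.coe_mapAddMonoidHom, map_sum]
        refine Finset.sum_congr rfl fun i _ => ?_
        have hi : (i : ℕ) ≤ n := by have := i.2; omega
        rw [Multiset.coe_mapAddMonoidHom, Multiset.map_bind, joins, Multiset.bind_assoc]
        have h1 : ((codes i).bind fun q => ((codes (n - i)).map q.join).map Code.forget) =
            ((codes i).map Code.forget).bind fun q =>
              ((codes (n - i)).map Code.forget).map q.join' := by
          rw [Multiset.bind_map]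
          refine Multiset.bind_congr fun q _ => ?_
          rw [Multiset.map_map, Multiset.map_map]
          refine Multiset.map_congr rfl fun r _ => ?_
          simp [Code.join, Code.join', Code.forget]
        rw [h1, ih i (by omega), ih (n - i) (by omega), Multiset.bind_assoc]
        refine Multiset.bind_congr fun q hq => ?_
        simp only [Multiset.bind_map, Multiset.map_bind]
        rw [Multiset.bind_bind]
        refine Multiset.bind_congr fun r hr => ?_
        have h2 := weights_join i (n - i) (deg_pos_of_mem hq) (deg_pos_of_mem hr)
        rw [show (i : ℕ) + (n - i) + 1 = n + 1 by omega] at h2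
        exact h2.symm


/-! ## Vertices, faces and marked vertices -/

theorem degree_coe {n : ℕ} (c : Finset (Fin (4 * n))) :
    degree (c : Set (Fin (4 * n))) = c.card / 2 := by
  rw [degree, Set.ncard_coe_finset]

theorem degree_image {n : ℕ} (φ : Equiv.Perm (Fin (4 * n))) (v : Set (Fin (4 * n))) :
    degree (φ '' v) = degree v := by
  rw [degree, degree, Set.ncard_image_of_injective _ φ.injective]

namespace RootedMap

variable {n : ℕ} (M : RootedMap n)

theorem vertexAt_eq (f : Fin (4 * n)) : M.vertexAt f = cls M.σ₁ M.σ₂ M.σ₂ f := by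
  ext f'
  rw [Finset.mem_coe, mem_cls, joined_iff_closure_pair]
  rfl

theorem faceAt_eq (f : Fin (4 * n)) : M.faceAt f = cls M.σ₁ M.σ₀ M.σ₀ f := by
  ext f'
  rw [Finset.mem_coe, mem_cls, joined_iff_closure_pair, Set.pair_comm]
  rfl

theorem ncard_faces : M.faces.ncard = M.toProfile.faces := by
  have h : M.faces = (fun c : Finset (Fin (4 * n)) => (c : Set (Fin (4 * n)))) ''
      (orbits M.σ₁ M.σ₀ M.σ₀ fun _ => True) := by
    ext v
    simp [faces, mem_orbits, faceAt_eq]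
  rw [h, Set.ncard_image_of_injective _ Finset.coe_injective, Set.ncard_coe_finset, toProfile,
    profile, sizes, Multiset.card_map]
  rfl

theorem degree_rootVertex : degree M.rootVertex = M.toProfile.deg := by
  rw [rootVertex, vertexAt_eq, degree_coe]
  rfl

theorem isOrientable_iff : M.IsOrientable ↔ M.toProfile.ori = true := by
  rw [toProfile, profile_ori]
  rfl

/-- The vertices other than the root-vertex. -/
noncomputable def nonroot : Finset (Set (Fin (4 * n))) :=
  (orbits M.σ₁ M.σ₂ M.σ₂ fun z => ¬ Joined M.σ₁ M.σ₂ M.σ₂ M.root z).map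
    ⟨_, Finset.coe_injective⟩

theorem mem_nonroot {v : Set (Fin (4 * n))} :
    v ∈ M.nonroot ↔ v ∈ M.vertices ∧ v ≠ M.rootVertex := by
  simp only [nonroot, Finset.mem_map, mem_orbits, Function.Embedding.coeFn_mk, vertices,
    Set.mem_range, rootVertex, vertexAt_eq]
  constructor
  · rintro ⟨_, ⟨y, hy, rfl⟩, rfl⟩
    refine ⟨⟨y, rfl⟩, fun h => hy ?_⟩
    exact (cls_eq_iff.1 (Finset.coe_injective h)).symm
  · rintro ⟨⟨y, rfl⟩, hy⟩
    refine ⟨_, ⟨y, fun h => hy ?_, rfl⟩, rfl⟩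
    rw [cls_eq_iff.2 h]

theorem map_degree_nonroot : M.nonroot.val.map degree = M.toProfile.others := by
  simp only [nonroot, toProfile, profile, sizes, Finset.map_val, Multiset.map_map]
  refine Multiset.map_congr rfl fun c _ => ?_
  exact degree_coe c

theorem eulerChar_eq :
    M.eulerChar = 1 + M.toProfile.others.card - n + M.toProfile.faces := by
  classical
  have h : M.vertices = (insert M.rootVertex M.nonroot : Finset (Set (Fin (4 * n)))) := by
    ext v
    rw [Finset.mem_coe, Finset.mem_insert, mem_nonroot]
    by_cases hv : v = M.rootVertex
    · simp only [hv, true_or, iff_true]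
      exact ⟨M.root, rfl⟩
    · simp [hv]
  rw [eulerChar, ncard_faces, h, Set.ncard_coe_finset, Finset.card_insert_of_notMem
    (fun h => (M.mem_nonroot.1 h).2 rfl), ← map_degree_nonroot, Multiset.card_map]
  simp only [Finset.card]
  push_cast
  ring

end RootedMap

namespace MarkedMap

variable {n k : ℕ}

/-- The marked vertices. -/
noncomputable def marks (M : MarkedMap n k) : Finset (Set (Fin (4 * n))) :=
  M.marked.toFinite.toFinset

theorem coe_marks (M : MarkedMap n k) : (M.marks : Set (Set (Fin (4 * n)))) = M.marked := by
  simp [marks]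

theorem card_marks (M : MarkedMap n k) : M.marks.card = k := by
  refine Eq.trans ?_ M.card_marked
  rw [← coe_marks, Set.ncard_coe_finset]

/-- The code of a marked map. -/
noncomputable def code (M : MarkedMap n k) : Code (Multiset ℕ) :=
  ⟨M.toProfile.ori, M.eulerChar, M.toProfile.deg, M.marks.val.map degree⟩

theorem IsIso.code_eq {M M' : MarkedMap n k} {φ : Equiv.Perm (Fin (4 * n))}
    (h : M.IsIso M' φ) : M'.code = M.code := by
  have h1 := h.1.toProfile_eq
  have h2 : M'.marks = M.marks.map ⟨fun v => φ '' v, Set.image_injective.2 φ.injective⟩ := by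
    apply Finset.coe_injective
    rw [coe_marks, Finset.coe_map, coe_marks]
    exact h.2.symm
  rw [code, code, RootedMap.eulerChar_eq, RootedMap.eulerChar_eq, h1, h2, Finset.map_val,
    Multiset.map_map]
  congr 1
  exact Multiset.map_congr rfl fun v _ => degree_image φ v

theorem IsIso.unique {M M' : MarkedMap n k} {φ ψ : Equiv.Perm (Fin (4 * n))}
    (h : IsIso M M' φ) (h' : IsIso M M' ψ) : φ = ψ := h.1.unique h'.1

/-- The marked map with a given underlying map and given marked vertices. -/
def ofMarks (M : RootedMap n) (S : Finset (Set (Fin (4 * n)))) (hS : S ⊆ M.nonroot)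
    (hk : S.card = k) (h3 : ∀ v ∈ M.nonroot, v ∉ S → degree v = 3) : MarkedMap n k where
  toRootedMap := M
  marked := S
  marked_subset _ hv := (M.mem_nonroot.1 (hS hv)).1
  card_marked := by rw [Set.ncard_coe_finset, hk]
  root_notMem h := (M.mem_nonroot.1 (hS h)).2 rfl
  nearCubic v hv hr hm := h3 v (M.mem_nonroot.2 ⟨hv, hr⟩) hm

theorem marks_ofMarks (M : RootedMap n) (S : Finset (Set (Fin (4 * n)))) (hS : S ⊆ M.nonroot)
    (hk : S.card = k) (h3 : ∀ v ∈ M.nonroot, v ∉ S → degree v = 3) :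
    (ofMarks M S hS hk h3).marks = S := by
  apply Finset.coe_injective
  rw [coe_marks]
  rfl

noncomputable instance : Fintype (Quotient (isoSetoid n k)) := Fintype.ofFinite _

open Classical in
theorem filter_weights (M : RootedMap n) (k : ℕ) :
    (weights n M.toProfile.succ).filter (fun q => q.marks.card = k) =
      ∑ S ∈ M.nonroot.powerset with S.card = k ∧ ∀ v ∈ M.nonroot \ S, degree v = 3,
        {⟨M.toProfile.ori, M.eulerChar, M.toProfile.deg, S.val.map degree⟩} := by
  rw [weights]
  simp only [Profile.succ, Nat.add_sub_cancel, ← M.eulerChar_eq]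
  rw [← M.map_degree_nonroot, marks_map, Finset.sum_filter, ← Multiset.coe_mapAddMonoidHom,
    map_sum, Multiset.filter_eq_bind, bind_sum]
  refine Finset.sum_congr rfl fun S _ => ?_
  by_cases h1 : S.card = k <;> by_cases h2 : ∀ v ∈ M.nonroot \ S, degree v = 3
  · rw [if_pos h2, if_pos ⟨h1, h2⟩]
    simp [h1]
  · rw [if_neg h2, if_neg (fun h => h2 h.2)]
    simp
  · rw [if_pos h2, if_neg (fun h => h1 h.1)]
    simp [h1]
  · rw [if_neg h2, if_neg (fun h => h2 h.2)]
    simp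

open Classical in
/-- The codes of the isomorphism classes of marked near-cubic maps. -/
theorem sum_code (n k : ℕ) :
    ∑ C : Quotient (isoSetoid (n + 1) k), ({C.out.code} : Multiset (Code (Multiset ℕ))) =
      ((codes (n + 1)).map Code.forget).filter (fun q => q.marks.card = k) := by
  rw [codes_forget, ← RootedMap.sum_profiles, bind_sum_singleton, Multiset.filter_eq_bind, bind_sum]
  simp only [← Multiset.filter_eq_bind, filter_weights]
  rw [Finset.sum_sigma']
  have hmem : ∀ p ∈ Finset.univ.sigma (fun c : Quotient (RootedMap.isoSetoid (n + 1)) =>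
      c.out.nonroot.powerset.filter fun S => S.card = k ∧ ∀ v ∈ c.out.nonroot \ S, degree v = 3),
      p.2 ⊆ p.1.out.nonroot ∧ p.2.card = k ∧
        ∀ v ∈ p.1.out.nonroot, v ∉ p.2 → degree v = 3 := by
    rintro ⟨c, S⟩ h
    simp only [Finset.mem_sigma, Finset.mem_univ, true_and, Finset.mem_filter,
      Finset.mem_powerset, Finset.mem_sdiff] at h
    exact ⟨h.1, h.2.1, fun v hv hv' => h.2.2 v ⟨hv, hv'⟩⟩
  symm
  refine Finset.sum_bij (fun p hp => Quotient.mk _ (ofMarks p.1.out p.2 (hmem p hp).1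
    (hmem p hp).2.1 (hmem p hp).2.2)) (fun _ _ => Finset.mem_univ _) ?_ ?_ ?_
  · rintro ⟨c, S⟩ hp ⟨c', S'⟩ hp' h
    obtain ⟨φ, hφ⟩ := Quotient.exact h
    have hc : c = c' := by
      rw [← Quotient.out_eq c, ← Quotient.out_eq c']
      exact Quotient.sound ⟨φ, hφ.1⟩
    subst hc
    -- By rigidity, two markings of a representative which give isomorphic marked maps coincide.
    have h1 : φ = 1 := hφ.1.unique (RootedMap.isIso_refl _)
    have h2 := hφ.2
    rw [h1] at h2
    have h3 : S = S' := by
      apply Finset.coe_injective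
      simpa [ofMarks] using h2
    rw [h3]
  · intro C _
    obtain ⟨φ, hφ⟩ := Quotient.exact
      (Quotient.out_eq (Quotient.mk (RootedMap.isoSetoid (n + 1)) C.out.toRootedMap)).symm
    set c := Quotient.mk (RootedMap.isoSetoid (n + 1)) C.out.toRootedMap with hc
    let S := C.out.marks.map ⟨fun v => φ '' v, Set.image_injective.2 φ.injective⟩
    have hv : ∀ f, c.out.vertexAt (φ f) = φ '' C.out.vertexAt f := by
      intro f
      rw [RootedMap.vertexAt_eq, RootedMap.vertexAt_eq,
        card_cls_map c.out.invol₁ c.out.invol₂ c.out.invol₂ φ.injective saturated_true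
          (fun y _ => (hφ.2.1 y).symm) (fun y _ => (hφ.2.2.1 y).symm)
          (fun y _ => (hφ.2.2.1 y).symm) trivial, Finset.coe_map]
      rfl
    have hroot : c.out.rootVertex = φ '' C.out.rootVertex := by
      rw [RootedMap.rootVertex, ← hφ.2.2.2, hv]
      rfl
    have hinj : Function.Injective fun v : Set (Fin (4 * (n + 1))) => φ '' v :=
      Set.image_injective.2 φ.injective
    have hnr : ∀ v, φ '' v ∈ c.out.nonroot ↔ v ∈ C.out.nonroot := by
      intro v
      rw [RootedMap.mem_nonroot, RootedMap.mem_nonroot, hroot, hinj.ne_iff]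
      refine and_congr_left fun _ => ?_
      constructor
      · rintro ⟨f, hf⟩
        refine ⟨φ.symm f, hinj ?_⟩
        change φ '' C.out.vertexAt (φ.symm f) = φ '' v
        rw [← hv, Equiv.apply_symm_apply, hf]
      · rintro ⟨f, rfl⟩
        exact ⟨φ f, hv f⟩
    have hm : ∀ v, v ∈ C.out.marks ↔ v ∈ C.out.marked := fun v => by
      rw [← Finset.mem_coe, coe_marks]
    have hS : S ⊆ c.out.nonroot := by
      intro v hv
      obtain ⟨w, hw, rfl⟩ := Finset.mem_map.1 hv
      rw [hm] at hw
      exact (hnr w).2 (C.out.toRootedMap.mem_nonroot.2 ⟨C.out.marked_subset hw,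
        fun h => C.out.root_notMem (h ▸ hw)⟩)
    have hk : S.card = k := by
      rw [Finset.card_map, C.out.card_marks]
    have h3 : ∀ v ∈ c.out.nonroot, v ∉ S → degree v = 3 := by
      intro v hv hv'
      obtain ⟨w, rfl⟩ : ∃ w, φ '' w = v := ⟨φ.symm '' v, by simp [Set.image_image]⟩
      rw [hnr, RootedMap.mem_nonroot] at hv
      rw [degree_image]
      refine C.out.nearCubic w hv.1 hv.2 fun h => hv' ?_
      exact Finset.mem_map.2 ⟨w, (hm w).2 h, rfl⟩
    refine ⟨⟨c, S⟩, ?_, ?_⟩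
    · simp only [Finset.mem_sigma, Finset.mem_univ, true_and, Finset.mem_filter,
        Finset.mem_powerset, Finset.mem_sdiff]
      exact ⟨hS, hk, fun v hv => h3 v hv.1 hv.2⟩
    · rw [← Quotient.out_eq C]
      apply Quotient.sound
      refine Setoid.symm ⟨φ, hφ, ?_⟩
      change _ = (S : Set (Set (Fin (4 * (n + 1)))))
      rw [Finset.coe_map, coe_marks]
      rfl
  · rintro ⟨c, S⟩ hp
    obtain ⟨hS, hk, h3⟩ := hmem ⟨c, S⟩ hp
    obtain ⟨φ, hφ⟩ := Quotient.exact
      (Quotient.out_eq (Quotient.mk (isoSetoid (n + 1) k) (ofMarks c.out S hS hk h3)))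
    rw [← hφ.code_eq, code, marks_ofMarks]
    rfl

end MarkedMap

/-! ## A canonical order -/

/-- Two families with the same multiset of values can be matched, one element at a time, respecting
the values. -/
theorem exists_map_eq {ι α β : Type*} (s : Finset ι) (f : ι → β) (g : α → β) (t : Multiset α)
    [Inhabited α] (h : s.val.map f = t.map g) :
    ∃ u : ι → α, (∀ i ∈ s, g (u i) = f i) ∧ s.val.map u = t := by
  classical
  induction s using Finset.induction_on generalizing t with
  | empty =>
    refine ⟨fun _ => default, by simp, ?_⟩
    symm
    simpa using h.symm
  | insert i s hi ih =>
    rw [Finset.insert_val_of_notMem hi, Multiset.map_cons] at h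
    obtain ⟨a, ha, hg⟩ : ∃ a ∈ t, g a = f i := by
      rw [← Multiset.mem_map, ← h]
      exact Multiset.mem_cons_self _ _
    obtain ⟨t, rfl⟩ := Multiset.exists_cons_of_mem ha
    rw [Multiset.map_cons, hg, Multiset.cons_inj_right] at h
    obtain ⟨u, hu, rfl⟩ := ih t h
    have hu' : ∀ j ∈ s, Function.update u i a j = u j := fun j hj =>
      Function.update_of_ne (fun e => hi (by rwa [← e])) _ _
    refine ⟨Function.update u i a, fun j hj => ?_, ?_⟩
    · rcases Finset.mem_insert.1 hj with rfl | hj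
      · rw [Function.update_self, hg]
      · rw [hu' j hj, hu j hj]
    · rw [Finset.insert_val_of_notMem hi, Multiset.map_cons, Function.update_self,
        Multiset.map_congr rfl hu']

namespace MarkedMap

variable {n k : ℕ}

theorem exists_enum (M : MarkedMap n k) {q : Code (List ℕ)} (h : q.forget = M.code) :
    ∃ e : Fin k → Set (Fin (4 * n)), Function.Injective e ∧ Set.range e = M.marked ∧
      q = ⟨M.toProfile.ori, M.eulerChar, M.toProfile.deg, List.ofFn fun i => degree (e i)⟩ := by
  have hm : (q.marks : Multiset ℕ) = M.marks.val.map degree := congrArg Code.marks h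
  have hk : q.marks.length = k := by
    have := congrArg Multiset.card hm
    rw [Multiset.coe_card, Multiset.card_map] at this
    exact this.trans M.card_marks
  subst hk
  have h1 : (Finset.univ : Finset (Fin q.marks.length)).val.map q.marks.get = q.marks := by
    rw [Fin.univ_val_map, List.ofFn_get]
  obtain ⟨e, he, hv⟩ := exists_map_eq Finset.univ q.marks.get degree M.marks.val (h1.trans hm)
  refine ⟨e, ?_, ?_, ?_⟩
  · have : (Finset.univ.val.map e).Nodup := hv ▸ M.marks.nodup
    intro i j hij
    exact Multiset.inj_on_of_nodup_map this i (Finset.mem_univ_val i) j (Finset.mem_univ_val j) hij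
  · rw [← coe_marks]
    ext v
    rw [Finset.mem_coe, ← Finset.mem_val, ← hv]
    simp
  · ext1
    · have := congrArg Code.ori h
      exact this
    · have := congrArg Code.chi h
      exact this
    · have := congrArg Code.deg h
      exact this
    · simp only [he _ (Finset.mem_univ _), List.ofFn_get]

/-- The classes and the lists in `codes` have the same unordered codes, so each class receives one
list and all lists are used. With no edge there is no class. -/
theorem exists_code (n k : ℕ) :
    ∃ u : Quotient (isoSetoid n k) → Code (List ℕ), (∀ C, (u C).forget = C.out.code) ∧
      (n ≠ 0 → Finset.univ.val.map u = (codes n).filter fun q => q.marks.length = k) := by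
  cases n with
  | zero => exact ⟨fun C => C.out.root.elim0, fun C => C.out.root.elim0, by simp⟩
  | succ n =>
    have : Inhabited (Code (List ℕ)) := ⟨⟨true, 0, 0, []⟩⟩
    have h := sum_code n k
    have e := map_sum_singleton Finset.univ (fun C : Quotient (isoSetoid (n + 1) k) => C)
      (fun C => C.out.code)
    rw [Finset.sum_multiset_singleton] at e
    rw [← e, Multiset.filter_map] at h
    obtain ⟨u, hu, hs⟩ := exists_map_eq _ _ _ _ h
    exact ⟨u, fun C => hu C (Finset.mem_univ C), fun _ => hs⟩

/-- The list of the degrees of the marked vertices is prescribed by a canonical order. -/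
theorem exists_canonicalOrder : ∃ c : CanonicalOrder, ∀ n k, n ≠ 0 →
    Finset.univ.val.map (fun C : Quotient (isoSetoid n k) => (⟨C.out.toProfile.ori,
      C.out.eulerChar, C.out.toProfile.deg, List.ofFn fun i => degree (c.enum C.out i)⟩ :
        Code (List ℕ))) = (codes n).filter fun q => q.marks.length = k := by
  choose u hu hs using exists_code
  choose e he hr hq using fun n k (C : Quotient (isoSetoid n k)) => C.out.exists_enum (hu n k C)
  have hφ : ∀ n k (M : MarkedMap n k), ∃ φ, (Quotient.mk _ M).out.IsIso M φ := fun n k M =>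
    Quotient.exact (Quotient.out_eq (Quotient.mk (isoSetoid n k) M))
  choose φ hφ using hφ
  -- The order is chosen on representatives and transported along isomorphisms; their uniqueness
  -- makes it equivariant.
  let c : CanonicalOrder :=
    { enum := fun {n k} M i => φ n k M '' e n k (Quotient.mk _ M) i
      enum_injective := fun {n k} M =>
        (Set.image_injective.2 (φ n k M).injective).comp (he n k _)
      range_enum := fun {n k} M => by
        rw [← (hφ n k M).2, ← hr, ← Set.range_comp]
        rfl
      equivariant := fun {n k} M M' ψ h i => by
        have h1 : Quotient.mk (isoSetoid n k) M = Quotient.mk _ M' := Quotient.sound ⟨ψ, h⟩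
        have h2 := hφ n k M
        have h3 := hφ n k M'
        have h4 : φ n k M' = ψ * φ n k M := by
          rw [← h1] at h3
          exact h3.unique (h2.trans h)
        rw [h4, ← h1, Set.image_image]
        rfl }
  refine ⟨c, fun n k hn => ?_⟩
  rw [← hs n k hn]
  refine Multiset.map_congr rfl fun C _ => ?_
  rw [hq n k C]
  congr 2
  funext i
  have h1 : φ n k C.out = 1 := by
    have h2 := hφ n k C.out
    rw [Quotient.out_eq] at h2
    exact h2.unique ⟨RootedMap.isIso_refl _, by simp⟩
  change degree (φ n k C.out '' _) = _
  rw [degree_image, Quotient.out_eq]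

end MarkedMap


/-! ## Generating functions of codes -/

theorem Code.mem_step {q r : Code (List ℕ)} (h : r ∈ q.step) :
    r.chi ≤ q.chi ∧ 1 ≤ r.deg ∧ (r.ori = true → q.ori = true ∧ Even (q.chi - r.chi)) := by
  simp only [Code.step, Multiset.mem_add, Multiset.mem_sum, Finset.mem_univ, true_and] at h
  rcases h with ((h | ⟨i, -, h⟩) | h) | ⟨j, h⟩
  · split_ifs at h with h2
    · rw [Multiset.mem_singleton] at h
      subst h
      exact ⟨le_rfl, by simp only; omega, fun h => ⟨h, by simp⟩⟩
    · simp at h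
  · rw [Multiset.mem_singleton] at h
    subst h
    exact ⟨le_rfl, by simp, fun h => ⟨h, by simp⟩⟩
  · rw [Multiset.mem_nsmul, Multiset.mem_singleton] at h
    obtain ⟨-, rfl⟩ := h
    exact ⟨by simp, by simp, fun h => by simp at h⟩
  · rw [Multiset.mem_nsmul, Multiset.mem_add, Multiset.mem_singleton, Multiset.mem_singleton] at h
    obtain ⟨-, rfl | rfl⟩ := h
    · exact ⟨by simp, by simp, fun h => ⟨h, by simp⟩⟩
    · exact ⟨by simp, by simp, fun h => by simp at h⟩

/-- The bound makes genera natural numbers, evenness excludes orientable surfaces with `2 - χ` odd,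
and the positive degree singles out the map without edges. -/
theorem mem_codes {n : ℕ} {q : Code (List ℕ)} (h : q ∈ codes n) :
    q.chi ≤ 2 ∧ (q.ori = true → Even q.chi) ∧ (n ≠ 0 → 1 ≤ q.deg) := by
  induction n using Nat.strong_induction_on generalizing q with
  | _ n ih =>
    match n with
    | 0 =>
      rw [codes, Multiset.mem_singleton] at h
      subst h
      simp
    | n + 1 =>
      simp only [codes, Multiset.mem_add, Multiset.mem_bind, Multiset.mem_sum, Finset.mem_univ,
        true_and, Multiset.mem_map] at h
      rcases h with ⟨r, hr, h⟩ | ⟨i, r, hr, t, ht, rfl⟩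
      · obtain ⟨h1, h2, h3⟩ := Code.mem_step h
        obtain ⟨k1, k2, -⟩ := ih n (by omega) hr
        refine ⟨h1.trans k1, fun ho => ?_, fun _ => h2⟩
        have h4 := (k2 (h3 ho).1).sub (h3 ho).2
        rwa [sub_sub_cancel] at h4
      · obtain ⟨k1, k2, -⟩ := ih i i.2 hr
        obtain ⟨l1, l2, -⟩ := ih (n - i) (by omega) ht
        refine ⟨?_, fun ho => ?_, fun _ => ?_⟩
        · simp only [Code.join]; omega
        · simp only [Code.join, Bool.and_eq_true] at ho
          exact ((k2 ho.1).add (l2 ho.2)).sub even_two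
        · simp only [Code.join]; omega

/-- The monomial in the variables `x, x₁, …, x_k` of a code. -/
noncomputable def Code.monomial (k : ℕ) (q : Code (List ℕ)) : MvPolynomial (Fin (k + 1)) ℚ :=
  MvPolynomial.X 0 ^ q.deg * ∏ i : Fin k, MvPolynomial.X i.succ ^ q.marks.getD i 0

open Classical in
/-- The term of a code in the series with `k` marks of the surfaces satisfying `p`. -/
noncomputable def Code.term (p : Bool → ℤ → Prop) (k : ℕ) (q : Code (List ℕ)) :
    MvPolynomial (Fin (k + 1)) ℚ :=
  if p q.ori q.chi ∧ q.marks.length = k then q.monomial k else 0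

/-- The sum of the terms of a multiset of codes. -/
noncomputable def total (p : Bool → ℤ → Prop) (k : ℕ) (s : Multiset (Code (List ℕ))) :
    MvPolynomial (Fin (k + 1)) ℚ := (s.map (Code.term p k)).sum

/-- The generating functions of the codes for a family of sets of surfaces. -/
noncomputable def codeSeries (p : ℕ → Bool → ℤ → Prop) (g k : ℕ) : Series k :=
  PowerSeries.mk fun n => total (p g) k (codes n)

theorem total_or {p q r : Bool → ℤ → Prop} {s : Multiset (Code (List ℕ))} (k : ℕ)
    (h : ∀ t ∈ s, r t.ori t.chi ↔ p t.ori t.chi ∨ q t.ori t.chi)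
    (hd : ∀ o χ, p o χ → ¬ q o χ) : total r k s = total p k s + total q k s := by
  rw [total, total, total, ← Multiset.sum_map_add]
  congr 1
  refine Multiset.map_congr rfl fun t ht => ?_
  have h1 := h t ht
  have h2 := hd t.ori t.chi
  simp only [Code.term]
  by_cases hp : p t.ori t.chi
  · simp [hp, h1.2 (Or.inl hp), h2 hp]
  · by_cases hq : q t.ori t.chi
    · simp [hp, hq, h1.2 (Or.inr hq)]
    · simp [hp, hq, mt h1.1 (not_or.2 ⟨hp, hq⟩)]

theorem total_congr {p r : Bool → ℤ → Prop} {s : Multiset (Code (List ℕ))} (k : ℕ)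
    (h : ∀ t ∈ s, r t.ori t.chi ↔ p t.ori t.chi) : total r k s = total p k s := by
  rw [total, total]
  congr 1
  refine Multiset.map_congr rfl fun t ht => ?_
  have h1 := h t ht
  by_cases hp : p t.ori t.chi
  · simp [Code.term, hp, h1.2 hp]
  · simp [Code.term, hp, mt h1.1 hp]

theorem RootedMap.isOn_iff {n : ℕ} (M : RootedMap n) (ori : Bool) (χ : ℤ) :
    M.IsOn ori χ ↔ M.toProfile.ori = ori ∧ M.eulerChar = χ := by
  rw [RootedMap.IsOn, RootedMap.isOrientable_iff]
  cases ori <;> cases M.toProfile.ori <;> simp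

/-- The order `c` induces the codes. -/
def CanonicalOrder.Good (c : CanonicalOrder) : Prop := ∀ n k, n ≠ 0 →
  Finset.univ.val.map (fun C : Quotient (MarkedMap.isoSetoid n k) => (⟨C.out.toProfile.ori,
    C.out.eulerChar, C.out.toProfile.deg, List.ofFn fun i => degree (c.enum C.out i)⟩ :
      Code (List ℕ))) = (codes n).filter fun q => q.marks.length = k

namespace CanonicalOrder.Good

variable {c : CanonicalOrder}

/-- For `n ≥ 1` this is the defining property of a good order; for `n = 0` there is no `RootedMap`,
and the extra summand of the series supplies the only code. -/
theorem coeff_mapSeries (hc : c.Good) (ori : Bool) (χ : ℤ) (n k : ℕ) :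
    PowerSeries.coeff n (mapSeries c ori χ k) =
      total (fun o x => o = ori ∧ x = χ) k (codes n) := by
  classical
  rw [mapSeries, PowerSeries.coeff_mk]
  by_cases hn : n = 0
  · subst hn
    have : IsEmpty (Quotient (MarkedMap.isoSetoid 0 k)) := ⟨fun C => C.out.root.elim0⟩
    rw [finsum_of_isEmpty, add_zero, codes, total, Multiset.map_singleton, Multiset.sum_singleton,
      Code.term]
    by_cases hk : k = 0
    · subst hk
      simp [Code.monomial, eq_comm]
    · simp [hk, Ne.symm hk]
  · have h : total (fun o x => o = ori ∧ x = χ) k (codes n) =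
        total (fun o x => o = ori ∧ x = χ) k ((codes n).filter fun q => q.marks.length = k) := by
      rw [total, total]
      generalize codes n = s
      induction s using Multiset.induction_on with
      | empty => simp
      | cons q s ih =>
        rw [Multiset.map_cons, Multiset.sum_cons, ih]
        by_cases hq : q.marks.length = k
        · rw [Multiset.filter_cons_of_pos (p := fun q : Code (List ℕ) => q.marks.length = k) _ hq,
            Multiset.map_cons, Multiset.sum_cons]
        · rw [Multiset.filter_cons_of_neg (p := fun q : Code (List ℕ) => q.marks.length = k) _ hq,
            Code.term, if_neg (fun h => hq h.2), zero_add]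
    rw [if_neg (fun h => hn h.1), zero_add, finsum_eq_sum_of_fintype, h, ← hc n k hn, total,
      Multiset.map_map]
    refine Finset.sum_congr rfl fun C _ => ?_
    rw [finsum_eq_if, Function.comp_apply, Code.term]
    have h1 : Code.monomial k ⟨C.out.toProfile.ori, C.out.eulerChar, C.out.toProfile.deg,
        List.ofFn fun i => degree (c.enum C.out i)⟩ = MvPolynomial.X 0 ^ degree C.out.rootVertex *
        ∏ i : Fin k, MvPolynomial.X i.succ ^ degree (c.enum C.out i) := by
      rw [Code.monomial, RootedMap.degree_rootVertex]
      congr 1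
      refine Finset.prod_congr rfl fun i _ => ?_
      simp
    rw [h1]
    by_cases h2 : C.out.IsOn ori χ
    · rw [if_pos h2, if_pos ⟨(C.out.isOn_iff ori χ).1 h2, by simp⟩]
    · rw [if_neg h2, if_neg fun h3 => h2 ((C.out.isOn_iff ori χ).2 h3.1)]

/-- The orientable surface of genus `g`. -/
def selO (g : ℕ) (o : Bool) (χ : ℤ) : Prop := o = true ∧ χ = 2 - 2 * g

/-- The surfaces of Euler characteristic `2 - g`. -/
def selQ (g : ℕ) (_ : Bool) (χ : ℤ) : Prop := χ = 2 - g

theorem seriesO_eq (hc : c.Good) : seriesO c = codeSeries selO := by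
  funext g k
  ext1 n
  rw [seriesO, hc.coeff_mapSeries, codeSeries, PowerSeries.coeff_mk]
  rfl

/-- Euler characteristic `2 - g` collects the orientable surface of genus `g / 2` and the
non-orientable one of genus `g`. For odd `g` the former does not occur, by parity. -/
theorem seriesQ_eq (hc : c.Good) : seriesQ c = codeSeries selQ := by
  funext g k
  ext1 n
  rw [seriesQ, map_add, seriesP, hc.coeff_mapSeries, codeSeries, PowerSeries.coeff_mk]
  by_cases hg : Even g
  · rw [if_pos hg, seriesO, hc.coeff_mapSeries]
    symm
    obtain ⟨m, rfl⟩ := hg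
    apply total_or
    · intro t _
      rw [selQ]
      have : (((m + m) / 2 : ℕ) : ℤ) = m := by congr 1; omega
      rw [this]
      push_cast
      cases t.ori
      · simp
      · simp only [true_and, Bool.true_eq_false, false_and, or_false]
        constructor <;> intro h <;> omega
    · rintro o χ ⟨rfl, -⟩ ⟨h, -⟩
      simp at h
  · rw [if_neg hg, map_zero, zero_add]
    apply total_congr
    intro t ht
    rw [selQ]
    have h := (mem_codes ht).2.1
    constructor
    · rintro ⟨h1, h2⟩
      exact h2
    · intro h2
      refine ⟨?_, h2⟩
      by_contra ho
      rw [Bool.not_eq_false] at ho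
      have h3 := h ho
      rw [h2] at h3
      apply hg
      rw [Int.even_sub] at h3
      simpa using h3

end CanonicalOrder.Good


/-! ## The terms of the functional equations -/

section Total

variable (p : Bool → ℤ → Prop) (k : ℕ)

@[simp] theorem total_zero : total p k 0 = 0 := by simp [total]

@[simp] theorem total_cons (q : Code (List ℕ)) (s : Multiset (Code (List ℕ))) :
    total p k (q ::ₘ s) = q.term p k + total p k s := by simp [total]

@[simp] theorem total_singleton (q : Code (List ℕ)) : total p k {q} = q.term p k := by
  simp [total]

@[simp] theorem total_add (s t : Multiset (Code (List ℕ))) :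
    total p k (s + t) = total p k s + total p k t := by simp [total]

theorem total_nsmul (n : ℕ) (s : Multiset (Code (List ℕ))) :
    total p k (n • s) = n • total p k s := by
  rw [total, Multiset.map_nsmul, Multiset.sum_nsmul, total]

theorem total_sum {ι : Type*} (s : Finset ι) (f : ι → Multiset (Code (List ℕ))) :
    total p k (∑ i ∈ s, f i) = ∑ i ∈ s, total p k (f i) := by
  classical
  induction s using Finset.induction_on with
  | empty => simp
  | insert a s ha ih => rw [Finset.sum_insert ha, Finset.sum_insert ha, total_add, ih]

theorem total_bind (s : Multiset (Code (List ℕ)))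
    (f : Code (List ℕ) → Multiset (Code (List ℕ))) :
    total p k (s.bind f) = (s.map fun q => total p k (f q)).sum := by
  rw [total, Multiset.map_bind, Multiset.sum_bind]
  rfl

theorem map_total {N : Type*} [AddCommMonoid N] (L : MvPolynomial (Fin (k + 1)) ℚ →+ N)
    (s : Multiset (Code (List ℕ))) :
    L (total p k s) = (s.map fun q => L (q.term p k)).sum := by
  rw [total, AddMonoidHom.map_multiset_sum, Multiset.map_map]
  rfl

end Total

namespace Code

variable (q : Code (List ℕ))

/-- The codes obtained by adding an edge to a cubic vertex. -/
noncomputable def cubic : Multiset (Code (List ℕ)) :=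
  if 2 ≤ q.deg then {⟨q.ori, q.chi, q.deg - 1, q.marks⟩} else 0

/-- The codes obtained by adding an edge to a new marked vertex. -/
noncomputable def marked : Multiset (Code (List ℕ)) :=
  ∑ i ∈ Finset.range (q.deg + 1), {⟨q.ori, q.chi, i + 1, q.marks ++ [q.deg + 1 - i]⟩}

/-- The codes obtained by adding a twisted loop. -/
noncomputable def crossCap : Multiset (Code (List ℕ)) :=
  (q.deg + 1) • {⟨false, q.chi - 1, q.deg + 2, q.marks⟩}

/-- The codes obtained by merging a marked vertex into the root-vertex. -/
noncomputable def handle : Multiset (Code (List ℕ)) :=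
  ∑ j : Fin q.marks.length, q.marks[j] •
    ({⟨q.ori, q.chi - 2, q.deg + q.marks[j] + 2, q.marks.eraseIdx j⟩} +
    {⟨false, q.chi - 2, q.deg + q.marks[j] + 2, q.marks.eraseIdx j⟩})

theorem step_eq : q.step = q.cubic + q.marked + q.crossCap + q.handle := rfl

theorem term_of_pos {p : Bool → ℤ → Prop} {k : ℕ} (h : p q.ori q.chi) (hk : q.marks.length = k) :
    q.term p k = q.monomial k := by rw [term, if_pos ⟨h, hk⟩]

theorem term_of_neg {p : Bool → ℤ → Prop} {k : ℕ} (h : ¬ p q.ori q.chi) : q.term p k = 0 := by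
  rw [term, if_neg fun h' => h h'.1]

theorem term_of_ne {p : Bool → ℤ → Prop} {k : ℕ} (h : q.marks.length ≠ k) : q.term p k = 0 := by
  rw [term, if_neg fun h' => h h'.2]

end Code

/-- The coefficient of a power of `x` in a polynomial. -/
noncomputable def coeffPoly (k d : ℕ) :
    MvPolynomial (Fin (k + 1)) ℚ →+ MvPolynomial (Fin (k + 1)) ℚ where
  toFun f := MvPolynomial.rename Fin.succ ((MvPolynomial.finSuccEquiv ℚ k f).coeff d)
  map_zero' := by simp
  map_add' f g := by simp

theorem coeff_coeffX {k : ℕ} (d n : ℕ) (F : Series k) :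
    PowerSeries.coeff n (coeffX d F) = coeffPoly k d (PowerSeries.coeff n F) := by
  rw [coeffX, PowerSeries.coeff_mk]
  rfl

theorem coeffPoly_monomial (k d : ℕ) (q : Code (List ℕ)) :
    coeffPoly k d (q.monomial k) = if d = q.deg then
      ∏ i : Fin k, MvPolynomial.X i.succ ^ q.marks.getD i 0 else 0 := by
  have h : MvPolynomial.finSuccEquiv ℚ k (q.monomial k) = Polynomial.X ^ q.deg *
      Polynomial.C (∏ i : Fin k, MvPolynomial.X i ^ q.marks.getD i 0) := by
    rw [Code.monomial, map_mul, map_pow, MvPolynomial.finSuccEquiv_X_zero, map_prod, map_prod]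
    congr 1
    refine Finset.prod_congr rfl fun i _ => ?_
    rw [map_pow, map_pow, MvPolynomial.finSuccEquiv_X_succ]
  change MvPolynomial.rename Fin.succ ((MvPolynomial.finSuccEquiv ℚ k (q.monomial k)).coeff d) = _
  rw [h, Polynomial.coeff_mul_C, Polynomial.coeff_X_pow]
  split_ifs
  · rw [one_mul, map_prod]
    refine Finset.prod_congr rfl fun i _ => ?_
    rw [map_pow, MvPolynomial.rename_X]
  · simp

-- Only a root-vertex of degree at least 2 can release a cubic vertex, and its degree then drops by
-- one: a division by `x`. Degrees 0 and 1 are the corrections subtracted in the equation.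
open Classical in
theorem term_eq_cubic (p : Bool → ℤ → Prop) (k : ℕ) (q : Code (List ℕ)) :
    q.term p k = (if q.deg = 0 then q.term p k else 0) +
      MvPolynomial.X 0 * total p k q.cubic + MvPolynomial.X 0 * coeffPoly k 1 (q.term p k) := by
  by_cases hp : p q.ori q.chi
  swap
  · have h : total p k q.cubic = 0 := by
      rw [Code.cubic]
      split_ifs
      · rw [total_singleton, Code.term_of_neg]
        exact hp
      · simp
    rw [h, q.term_of_neg hp]
    simp
  by_cases hk : q.marks.length = k
  swap
  · have h : total p k q.cubic = 0 := by
      rw [Code.cubic]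
      split_ifs
      · rw [total_singleton, Code.term_of_ne]
        exact hk
      · simp
    rw [h, q.term_of_ne hk]
    simp
  rw [q.term_of_pos hp hk, coeffPoly_monomial, Code.cubic]
  by_cases h0 : q.deg = 0
  · simp [h0]
  by_cases h1 : q.deg = 1
  · simp [h1, Code.monomial]
  rw [if_neg h0, if_pos (by omega), if_neg (Ne.symm h1), total_singleton,
    Code.term_of_pos ⟨q.ori, q.chi, q.deg - 1, q.marks⟩ hp hk,
    Code.monomial, Code.monomial, ← mul_assoc, ← pow_succ', Nat.sub_add_cancel (by omega)]
  simp

/-- The series of the codes obtained by adding an edge to a cubic vertex, divided by `z`. -/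
noncomputable def cubicSeries (p : ℕ → Bool → ℤ → Prop) (g k : ℕ) : Series k :=
  PowerSeries.mk fun n => total (p g) k ((codes n).bind Code.cubic)

theorem sum_term_deg_zero {p : ℕ → Bool → ℤ → Prop} (hp : ∀ g, p g true 2 ↔ g = 0) (g k n : ℕ) :
    ((codes n).map fun q => if q.deg = 0 then q.term (p g) k else 0).sum =
      PowerSeries.coeff n (c₀ g k) := by
  by_cases hn : n = 0
  · subst hn
    rw [codes, Multiset.map_singleton, Multiset.sum_singleton, if_pos rfl, Code.term, c₀, hp]
    by_cases h : g = 0 ∧ k = 0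
    · obtain ⟨rfl, rfl⟩ := h
      simp [Code.monomial]
    · rw [if_neg h, if_neg fun h' => h ⟨h'.1, h'.2.symm⟩, map_zero]
  · rw [Multiset.map_congr rfl (g := fun _ => 0) fun q hq => if_neg (by
      have := (mem_codes hq).2.2 hn
      omega)]
    rw [c₀]
    split_ifs
    · simp [PowerSeries.coeff_one, hn]
    · simp

theorem codeSeries_eq_cubic {p : ℕ → Bool → ℤ → Prop} (hp : ∀ g, p g true 2 ↔ g = 0)
    (g k : ℕ) : xvar 0 * cubicSeries p g k =
      codeSeries p g k - c₀ g k - xvar 0 * coeffX 1 (codeSeries p g k) := by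
  rw [sub_sub, eq_sub_iff_add_eq]
  ext1 n
  rw [map_add, map_add, xvar, PowerSeries.coeff_C_mul, PowerSeries.coeff_C_mul, coeff_coeffX,
    codeSeries, cubicSeries, PowerSeries.coeff_mk, PowerSeries.coeff_mk, map_total, total_bind,
    total, ← Multiset.sum_map_mul_left, ← Multiset.sum_map_mul_left, ← sum_term_deg_zero hp,
    ← Multiset.sum_map_add, ← Multiset.sum_map_add]
  congr 1
  refine Multiset.map_congr rfl fun q _ => ?_
  conv_rhs => rw [term_eq_cubic]
  ring

theorem coeffX_zero_codeSeries {p : ℕ → Bool → ℤ → Prop} (hp : ∀ g, p g true 2 ↔ g = 0)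
    (g k : ℕ) : coeffX 0 (codeSeries p g k) = c₀ g k := by
  ext1 n
  rw [coeff_coeffX, codeSeries, PowerSeries.coeff_mk, map_total, ← sum_term_deg_zero hp]
  by_cases hn : n = 0
  · subst hn
    rw [codes, Multiset.map_singleton, Multiset.map_singleton, if_pos rfl, Code.term]
    split_ifs with h
    · rw [coeffPoly_monomial, if_pos rfl, Code.monomial]
      simp
    · rw [map_zero]
  · congr 1
    refine Multiset.map_congr rfl fun q hq => ?_
    have h := (mem_codes hq).2.2 hn
    rw [if_neg (by omega), Code.term]
    split_ifs
    · rw [coeffPoly_monomial, if_neg (by omega)]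
    · rw [map_zero]

/-- The quotient of `x F(x) - x_k F(x_k)` by `x - x_k` for the monomial of a code. -/
noncomputable def Code.geom (k : ℕ) (q : Code (List ℕ)) : MvPolynomial (Fin (k + 1 + 1)) ℚ :=
  (∑ i ∈ Finset.range (q.deg + 1),
    MvPolynomial.X 0 ^ i * MvPolynomial.X (Fin.last (k + 1)) ^ (q.deg - i)) *
    ∏ i : Fin k, MvPolynomial.X i.succ.castSucc ^ q.marks.getD i 0

/-- The quotient is a geometric sum, whose terms are the ways of sharing the edge-ends between the
root-vertex and a new marked vertex. -/
theorem Code.sub_mul_geom (k : ℕ) (q : Code (List ℕ)) :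
    (MvPolynomial.X 0 - MvPolynomial.X (Fin.last (k + 1))) * q.geom k =
      MvPolynomial.X 0 * MvPolynomial.rename Fin.castSucc (q.monomial k) -
      MvPolynomial.X (Fin.last (k + 1)) * MvPolynomial.rename
        (fun i : Fin (k + 1) => if i = 0 then Fin.last (k + 1) else i.castSucc)
        (q.monomial k) := by
  have h := (Commute.all (MvPolynomial.X 0 : MvPolynomial (Fin (k + 1 + 1)) ℚ)
    (MvPolynomial.X (Fin.last (k + 1)))).mul_geom_sum₂ (q.deg + 1)
  rw [Nat.add_sub_cancel] at h
  rw [Code.geom, ← mul_assoc, h, Code.monomial, map_mul, map_mul, map_pow, map_pow,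
    MvPolynomial.rename_X, MvPolynomial.rename_X, map_prod, map_prod, if_pos rfl]
  simp only [map_pow, MvPolynomial.rename_X, Fin.succ_ne_zero, if_false, Fin.castSucc_zero]
  ring

/-- The factor `x x_k` accounts for the new edge, which has one end at each of the two vertices. -/
theorem Code.total_marked (p : Bool → ℤ → Prop) (k : ℕ) (q : Code (List ℕ)) (hp : p q.ori q.chi)
    (hk : q.marks.length = k) : total p (k + 1) q.marked =
      MvPolynomial.X 0 * MvPolynomial.X (Fin.last (k + 1)) * q.geom k := by
  rw [Code.marked, total_sum, Code.geom, Finset.sum_mul, Finset.mul_sum]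
  refine Finset.sum_congr rfl fun i hi => ?_
  have hi' := Finset.mem_range.1 hi
  rw [total_singleton, Code.term_of_pos ⟨q.ori, q.chi, i + 1, q.marks ++ [q.deg + 1 - i]⟩ hp
    (by simp [hk]), Code.monomial,
    Fin.prod_univ_castSucc]
  have h1 : ∀ j : Fin k, (q.marks ++ [q.deg + 1 - i]).getD j.castSucc 0 = q.marks.getD j 0 := by
    intro j
    exact List.getD_append _ _ _ _ (by rw [hk]; exact j.2)
  have h2 : (q.marks ++ [q.deg + 1 - i]).getD (Fin.last k) 0 = q.deg - i + 1 := by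
    subst hk
    simp
    omega
  simp only [h1, h2, Fin.succ_castSucc, Fin.succ_last]
  rw [pow_succ, pow_succ]
  ring

theorem Code.total_marked_of_neg (p : Bool → ℤ → Prop) (k : ℕ) (q : Code (List ℕ))
    (h : ¬ (p q.ori q.chi ∧ q.marks.length = k)) : total p (k + 1) q.marked = 0 := by
  rw [Code.marked, total_sum]
  refine Finset.sum_eq_zero fun i _ => ?_
  rw [total_singleton, Code.term, if_neg]
  simpa using h

theorem Code.total_marked_zero (p : Bool → ℤ → Prop) (q : Code (List ℕ)) :
    total p 0 q.marked = 0 := by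
  rw [Code.marked, total_sum]
  refine Finset.sum_eq_zero fun i _ => ?_
  rw [total_singleton, Code.term, if_neg]
  simp

open Classical in
/-- The quotient of `x F(x) - x_k F(x_k)` by `x - x_k`. -/
noncomputable def geomSeries (p : ℕ → Bool → ℤ → Prop) (g k : ℕ) : Series (k + 1) :=
  PowerSeries.mk fun n => ((codes n).map fun q =>
    if p g q.ori q.chi ∧ q.marks.length = k then q.geom k else 0).sum

theorem coeff_substVars {m k : ℕ} (s : Fin (m + 1) → Fin (k + 1)) (F : Series m) (n : ℕ) :
    PowerSeries.coeff n (substVars s F) = MvPolynomial.rename s (PowerSeries.coeff n F) := rfl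

theorem rename_total {m k : ℕ} (s : Fin (m + 1) → Fin (k + 1)) (p : Bool → ℤ → Prop)
    (t : Multiset (Code (List ℕ))) : MvPolynomial.rename s (total p m t) =
      (t.map fun q => MvPolynomial.rename s (q.term p m)).sum :=
  map_total p m (MvPolynomial.rename (R := ℚ) s).toAddMonoidHom t

theorem sub_mul_geomSeries (p : ℕ → Bool → ℤ → Prop) (g k : ℕ) :
    (xvar 0 - xvar (Fin.last (k + 1))) * geomSeries p g k =
      xvar 0 * substVars Fin.castSucc (codeSeries p g k) - xvar (Fin.last (k + 1)) *
        substVars (fun i => if i = 0 then Fin.last (k + 1) else i.castSucc)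
          (codeSeries p g k) := by
  ext1 n
  have e : (xvar 0 - xvar (Fin.last (k + 1)) : Series (k + 1)) =
      PowerSeries.C (MvPolynomial.X 0 - MvPolynomial.X (Fin.last (k + 1))) :=
    (map_sub PowerSeries.C _ _).symm
  rw [e, map_sub (PowerSeries.coeff n), xvar, xvar, PowerSeries.coeff_C_mul, PowerSeries.coeff_C_mul,
    PowerSeries.coeff_C_mul, coeff_substVars, coeff_substVars, codeSeries, geomSeries,
    PowerSeries.coeff_mk, PowerSeries.coeff_mk, rename_total, rename_total,
    ← Multiset.sum_map_mul_left, ← Multiset.sum_map_mul_left, ← Multiset.sum_map_mul_left,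
    ← Multiset.sum_map_sub]
  congr 1
  refine Multiset.map_congr rfl fun q _ => ?_
  by_cases h : p g q.ori q.chi ∧ q.marks.length = k
  · rw [if_pos h, Code.term, if_pos h, Code.sub_mul_geom]
  · rw [if_neg h, Code.term, if_neg h]
    simp

theorem total_bind_marked (p : ℕ → Bool → ℤ → Prop) (g k n : ℕ) :
    total (p g) (k + 1) ((codes n).bind Code.marked) = MvPolynomial.X 0 *
      MvPolynomial.X (Fin.last (k + 1)) * PowerSeries.coeff n (geomSeries p g k) := by
  rw [total_bind, geomSeries, PowerSeries.coeff_mk, ← Multiset.sum_map_mul_left]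
  congr 1
  refine Multiset.map_congr rfl fun q _ => ?_
  by_cases h : p g q.ori q.chi ∧ q.marks.length = k
  · rw [if_pos h, Code.total_marked _ _ _ h.1 h.2]
  · rw [if_neg h, Code.total_marked_of_neg _ _ _ h, mul_zero]


theorem coeff_succ_xvar_pow {k : ℕ} (m n : ℕ) (F : Series k) :
    PowerSeries.coeff (n + 1) (xvar 0 ^ m * PowerSeries.X * F) =
      MvPolynomial.X 0 ^ m * PowerSeries.coeff n F := by
  rw [xvar, ← map_pow, mul_assoc, PowerSeries.coeff_C_mul, PowerSeries.coeff_succ_X_mul]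

theorem coeff_zero_xvar_pow {k : ℕ} (m : ℕ) (F : Series k) :
    PowerSeries.coeff 0 (xvar 0 ^ m * PowerSeries.X * F) = 0 := by
  simp

/-! ### Adding a handle -/

/-- The effect of adding a handle on polynomials. -/
noncomputable def handlePoly (k : ℕ) :
    MvPolynomial (Fin (k + 1 + 1)) ℚ →+ MvPolynomial (Fin (k + 1)) ℚ where
  toFun f := MvPolynomial.X 0 ^ 3 * ∑ j : Fin (k + 1),
    MvPolynomial.rename (Fin.insertNth j.succ 0 id : Fin (k + 1 + 1) → Fin (k + 1))
      (MvPolynomial.pderiv j.succ f)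
  map_zero' := by simp
  map_add' f g := by simp [Finset.sum_add_distrib, mul_add]

theorem handlePoly_apply (k : ℕ) (f : MvPolynomial (Fin (k + 1 + 1)) ℚ) :
    handlePoly k f = MvPolynomial.X 0 ^ 3 * ∑ j : Fin (k + 1),
      MvPolynomial.rename (Fin.insertNth j.succ 0 id : Fin (k + 1 + 1) → Fin (k + 1))
        (MvPolynomial.pderiv j.succ f) := rfl

theorem coeff_handleTerm {k : ℕ} (G : Series (k + 1)) (n : ℕ) :
    PowerSeries.coeff (n + 1) (handleTerm G) = handlePoly k (PowerSeries.coeff n G) := by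
  rw [handleTerm, coeff_succ_xvar_pow, map_sum, handlePoly_apply]
  congr 1
  refine Finset.sum_congr rfl fun j _ => ?_
  rw [coeff_substVars, derivVar, PowerSeries.coeff_mk]

theorem pderiv_prod_eq_zero {ι σ : Type*} (s : Finset ι) (f : ι → MvPolynomial σ ℚ) (i : σ)
    (h : ∀ j ∈ s, MvPolynomial.pderiv i (f j) = 0) :
    MvPolynomial.pderiv i (∏ j ∈ s, f j) = 0 := by
  refine Finset.prod_induction f (fun g => MvPolynomial.pderiv i g = 0) ?_ ?_ h
  · intro a b ha hb
    rw [Derivation.leibniz, ha, hb]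
    simp
  · simp

theorem pderiv_X_pow_of_ne {σ : Type*} {i j : σ} (h : j ≠ i) (m : ℕ) :
    MvPolynomial.pderiv i (MvPolynomial.X j ^ m : MvPolynomial σ ℚ) = 0 := by
  rw [Derivation.leibniz_pow, MvPolynomial.pderiv_X_of_ne h]
  simp

/-- Differentiation brings down the degree of the mark, the number of places for the new edge-end,
and setting `x_j = x` merges the vertex into the root-vertex. The factor `x ^ 3` supplies the two
new ends and the power lost by differentiating. -/
theorem rename_pderiv_monomial (k : ℕ) (q : Code (List ℕ)) (j : Fin (k + 1)) :
    MvPolynomial.X 0 ^ 3 * MvPolynomial.rename (Fin.insertNth j.succ 0 id : Fin (k + 1 + 1) →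
      Fin (k + 1)) (MvPolynomial.pderiv j.succ (q.monomial (k + 1))) =
    q.marks.getD j 0 • (MvPolynomial.X 0 ^ (q.deg + q.marks.getD j 0 + 2) *
      ∏ i : Fin k, MvPolynomial.X i.succ ^ q.marks.getD (j.succAbove i) 0) := by
  set R : MvPolynomial (Fin (k + 1 + 1)) ℚ := MvPolynomial.X 0 ^ q.deg *
    ∏ i : Fin k, MvPolynomial.X (j.succAbove i).succ ^ q.marks.getD (j.succAbove i) 0 with hR
  have h1 : q.monomial (k + 1) = MvPolynomial.X j.succ ^ q.marks.getD j 0 * R := by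
    rw [Code.monomial, Fin.prod_univ_succAbove _ j, hR]
    ring
  have h2 : MvPolynomial.pderiv j.succ R = 0 := by
    rw [hR, Derivation.leibniz, pderiv_X_pow_of_ne (Fin.succ_ne_zero j).symm,
      pderiv_prod_eq_zero _ _ _ fun i _ => pderiv_X_pow_of_ne
        (fun h => Fin.succAbove_ne j i (Fin.succ_injective _ h)) _]
    simp
  have h3 : MvPolynomial.rename (Fin.insertNth j.succ 0 id : Fin (k + 1 + 1) → Fin (k + 1)) R =
      MvPolynomial.X 0 ^ q.deg *
        ∏ i : Fin k, MvPolynomial.X i.succ ^ q.marks.getD (j.succAbove i) 0 := by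
    rw [hR, map_mul, map_pow, MvPolynomial.rename_X, map_prod]
    congr 1
    refine Finset.prod_congr rfl fun i _ => ?_
    rw [map_pow, MvPolynomial.rename_X]
    congr 2
    have h := Fin.insertNth_apply_succAbove (α := fun _ => Fin (k + 1)) j.succ 0 id i.succ
    rwa [Fin.succ_succAbove_succ] at h
  have h4 : MvPolynomial.pderiv j.succ (q.monomial (k + 1)) =
      ((q.marks.getD j 0 : ℕ) : MvPolynomial (Fin (k + 1 + 1)) ℚ) *
        (MvPolynomial.X j.succ ^ (q.marks.getD j 0 - 1) * R) := by
    rw [h1, Derivation.leibniz, h2, Derivation.leibniz_pow, MvPolynomial.pderiv_X_self]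
    simp only [smul_eq_mul, mul_one, nsmul_eq_mul]
    ring
  rw [h4, map_mul, map_natCast, map_mul, h3, map_pow, MvPolynomial.rename_X,
    Fin.insertNth_apply_same, nsmul_eq_mul]
  -- For a mark of degree 0 the truncated exponent is wrong, but the factor in front vanishes.
  rcases Nat.eq_zero_or_pos (q.marks.getD j 0) with h | h
  · rw [h]
    simp
  · obtain ⟨m, hm⟩ : ∃ m, q.marks.getD j 0 = m + 1 := ⟨q.marks.getD j 0 - 1, by omega⟩
    rw [hm, Nat.add_sub_cancel]
    ring

theorem getD_eraseIdx {k : ℕ} (l : List ℕ) (j : Fin (k + 1)) (i : Fin k) :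
    (l.eraseIdx j).getD i 0 = l.getD (j.succAbove i) 0 := by
  rw [List.getD_eq_getElem?_getD, List.getD_eq_getElem?_getD, List.getElem?_eraseIdx]
  congr 1
  rw [Fin.succAbove]
  by_cases h : (i : ℕ) < j
  · rw [if_pos h, if_pos (Fin.lt_def.2 h)]
    rfl
  · rw [if_neg h, if_neg (fun h' => h (Fin.lt_def.1 h'))]
    rfl

-- Each merge has one outcome of the same orientability and one non-orientable outcome, each counted
-- if its surface is selected. For `O` at most the first counts; for `Q` both count or neither,
-- whence the factor 2.
open Classical in
theorem Code.total_handle (p : Bool → ℤ → Prop) (k : ℕ) (q : Code (List ℕ)) :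
    total p k q.handle = ((if p q.ori (q.chi - 2) then 1 else 0) +
      (if p false (q.chi - 2) then 1 else 0)) *
      handlePoly k (if q.marks.length = k + 1 then q.monomial (k + 1) else 0) := by
  rw [Code.handle, total_sum]
  by_cases hk : q.marks.length = k + 1
  · rw [if_pos hk, handlePoly_apply, Finset.mul_sum, Finset.mul_sum]
    refine Fintype.sum_equiv (finCongr hk) _ _ fun j => ?_
    have hj : q.marks[j] = q.marks.getD (finCongr hk j) 0 := by simp
    have hl : (q.marks.eraseIdx j).length = k := by
      rw [List.length_eraseIdx_of_lt j.2, hk]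
      rfl
    have hm : ∀ o, Code.monomial k ⟨o, q.chi - 2, q.deg + q.marks[j] + 2, q.marks.eraseIdx j⟩ =
        MvPolynomial.X 0 ^ (q.deg + q.marks[j] + 2) * ∏ i : Fin k,
          MvPolynomial.X i.succ ^ q.marks.getD ((finCongr hk j).succAbove i) 0 := by
      intro o
      rw [Code.monomial]
      congr 1
      refine Finset.prod_congr rfl fun i _ => ?_
      rw [← getD_eraseIdx]
      rfl
    rw [rename_pderiv_monomial, total_nsmul, total_add, total_singleton, total_singleton,
      Code.term, Code.term, hm, hm, ← hj]
    simp only [hl, and_true]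
    (split_ifs <;> simp); ring
  · rw [if_neg hk, map_zero, mul_zero]
    refine Finset.sum_eq_zero fun j _ => ?_
    have hl : (q.marks.eraseIdx j).length ≠ k := by
      rw [List.length_eraseIdx_of_lt j.2]
      have := j.2
      omega
    rw [total_nsmul, total_add, total_singleton, total_singleton, Code.term_of_ne _ hl,
      Code.term_of_ne _ hl]
    simp

/-! ### Adding a crosscap -/

/-- The effect of adding a crosscap on polynomials. -/
noncomputable def crossCapPoly (k : ℕ) :
    MvPolynomial (Fin (k + 1)) ℚ →+ MvPolynomial (Fin (k + 1)) ℚ where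
  toFun f := MvPolynomial.X 0 ^ 2 * MvPolynomial.pderiv 0 (MvPolynomial.X 0 * f)
  map_zero' := by simp
  map_add' f g := by rw [mul_add, map_add, mul_add]

theorem coeff_crossCapTerm {k : ℕ} (G : Series k) (n : ℕ) :
    PowerSeries.coeff (n + 1) (crossCapTerm G) = crossCapPoly k (PowerSeries.coeff n G) := by
  rw [crossCapTerm, coeff_succ_xvar_pow, derivVar, PowerSeries.coeff_mk, xvar,
    PowerSeries.coeff_C_mul]
  rfl

/-- The operator multiplies `x ^ d` by `d + 1`, the number of places for a twisted loop; `x ^ 2`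
stands for its two ends. -/
theorem crossCapPoly_monomial (k : ℕ) (q : Code (List ℕ)) :
    crossCapPoly k (q.monomial k) = (q.deg + 1) • (MvPolynomial.X 0 ^ (q.deg + 2) *
      ∏ i : Fin k, MvPolynomial.X i.succ ^ q.marks.getD i 0) := by
  change MvPolynomial.X 0 ^ 2 * MvPolynomial.pderiv 0 (MvPolynomial.X 0 * q.monomial k) = _
  rw [Code.monomial, ← mul_assoc, ← pow_succ', Derivation.leibniz,
    pderiv_prod_eq_zero _ _ _ fun i _ => pderiv_X_pow_of_ne (Fin.succ_ne_zero i) _,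
    Derivation.leibniz_pow, MvPolynomial.pderiv_X_self]
  simp only [smul_eq_mul, mul_one, Nat.add_sub_cancel, nsmul_eq_mul]
  ring

open Classical in
theorem Code.total_crossCap (p : Bool → ℤ → Prop) (k : ℕ) (q : Code (List ℕ)) :
    total p k q.crossCap = (if p false (q.chi - 1) then 1 else 0) *
      crossCapPoly k (if q.marks.length = k then q.monomial k else 0) := by
  rw [Code.crossCap, total_nsmul, total_singleton, Code.term]
  by_cases hk : q.marks.length = k
  · rw [if_pos hk, crossCapPoly_monomial]
    simp only [hk, and_true]
    split_ifs <;> simp [Code.monomial]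
  · rw [if_neg hk, if_neg (fun h => hk h.2)]
    simp

/-! ### Joining two maps -/

/-- A monomial in variables indexed by natural numbers. -/
theorem rename_monomial {m k : ℕ} (s : Fin (m + 1) → Fin (k + 1)) (Y : ℕ → Fin (k + 1))
    (h : ∀ i : Fin (m + 1), s i = Y i) (q : Code (List ℕ)) :
    MvPolynomial.rename s (q.monomial m) = MvPolynomial.X (Y 0) ^ q.deg *
      ∏ i ∈ Finset.range m, MvPolynomial.X (Y (i + 1)) ^ q.marks.getD i 0 := by
  rw [Code.monomial, map_mul, map_pow, MvPolynomial.rename_X, h, map_prod,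
    ← Fin.prod_univ_eq_prod_range (fun i => (MvPolynomial.X (Y (i + 1)) ^ q.marks.getD i 0 :
      MvPolynomial (Fin (k + 1)) ℚ))]
  congr 1
  refine Finset.prod_congr rfl fun i _ => ?_
  rw [map_pow, MvPolynomial.rename_X, h, Fin.val_succ]

/-- The families of sets of surfaces which are graded by the genus, for the surfaces of codes. -/
structure Graded (p : ℕ → Bool → ℤ → Prop) : Prop where
  sphere : ∀ g, p g true 2 ↔ g = 0
  unique : ∀ {g g' o χ}, p g o χ → p g' o χ → g = g'
  join : ∀ g o χ o' χ', χ ≤ 2 → χ' ≤ 2 → (o = true → Even χ) → (o' = true → Even χ') →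
    (p g (o && o') (χ + χ' - 2) ↔ ∃ i ≤ g, p i o χ ∧ p (g - i) o' χ')

/-- Indexing the variables by natural numbers lets the product over the concatenated list split at
position `j`. -/
theorem monomial_join {k : ℕ} (q r : Code (List ℕ)) (j : Fin (k + 1)) (hq : q.marks.length = j) :
    MvPolynomial.X 0 ^ 2 * (MvPolynomial.rename
      (fun m : Fin (j.val + 1) => (⟨m.val, by omega⟩ : Fin (k + 1))) (q.monomial j.val) *
      MvPolynomial.rename (fun m : Fin (k - j.val + 1) =>
        if m = 0 then 0 else (⟨j.val + m.val, by omega⟩ : Fin (k + 1)))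
        (r.monomial (k - j.val))) = (q.join r).monomial k := by
  have hj := j.2
  rw [rename_monomial _ (fun i => Fin.ofNat (k + 1) i), rename_monomial _
    (fun i => if i = 0 then 0 else Fin.ofNat (k + 1) (j + i)),
    ← MvPolynomial.rename_id_apply ((q.join r).monomial k),
    rename_monomial _ (fun i => Fin.ofNat (k + 1) i)]
  · rw [show Finset.range k = Finset.range (j + (k - j)) by congr 1; omega,
      Finset.prod_range_add]
    have h1 : ∀ i ∈ Finset.range (j : ℕ), (q.marks ++ r.marks).getD i 0 = q.marks.getD i 0 :=
      fun i hi => List.getD_append _ _ _ _ (by rw [hq]; exact Finset.mem_range.1 hi)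
    have h2 : ∀ i, (q.marks ++ r.marks).getD (j + i) 0 = r.marks.getD i 0 := by
      intro i
      refine (List.getD_append_right _ _ _ _ (by omega)).trans ?_
      rw [hq, Nat.add_sub_cancel_left]
    rw [Finset.prod_congr rfl fun i hi => by rw [← h1 i hi]]
    simp only [h2, if_true, Nat.add_eq_zero_iff, one_ne_zero, and_false, if_false, Code.join]
    have h3 : Fin.ofNat (k + 1) 0 = 0 := rfl
    rw [h3]
    simp only [add_assoc]
    ring
  · intro i
    ext
    simp
  · intro i
    have hi := i.2
    by_cases h : i = 0
    · simp [h]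
    · have h' : (i : ℕ) ≠ 0 := fun e => h (Fin.ext e)
      rw [if_neg h, if_neg h']
      ext
      simp [Nat.mod_eq_of_lt (show (j : ℕ) + i < k + 1 by omega)]
  · intro i
    ext
    have hi := i.2
    simp [Nat.mod_eq_of_lt (show (i : ℕ) < k + 1 by omega)]

/-- The coefficients of the product term. -/
noncomputable def joinPoly (g k : ℕ) (A B : ∀ _ k : ℕ, MvPolynomial (Fin (k + 1)) ℚ) :
    MvPolynomial (Fin (k + 1)) ℚ :=
  MvPolynomial.X 0 ^ 2 * ∑ i ∈ Finset.range (g + 1), ∑ j : Fin (k + 1),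
    MvPolynomial.rename (fun m : Fin (j.val + 1) => (⟨m.val, by omega⟩ : Fin (k + 1)))
      (A i j.val) *
    MvPolynomial.rename (fun m : Fin (k - j.val + 1) =>
      if m = 0 then 0 else (⟨j.val + m.val, by omega⟩ : Fin (k + 1))) (B (g - i) (k - j.val))

theorem joinPoly_add_left (g k : ℕ) (A A' B : ∀ _ k : ℕ, MvPolynomial (Fin (k + 1)) ℚ) :
    joinPoly g k (fun g k => A g k + A' g k) B = joinPoly g k A B + joinPoly g k A' B := by
  simp only [joinPoly, map_add, add_mul, Finset.sum_add_distrib, mul_add]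

theorem joinPoly_add_right (g k : ℕ) (A B B' : ∀ _ k : ℕ, MvPolynomial (Fin (k + 1)) ℚ) :
    joinPoly g k A (fun g k => B g k + B' g k) = joinPoly g k A B + joinPoly g k A B' := by
  simp only [joinPoly, map_add, Finset.sum_add_distrib, mul_add]

theorem joinPoly_zero_left (g k : ℕ) (B : ∀ _ k : ℕ, MvPolynomial (Fin (k + 1)) ℚ) :
    joinPoly g k (fun _ _ => 0) B = 0 := by
  simp [joinPoly]

theorem joinPoly_zero_right (g k : ℕ) (A : ∀ _ k : ℕ, MvPolynomial (Fin (k + 1)) ℚ) :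
    joinPoly g k A (fun _ _ => 0) = 0 := by
  simp [joinPoly]

theorem coeff_productTerm (F : ∀ _ k : ℕ, Series k) (g k n : ℕ) :
    PowerSeries.coeff (n + 1) (productTerm F g k) = ∑ a : Fin (n + 1),
      joinPoly g k (fun i j => PowerSeries.coeff a (F i j))
        (fun i j => PowerSeries.coeff (n - a) (F i j)) := by
  rw [productTerm, coeff_succ_xvar_pow]
  simp only [joinPoly]
  rw [← Finset.mul_sum, map_sum, Finset.sum_comm]
  congr 1
  refine Finset.sum_congr rfl fun i _ => ?_
  rw [map_sum, Finset.sum_comm]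
  refine Finset.sum_congr rfl fun j _ => ?_
  rw [PowerSeries.coeff_mul, Finset.Nat.sum_antidiagonal_eq_sum_range_succ_mk,
    ← Fin.sum_univ_eq_sum_range (fun a => PowerSeries.coeff a (substVars _ (F i j)) *
      PowerSeries.coeff (n - a) (substVars _ (F (g - i) (k - j)))) (n + 1)]
  rfl

/-- A pair of codes contributes to at most one summand: the surface of the first code determines `i`
and the number of its marks determines `j`. -/
theorem joinPoly_term {p : ℕ → Bool → ℤ → Prop} (hp : Graded p) (g k : ℕ)
    {q r : Code (List ℕ)} (hq : q.chi ≤ 2) (hr : r.chi ≤ 2) (hq' : q.ori = true → Even q.chi)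
    (hr' : r.ori = true → Even r.chi) :
    joinPoly g k (fun i j => q.term (p i) j) (fun i j => r.term (p i) j) =
      (q.join r).term (p g) k := by
  have hj := hp.join g q.ori q.chi r.ori r.chi hq hr hq' hr'
  rw [joinPoly]
  by_cases h : p g (q.join r).ori (q.join r).chi ∧ (q.join r).marks.length = k
  · rw [Code.term_of_pos _ h.1 h.2]
    obtain ⟨i, hi, h1, h2⟩ := hj.1 h.1
    have hl : q.marks.length + r.marks.length = k := by
      rw [← h.2]
      simp [Code.join]
    rw [Finset.sum_eq_single i, Finset.sum_eq_single (⟨q.marks.length, by omega⟩ : Fin (k + 1)),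
      Code.term_of_pos _ h1 rfl, Code.term_of_pos _ h2 (by simp only; omega), monomial_join _ _
        (⟨q.marks.length, by omega⟩ : Fin (k + 1)) rfl]
    · intro j _ hne
      rw [Code.term_of_ne _ (fun e => hne (Fin.ext e.symm)), map_zero, zero_mul]
    · exact fun h => absurd (Finset.mem_univ _) h
    · intro i' _ hne
      refine Finset.sum_eq_zero fun j _ => ?_
      rw [Code.term_of_neg _ (fun h3 => hne (hp.unique h3 h1)), map_zero, zero_mul]
    · exact fun h => absurd (Finset.mem_range.2 (by omega)) h
  · rw [Code.term, if_neg h, Finset.sum_eq_zero, mul_zero]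
    intro i hi
    refine Finset.sum_eq_zero fun j _ => ?_
    have hi' := Finset.mem_range.1 hi
    by_cases h1 : p i q.ori q.chi
    · by_cases h2 : p (g - i) r.ori r.chi
      · by_cases h3 : q.marks.length = j
        · rw [r.term_of_ne, map_zero, mul_zero]
          intro h4
          refine h ⟨hj.2 ⟨i, by omega, h1, h2⟩, ?_⟩
          have hj' := j.2
          simp only [Code.join, List.length_append]
          omega
        · rw [q.term_of_ne h3, map_zero, zero_mul]
      · rw [r.term_of_neg h2, map_zero, mul_zero]
    · rw [q.term_of_neg h1, map_zero, zero_mul]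

theorem joinPoly_total {p : ℕ → Bool → ℤ → Prop} (hp : Graded p) (g k : ℕ)
    {s t : Multiset (Code (List ℕ))} (hs : ∀ q ∈ s, q.chi ≤ 2 ∧ (q.ori = true → Even q.chi))
    (ht : ∀ q ∈ t, q.chi ≤ 2 ∧ (q.ori = true → Even q.chi)) :
    joinPoly g k (fun i j => total (p i) j s) (fun i j => total (p i) j t) =
      total (p g) k (s.bind fun q => t.map q.join) := by
  induction s using Multiset.induction_on with
  | empty => simpa using joinPoly_zero_left g k _
  | cons q s ih =>
    simp only [total_cons]
    rw [joinPoly_add_left, ih fun r hr => hs r (Multiset.mem_cons_of_mem hr), Multiset.cons_bind,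
      total_add]
    congr 1
    obtain ⟨h1, h2⟩ := hs q (Multiset.mem_cons_self q s)
    clear ih hs
    induction t using Multiset.induction_on with
    | empty => simpa using joinPoly_zero_right g k _
    | cons r t ih =>
      simp only [total_cons]
      obtain ⟨h3, h4⟩ := ht r (Multiset.mem_cons_self r t)
      rw [joinPoly_add_right, ih fun r hr => ht r (Multiset.mem_cons_of_mem hr),
        joinPoly_term hp g k h1 h3 h2 h4, Multiset.map_cons, total_cons]

theorem coeff_productTerm_codeSeries {p : ℕ → Bool → ℤ → Prop} (hp : Graded p) (g k n : ℕ) :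
    PowerSeries.coeff (n + 1) (productTerm (codeSeries p) g k) = total (p g) k
      (∑ i : Fin (n + 1), (codes i).bind fun q => (codes (n - i)).map q.join) := by
  rw [coeff_productTerm, total_sum]
  refine Finset.sum_congr rfl fun a _ => ?_
  simp only [codeSeries, PowerSeries.coeff_mk]
  exact joinPoly_total hp g k (fun q hq => ⟨(mem_codes hq).1, (mem_codes hq).2.1⟩)
    (fun q hq => ⟨(mem_codes hq).1, (mem_codes hq).2.1⟩)


/-! ## The functional equations -/

/-- The divisions in the equations are exact; exhibiting the quotient `G` brings them back to
series. -/
theorem frac_div_mul {k : ℕ} {b G c : Series k} (hb : b ≠ 0) (h : b * G = c) (a : Series k) :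
    algebraMap (Series k) (Frac k) a / algebraMap (Series k) (Frac k) b *
      algebraMap (Series k) (Frac k) c = algebraMap (Series k) (Frac k) (a * G) := by
  have hb' : algebraMap (Series k) (Frac k) b ≠ 0 := fun e =>
    hb (IsFractionRing.injective (Series k) (Frac k) (e.trans (map_zero _).symm))
  rw [← h, map_mul, map_mul]
  field_simp

theorem xvar_ne_zero {k : ℕ} (i : Fin (k + 1)) : (xvar i : Series k) ≠ 0 := by
  rw [xvar, Ne, ← map_zero PowerSeries.C, PowerSeries.C_injective.eq_iff]
  exact MvPolynomial.X_ne_zero i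

theorem X_sub_X_ne_zero (k : ℕ) : (MvPolynomial.X 0 - MvPolynomial.X (Fin.last (k + 1)) :
    MvPolynomial (Fin (k + 1 + 1)) ℚ) ≠ 0 := by
  rw [sub_ne_zero, Ne, MvPolynomial.X_injective.eq_iff]
  exact (Fin.last_pos).ne

theorem xvar_sub_xvar (k : ℕ) : (xvar 0 - xvar (Fin.last (k + 1)) : Series (k + 1)) =
    PowerSeries.C (MvPolynomial.X 0 - MvPolynomial.X (Fin.last (k + 1))) :=
  (map_sub PowerSeries.C _ _).symm

theorem xvar_sub_xvar_ne_zero (k : ℕ) :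
    (xvar 0 - xvar (Fin.last (k + 1)) : Series (k + 1)) ≠ 0 := by
  rw [xvar_sub_xvar, Ne, ← map_zero PowerSeries.C, PowerSeries.C_injective.eq_iff]
  exact X_sub_X_ne_zero k

/-! ### The series of codes solve the systems -/

section Existence

variable {p : ℕ → Bool → ℤ → Prop} (hp : Graded p)

/-- The series of the codes obtained by adding an edge to a new marked vertex. -/
noncomputable def markedSeries (p : ℕ → Bool → ℤ → Prop) (g : ℕ) : ∀ k : ℕ, Series k
  | 0 => 0
  | k + 1 => xvar 0 * xvar (Fin.last (k + 1)) * PowerSeries.X * geomSeries p g k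

theorem markedTerm_codeSeries (p : ℕ → Bool → ℤ → Prop) (g k : ℕ) :
    markedTerm (codeSeries p) g k = algebraMap (Series k) (Frac k) (markedSeries p g k) := by
  cases k with
  | zero => simp [markedTerm, markedSeries]
  | succ k => exact frac_div_mul (xvar_sub_xvar_ne_zero k) (sub_mul_geomSeries p g k) _

theorem coeff_zero_markedSeries (p : ℕ → Bool → ℤ → Prop) (g k : ℕ) :
    PowerSeries.coeff 0 (markedSeries p g k) = 0 := by
  cases k <;> simp [markedSeries]

theorem coeff_succ_markedSeries (p : ℕ → Bool → ℤ → Prop) (g k n : ℕ) :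
    PowerSeries.coeff (n + 1) (markedSeries p g k) =
      total (p g) k ((codes n).bind Code.marked) := by
  cases k with
  | zero =>
    rw [total_bind, Multiset.map_congr rfl fun q _ => Code.total_marked_zero _ q]
    simp [markedSeries]
  | succ k =>
    rw [total_bind_marked, markedSeries, xvar, xvar, ← map_mul, mul_assoc,
      PowerSeries.coeff_C_mul, PowerSeries.coeff_succ_X_mul]

include hp

theorem cubicTerm_codeSeries (g k : ℕ) : cubicTerm (codeSeries p) g k =
    algebraMap (Series k) (Frac k) (PowerSeries.X * cubicSeries p g k) :=
  frac_div_mul (xvar_ne_zero 0) (codeSeries_eq_cubic hp.sphere g k) _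

/-- The coefficient of `z ^ (n + 1)` is the recursion of `codes`: cubic splittings, marked
splittings and joins match the three middle terms, and `E` stands for twisted loops and merges. -/
theorem codeSeries_solution (g k : ℕ) (E : Series k) (h₀ : PowerSeries.coeff 0 E = 0)
    (h₁ : ∀ n, PowerSeries.coeff (n + 1) E = total (p g) k ((codes n).bind Code.crossCap) +
      total (p g) k ((codes n).bind Code.handle)) :
    algebraMap (Series k) (Frac k) (codeSeries p g k) =
      algebraMap (Series k) (Frac k) (c₀ g k) + cubicTerm (codeSeries p) g k +
      markedTerm (codeSeries p) g k +
      algebraMap (Series k) (Frac k) (productTerm (codeSeries p) g k) +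
      algebraMap (Series k) (Frac k) E := by
  rw [cubicTerm_codeSeries hp, markedTerm_codeSeries, ← map_add, ← map_add, ← map_add, ← map_add]
  congr 1
  ext1 n
  simp only [map_add]
  cases n with
  | zero =>
    rw [PowerSeries.coeff_zero_X_mul, coeff_zero_markedSeries, productTerm, coeff_zero_xvar_pow,
      h₀, ← sum_term_deg_zero hp.sphere, codeSeries, PowerSeries.coeff_mk, codes]
    simp
  | succ n =>
    rw [PowerSeries.coeff_succ_X_mul, coeff_succ_markedSeries, coeff_productTerm_codeSeries hp, h₁,
      codeSeries, PowerSeries.coeff_mk, codes, total_add, cubicSeries, PowerSeries.coeff_mk]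
    have h : PowerSeries.coeff (n + 1) (c₀ g k) = 0 := by
      rw [c₀]
      split_ifs <;> simp [PowerSeries.coeff_one]
    have hs : (codes n).bind Code.step = (codes n).bind Code.cubic + (codes n).bind Code.marked +
        (codes n).bind Code.crossCap + (codes n).bind Code.handle := by
      rw [← Multiset.bind_add, ← Multiset.bind_add, ← Multiset.bind_add]
      exact Multiset.bind_congr fun q _ => q.step_eq
    rw [h, hs, total_add, total_add, total_add]
    ring

end Existence

theorem systemQ_iff (F : ∀ _ k : ℕ, Series k) : SystemQ F ↔ ∀ g k,
    algebraMap (Series k) (Frac k) (F g k) =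
      algebraMap (Series k) (Frac k) (c₀ g k) + cubicTerm F g k + markedTerm F g k +
      algebraMap (Series k) (Frac k) (productTerm F g k) +
      algebraMap (Series k) (Frac k) ((if 2 ≤ g then 2 * handleTerm (F (g - 2) (k + 1)) else 0) +
        (if 1 ≤ g then crossCapTerm (F (g - 1) k) else 0)) := by
  simp only [SystemQ, map_add, add_assoc]

namespace CanonicalOrder.Good

/-- Evenness of `χ` is what provides the genus `1 - χ / 2` of an orientable part. -/
theorem graded_selO : Graded selO where
  sphere g := by
    simp only [selO, true_and]
    omega
  unique := by
    rintro g g' o χ ⟨-, h⟩ ⟨-, h'⟩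
    omega
  join g o χ o' χ' hχ hχ' he he' := by
    simp only [selO, Bool.and_eq_true]
    constructor
    · rintro ⟨⟨ho, ho'⟩, h⟩
      obtain ⟨a, ha⟩ := he ho
      obtain ⟨b, hb⟩ := he' ho'
      exact ⟨(1 - a).toNat, by omega, ⟨ho, by omega⟩, ho', by omega⟩
    · rintro ⟨i, hi, ⟨ho, h⟩, ho', h'⟩
      exact ⟨⟨ho, ho'⟩, by omega⟩

theorem graded_selQ : Graded selQ where
  sphere g := by
    simp only [selQ]
    omega
  unique := by
    rintro g g' o χ h h'
    simp only [selQ] at h h'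
    omega
  join g o χ o' χ' hχ hχ' _ _ := by
    simp only [selQ]
    constructor
    · intro h
      exact ⟨(2 - χ).toNat, by omega, by omega, by omega⟩
    · rintro ⟨i, hi, h, h'⟩
      omega

/-- Twisted loops and orientation-breaking merges never lie on an orientable surface, so a single
handle term remains. -/
theorem systemO_codeSeries : SystemO (codeSeries selO) := by
  classical
  intro g k
  refine codeSeries_solution graded_selO g k _ ?_ fun n => ?_
  · split_ifs
    · rw [handleTerm, coeff_zero_xvar_pow]
    · simp
  · have h1 : total (selO g) k ((codes n).bind Code.crossCap) = 0 := by
      rw [total_bind]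
      refine Multiset.sum_eq_zero fun f hf => ?_
      obtain ⟨q, -, rfl⟩ := Multiset.mem_map.1 hf
      rw [Code.total_crossCap, if_neg (fun h => Bool.false_ne_true h.1), zero_mul]
    rw [h1, zero_add, total_bind]
    by_cases hg : 1 ≤ g
    · rw [if_pos hg, coeff_handleTerm, codeSeries, PowerSeries.coeff_mk, map_total]
      congr 1
      refine Multiset.map_congr rfl fun q _ => ?_
      rw [Code.total_handle, Code.term, if_neg (show ¬ selO g false (q.chi - 2) from
        fun h => Bool.false_ne_true h.1), add_zero]
      have h2 : selO g q.ori (q.chi - 2) ↔ selO (g - 1) q.ori q.chi := by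
        simp only [selO]
        refine and_congr_right fun _ => ?_
        omega
      by_cases h3 : selO (g - 1) q.ori q.chi
      · rw [if_pos (h2.2 h3)]
        simp [h3]
      · rw [if_neg (mt h2.1 h3)]
        simp [h3]
    -- For `g = 0` a handle would have to be added to a code with `χ = 4`.
    · rw [if_neg hg, map_zero]
      symm
      refine Multiset.sum_eq_zero fun f hf => ?_
      obtain ⟨q, hq, rfl⟩ := Multiset.mem_map.1 hf
      have h4 := (mem_codes hq).1
      rw [Code.total_handle, if_neg (show ¬ selO g false (q.chi - 2) from
        fun h => Bool.false_ne_true h.1), if_neg, add_zero, zero_mul]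
      rintro ⟨-, h⟩
      omega

/-- Both kinds of merge lower `χ` by 2 and a twisted loop lowers it by 1. For small `g` the absent
terms would need a code with `χ > 2`. -/
theorem systemQ_codeSeries : SystemQ (codeSeries selQ) := by
  classical
  rw [systemQ_iff]
  intro g k
  refine codeSeries_solution graded_selQ g k _ ?_ fun n => ?_
  · rw [map_add]
    split_ifs <;> simp [handleTerm, crossCapTerm]
  · rw [map_add]
    refine (add_comm _ _).trans ?_
    congr 1
    · rw [total_bind]
      by_cases hg : 1 ≤ g
      · rw [if_pos hg, coeff_crossCapTerm, codeSeries, PowerSeries.coeff_mk, map_total]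
        congr 1
        refine Multiset.map_congr rfl fun q _ => ?_
        rw [Code.total_crossCap, Code.term]
        have h2 : selQ g false (q.chi - 1) ↔ selQ (g - 1) q.ori q.chi := by
          simp only [selQ]
          omega
        by_cases h3 : selQ (g - 1) q.ori q.chi
        · rw [if_pos (h2.2 h3)]
          simp [h3]
        · rw [if_neg (mt h2.1 h3)]
          simp [h3]
      · rw [if_neg hg, map_zero]
        symm
        refine Multiset.sum_eq_zero fun f hf => ?_
        obtain ⟨q, hq, rfl⟩ := Multiset.mem_map.1 hf
        have h4 := (mem_codes hq).1
        rw [Code.total_crossCap, if_neg, zero_mul]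
        simp only [selQ]
        omega
    · rw [total_bind]
      by_cases hg : 2 ≤ g
      · rw [if_pos hg, two_mul, map_add, coeff_handleTerm, codeSeries, PowerSeries.coeff_mk,
          map_total, ← Multiset.sum_map_add]
        congr 1
        refine Multiset.map_congr rfl fun q _ => ?_
        rw [Code.total_handle, Code.term]
        have h2 : ∀ o, selQ g o (q.chi - 2) ↔ selQ (g - 2) q.ori q.chi := by
          intro o
          simp only [selQ]
          omega
        simp only [h2]
        by_cases h3 : selQ (g - 2) q.ori q.chi
        · simp only [h3, if_true, true_and]
          ring
        · simp [h3]
      · rw [if_neg hg, map_zero]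
        symm
        refine Multiset.sum_eq_zero fun f hf => ?_
        obtain ⟨q, hq, rfl⟩ := Multiset.mem_map.1 hf
        have h4 := (mem_codes hq).1
        have h5 : ∀ o, ¬ selQ g o (q.chi - 2) := by
          intro o
          simp only [selQ]
          omega
        rw [Code.total_handle, if_neg (h5 _), if_neg (h5 _), add_zero, zero_mul]

end CanonicalOrder.Good

/-! ### Uniqueness of the solutions -/

section Uniqueness

/-- The denominator of the second term. -/
noncomputable def markedDen : ∀ k : ℕ, MvPolynomial (Fin (k + 1)) ℚ
  | 0 => 1
  | k + 1 => MvPolynomial.X 0 - MvPolynomial.X (Fin.last (k + 1))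

/-- The numerator of the second term. -/
noncomputable def markedNum (F : ∀ _ k : ℕ, Series k) (g : ℕ) : ∀ k : ℕ, Series k
  | 0 => 0
  | k + 1 => xvar 0 * xvar (Fin.last (k + 1)) * PowerSeries.X *
      (xvar 0 * substVars Fin.castSucc (F g k) - xvar (Fin.last (k + 1)) *
        substVars (fun i => if i = 0 then Fin.last (k + 1) else i.castSucc) (F g k))

theorem markedDen_ne_zero (k : ℕ) : markedDen k ≠ 0 := by
  cases k with
  | zero => exact one_ne_zero
  | succ k => exact X_sub_X_ne_zero k

theorem den_mul_markedTerm (F : ∀ _ k : ℕ, Series k) (g k : ℕ) :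
    algebraMap (Series k) (Frac k) (PowerSeries.C (markedDen k)) * markedTerm F g k =
      algebraMap (Series k) (Frac k) (markedNum F g k) := by
  cases k with
  | zero => simp [markedTerm, markedNum]
  | succ k =>
    have hb : algebraMap (Series (k + 1)) (Frac (k + 1)) (xvar 0 - xvar (Fin.last (k + 1))) ≠ 0 :=
      fun e => xvar_sub_xvar_ne_zero k (IsFractionRing.injective (Series (k + 1)) (Frac (k + 1))
        (e.trans (map_zero _).symm))
    rw [markedDen, ← xvar_sub_xvar, markedTerm, markedNum, map_mul _ _ (_ - _), ← mul_assoc,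
      mul_div_cancel₀ _ hb]

theorem x_mul_cubicTerm (F : ∀ _ k : ℕ, Series k) (g k : ℕ) :
    algebraMap (Series k) (Frac k) (xvar 0) * cubicTerm F g k =
      algebraMap (Series k) (Frac k)
        (PowerSeries.X * (F g k - c₀ g k - xvar 0 * coeffX 1 (F g k))) := by
  have hb : algebraMap (Series k) (Frac k) (xvar 0) ≠ 0 :=
      fun e => xvar_ne_zero 0 (IsFractionRing.injective (Series k) (Frac k)
        (e.trans (map_zero _).symm))
  rw [cubicTerm, map_mul]
  field_simp

theorem clear_aux {K : Type*} [CommRing K] {x d f c a b r e u v : K}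
    (h : f = c + a + b + r + e) (h₁ : d * b = u) (h₂ : x * a = v) :
    x * d * f = x * d * (c + r + e) + d * v + x * u := by
  rw [h, ← h₁, ← h₂]
  ring

/-- The equation after multiplication by the denominators. -/
theorem clear_denominators (F : ∀ _ k : ℕ, Series k) (g k : ℕ) (E : Series k)
    (h : algebraMap (Series k) (Frac k) (F g k) =
      algebraMap (Series k) (Frac k) (c₀ g k) + cubicTerm F g k + markedTerm F g k +
      algebraMap (Series k) (Frac k) (productTerm F g k) + algebraMap (Series k) (Frac k) E) :
    PowerSeries.C (MvPolynomial.X 0 * markedDen k) * F g k =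
      PowerSeries.C (MvPolynomial.X 0 * markedDen k) * (c₀ g k + productTerm F g k + E) +
      PowerSeries.C (markedDen k) *
        (PowerSeries.X * (F g k - c₀ g k - xvar 0 * coeffX 1 (F g k))) +
      PowerSeries.C (MvPolynomial.X 0) * markedNum F g k := by
  apply IsFractionRing.injective (Series k) (Frac k)
  have h1 := den_mul_markedTerm F g k
  have h2 := x_mul_cubicTerm F g k
  rw [xvar] at h2
  rw [map_mul PowerSeries.C]
  simp only [map_add, map_mul (algebraMap (Series k) (Frac k)) (PowerSeries.C _)]
  rw [map_mul (algebraMap (Series k) (Frac k)) (PowerSeries.C _ * PowerSeries.C _),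
    map_mul (algebraMap (Series k) (Frac k)) (PowerSeries.C _ * PowerSeries.C _),
    map_mul (algebraMap (Series k) (Frac k)) (PowerSeries.C _) (PowerSeries.C _)]
  simp only [map_add]
  exact clear_aux h h1 h2

/-- A system of equations with a contracting last term has at most one solution. -/
theorem eq_of_contracting (E : (∀ _ k : ℕ, Series k) → ∀ _ k : ℕ, Series k)
    (hE : ∀ n F F', (∀ m < n, ∀ g k, PowerSeries.coeff m (F g k) = PowerSeries.coeff m (F' g k)) →
      ∀ g k, PowerSeries.coeff n (E F g k) = PowerSeries.coeff n (E F' g k))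
    {F F' : ∀ _ k : ℕ, Series k}
    (h : ∀ g k, algebraMap (Series k) (Frac k) (F g k) =
      algebraMap (Series k) (Frac k) (c₀ g k) + cubicTerm F g k + markedTerm F g k +
      algebraMap (Series k) (Frac k) (productTerm F g k) + algebraMap (Series k) (Frac k) (E F g k))
    (h' : ∀ g k, algebraMap (Series k) (Frac k) (F' g k) =
      algebraMap (Series k) (Frac k) (c₀ g k) + cubicTerm F' g k + markedTerm F' g k +
      algebraMap (Series k) (Frac k) (productTerm F' g k) +
        algebraMap (Series k) (Frac k) (E F' g k)) : F = F' := by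
  -- Apart from `c₀`, every term on the right takes its coefficient of `z ^ n` from earlier
  -- coefficients. The denominators do not involve `z`, so clearing them multiplies each coefficient
  -- by one nonzero polynomial, which cancels.
  have key : ∀ n g k, PowerSeries.coeff n (F g k) = PowerSeries.coeff n (F' g k) := by
    intro n
    induction n using Nat.strong_induction_on with
    | _ n ih =>
      intro g k
      have e := congrArg (PowerSeries.coeff n) (clear_denominators F g k _ (h g k))
      have e' := congrArg (PowerSeries.coeff n) (clear_denominators F' g k _ (h' g k))
      have h1 : PowerSeries.coeff n (productTerm F g k) =
          PowerSeries.coeff n (productTerm F' g k) := by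
        cases n with
        | zero => rw [productTerm, productTerm, coeff_zero_xvar_pow, coeff_zero_xvar_pow]
        | succ n =>
          rw [coeff_productTerm, coeff_productTerm]
          refine Finset.sum_congr rfl fun a _ => ?_
          have ha := a.2
          congr 1
          · funext i j
            exact ih a (by omega) i j
          · funext i j
            exact ih (n - a) (by omega) i j
      have h2 : PowerSeries.coeff n
          (PowerSeries.X * (F g k - c₀ g k - xvar 0 * coeffX 1 (F g k))) =
          PowerSeries.coeff n
          (PowerSeries.X * (F' g k - c₀ g k - xvar 0 * coeffX 1 (F' g k))) := by
        cases n with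
        | zero => rw [PowerSeries.coeff_zero_X_mul, PowerSeries.coeff_zero_X_mul]
        | succ n =>
          rw [PowerSeries.coeff_succ_X_mul, PowerSeries.coeff_succ_X_mul]
          simp only [map_sub, xvar, PowerSeries.coeff_C_mul, coeff_coeffX, ih n (by omega)]
      have h3 : PowerSeries.coeff n (markedNum F g k) = PowerSeries.coeff n (markedNum F' g k) := by
        cases k with
        | zero => rfl
        | succ k =>
          simp only [markedNum, xvar, mul_assoc, PowerSeries.coeff_C_mul]
          cases n with
          | zero => rw [PowerSeries.coeff_zero_X_mul, PowerSeries.coeff_zero_X_mul]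
          | succ n =>
            rw [PowerSeries.coeff_succ_X_mul, PowerSeries.coeff_succ_X_mul]
            simp only [map_sub, PowerSeries.coeff_C_mul, coeff_substVars, ih n (by omega)]
      simp only [map_add, PowerSeries.coeff_C_mul, h1, h2, h3, hE n F F' ih g k] at e e'
      exact mul_left_cancel₀ (mul_ne_zero (MvPolynomial.X_ne_zero 0) (markedDen_ne_zero k))
        (e.trans e'.symm)
  funext g k
  ext1 n
  exact key n g k

theorem coeff_handleTerm_congr {k n : ℕ} {G G' : Series (k + 1)}
    (h : ∀ m < n, PowerSeries.coeff m G = PowerSeries.coeff m G') :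
    PowerSeries.coeff n (handleTerm G) = PowerSeries.coeff n (handleTerm G') := by
  cases n with
  | zero => rw [handleTerm, handleTerm, coeff_zero_xvar_pow, coeff_zero_xvar_pow]
  | succ n => rw [coeff_handleTerm, coeff_handleTerm, h n (by omega)]

theorem coeff_crossCapTerm_congr {k n : ℕ} {G G' : Series k}
    (h : ∀ m < n, PowerSeries.coeff m G = PowerSeries.coeff m G') :
    PowerSeries.coeff n (crossCapTerm G) = PowerSeries.coeff n (crossCapTerm G') := by
  cases n with
  | zero => rw [crossCapTerm, crossCapTerm, coeff_zero_xvar_pow, coeff_zero_xvar_pow]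
  | succ n => rw [coeff_crossCapTerm, coeff_crossCapTerm, h n (by omega)]

theorem SystemO.eq {F F' : ∀ _ k : ℕ, Series k} (h : SystemO F) (h' : SystemO F') : F = F' := by
  refine eq_of_contracting
    (fun F g k => if 1 ≤ g then handleTerm (F (g - 1) (k + 1)) else 0) ?_
    (fun g k => h g k) (fun g k => h' g k)
  intro n F F' hF g k
  split_ifs
  · exact coeff_handleTerm_congr fun m hm => hF m hm _ _
  · rfl

theorem SystemQ.eq {F F' : ∀ _ k : ℕ, Series k} (h : SystemQ F) (h' : SystemQ F') : F = F' := by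
  refine eq_of_contracting (fun F g k =>
    (if 2 ≤ g then 2 * handleTerm (F (g - 2) (k + 1)) else 0) +
      (if 1 ≤ g then crossCapTerm (F (g - 1) k) else 0)) ?_
    (fun g k => (systemQ_iff F).1 h g k) (fun g k => (systemQ_iff F').1 h' g k)
  intro n F F' hF g k
  simp only [map_add]
  refine congrArg₂ (· + ·) ?_ ?_
  · by_cases hg : 2 ≤ g
    · have h2 : (2 : Series k) = PowerSeries.C 2 := (map_ofNat PowerSeries.C 2).symm
      rw [if_pos hg, if_pos hg, h2, PowerSeries.coeff_C_mul, PowerSeries.coeff_C_mul,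
        coeff_handleTerm_congr fun m hm => hF m hm _ _]
    · rw [if_neg hg, if_neg hg]
  · by_cases hg : 1 ≤ g
    · rw [if_pos hg, if_pos hg]
      exact coeff_crossCapTerm_congr fun m hm => hF m hm _ _
    · rw [if_neg hg, if_neg hg]

end Uniqueness


/-! ## Cubic schemes -/

/-- The empty marking is admissible exactly when all entries equal 3. -/
theorem filter_card_marks (D : Multiset ℕ) :
    (marks D).filter (fun T => T.card = 0) = if ∀ b ∈ D, b = 3 then {0} else 0 := by
  induction D using Multiset.induction_on with
  | empty => simp
  | cons a D ih =>
    have h0 : ((marks D).map (Multiset.cons a)).filter (fun T => T.card = 0) = 0 := by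
      rw [Multiset.filter_eq_nil]
      intro T hT
      obtain ⟨U, -, rfl⟩ := Multiset.mem_map.1 hT
      simp
    rw [marks_cons, Multiset.filter_add, h0, add_zero]
    by_cases h : a = 3
    · rw [if_pos h, ih]
      simp [h]
    · simp [h]

namespace RootedMap

variable {n : ℕ} (M : RootedMap n)

/-- The sum of the degrees is twice the number of edges. -/
theorem deg_add_sum_others : M.toProfile.deg + M.toProfile.others.sum = 2 * n := by
  have h1 := sum_by_orbits (α := M.σ₁) (β := M.σ₂) (γ := M.σ₂) saturated_true (fun _ => 1) id
    (fun y _ => (Finset.card_eq_sum_ones _).symm)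
  rw [sizes_eq_cons saturated_true (a := M.root) trivial] at h1
  simp only [Multiset.map_id, Multiset.sum_cons, true_and, Finset.filter_true, Finset.sum_const,
    Finset.card_univ, Fintype.card_fin, smul_eq_mul, mul_one] at h1
  have h2 := even_card_cls (β := M.σ₂) (γ := M.σ₂) M.invol₁ M.ne₁ M.root
  have h3 : ∀ b ∈ sizes M.σ₁ M.σ₂ M.σ₂ (fun z => ¬ Joined M.σ₁ M.σ₂ M.σ₂ M.root z), Even b := by
    intro b hb
    obtain ⟨c, hc, rfl⟩ := Multiset.mem_map.1 hb
    rw [Finset.mem_val, mem_orbits] at hc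
    obtain ⟨y, -, rfl⟩ := hc
    exact even_card_cls M.invol₁ M.ne₁ y
  have h4 : ∀ s : Multiset ℕ, (∀ b ∈ s, Even b) → s.sum = 2 * (s.map (· / 2)).sum := by
    intro s hs
    rw [← Multiset.sum_map_mul_left]
    conv_lhs => rw [← Multiset.map_id s]
    congr 1
    refine Multiset.map_congr rfl fun b hb => ?_
    exact (Nat.two_mul_div_two_of_even (hs b hb)).symm
  rw [h4 _ h3, ← Nat.two_mul_div_two_of_even h2] at h1
  simp only [toProfile, profile]
  omega

/-- With `V` vertices the sum of the degrees gives `1 + 3 (V - 1) = 2n`. Together with `V - n + β =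
χ` this means `n = 2 - 3 (χ - β)`, so fixing the number of edges and fixing the number of faces are
equivalent. -/
theorem isCubicScheme_iff (ori : Bool) (χ : ℤ) (β e : ℕ) (he : (e : ℤ) = 2 - 3 * (χ - β)) :
    IsCubicScheme ori χ β M ↔ n = e ∧ (M.toProfile.ori = ori ∧ M.eulerChar = χ) ∧
      M.toProfile.deg = 1 ∧ ∀ b ∈ M.toProfile.others, b = 3 := by
  rw [IsCubicScheme, isOn_iff, ncard_faces, degree_rootVertex]
  have h1 : (∀ v ∈ M.vertices, v ≠ M.rootVertex → degree v = 3) ↔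
      ∀ b ∈ M.toProfile.others, b = 3 := by
    rw [← map_degree_nonroot]
    simp only [Multiset.mem_map, Finset.mem_val, mem_nonroot]
    constructor
    · rintro h b ⟨v, hv, rfl⟩
      exact h v hv.1 hv.2
    · exact fun h v hv hr => h _ ⟨v, ⟨hv, hr⟩, rfl⟩
  rw [h1]
  have h2 := M.deg_add_sum_others
  have h3 := M.eulerChar_eq
  have h4 : (∀ b ∈ M.toProfile.others, b = 3) →
      M.toProfile.others.sum = 3 * M.toProfile.others.card := by
    intro h
    conv_lhs => rw [Multiset.eq_replicate_card.2 h]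
    rw [Multiset.sum_replicate, smul_eq_mul, mul_comm]
  constructor
  · rintro ⟨⟨ho, hχ⟩, hβ, hd, h3'⟩
    have := h4 h3'
    exact ⟨by omega, ⟨ho, hχ⟩, hd, h3'⟩
  · rintro ⟨hn, ⟨ho, hχ⟩, hd, h3'⟩
    have := h4 h3'
    exact ⟨⟨ho, hχ⟩, by omega, hd, h3'⟩

end RootedMap

-- The monomial `x` selects root degree 1, and the absence of marks forces all other vertices to be
-- cubic. `codes_forget` and `RootedMap.sum_profiles` turn the sum over codes into a count of
-- classes.
open Classical in
theorem coeff_total_zero (p : Bool → ℤ → Prop) (n : ℕ) :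
    MvPolynomial.coeff (Finsupp.single 0 1) (total p 0 (codes (n + 1))) =
      ((Finset.univ.filter fun c : Quotient (RootedMap.isoSetoid (n + 1)) =>
        p c.out.toProfile.ori c.out.eulerChar ∧ c.out.toProfile.deg = 1 ∧
          ∀ b ∈ c.out.toProfile.others, b = 3).card : ℚ) := by
  let w : Code (Multiset ℕ) → ℚ := fun q => if p q.ori q.chi ∧ q.deg = 1 then 1 else 0
  have h1 : ∀ q : Code (List ℕ), MvPolynomial.coeffAddMonoidHom (Finsupp.single 0 1)
      (q.term p 0) = if q.forget.marks.card = 0 then w q.forget else 0 := by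
    intro q
    have h2 : MvPolynomial.coeff (Finsupp.single 0 1) (q.monomial 0) =
        if q.deg = 1 then 1 else 0 := by
      rw [Code.monomial, Finset.univ_eq_empty, Finset.prod_empty, mul_one,
        MvPolynomial.coeff_X_pow]
      refine if_congr ?_ rfl rfl
      exact ⟨fun h => by simpa using DFunLike.congr_fun h 0, fun h => by rw [h]⟩
    change MvPolynomial.coeff (Finsupp.single 0 1) (q.term p 0) = _
    simp only [Code.term, Code.forget, Multiset.coe_card, w]
    split_ifs <;> simp_all
  have h2 : ∀ s : Multiset (Code (Multiset ℕ)),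
      (s.map fun q => if q.marks.card = 0 then w q else 0).sum =
      ((s.filter fun q => q.marks.card = 0).map w).sum := by
    intro s
    induction s using Multiset.induction_on with
    | empty => simp
    | cons q s ih =>
      rw [Multiset.map_cons, Multiset.sum_cons, ih, Multiset.filter_cons]
      split_ifs <;> simp
  change MvPolynomial.coeffAddMonoidHom (Finsupp.single 0 1) _ = _
  rw [map_total, Multiset.map_congr rfl fun q _ => h1 q]
  have h3 := h2 ((codes (n + 1)).map Code.forget)
  rw [Multiset.map_map] at h3
  refine h3.trans ?_
  rw [codes_forget, ← RootedMap.sum_profiles, bind_sum_singleton, Finset.card_filter,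
    Multiset.filter_eq_bind, bind_sum, ← Multiset.coe_mapAddMonoidHom, map_sum,
    ← Multiset.coe_sumAddMonoidHom, map_sum, Nat.cast_sum]
  refine Finset.sum_congr rfl fun c _ => ?_
  rw [← Multiset.filter_eq_bind, weights, Multiset.filter_map]
  have h4 := filter_card_marks c.out.toProfile.others
  simp only [Function.comp_def, Profile.succ, h4, Nat.add_sub_cancel,
    Multiset.coe_mapAddMonoidHom, Multiset.coe_sumAddMonoidHom, ← c.out.eulerChar_eq]
  by_cases h5 : ∀ b ∈ c.out.toProfile.others, b = 3
  · rw [if_pos h5, Multiset.map_singleton, Multiset.map_singleton, Multiset.sum_singleton]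
    simp only [w, iff_true_intro h5, and_true, Nat.cast_ite, Nat.cast_one, Nat.cast_zero]
  · rw [if_neg h5]
    simp only [h5, and_false, if_false]
    simp

/-- A cubic scheme of the surface has exactly `e` edges, so schemes of all sizes are counted by one
coefficient. -/
theorem card_cubicSchemes {c : CanonicalOrder} (hc : c.Good) (ori : Bool) (χ : ℤ) (β e : ℕ)
    (he : (e : ℤ) = 2 - 3 * (χ - β)) (h0 : e ≠ 0) :
    (numCubicSchemes ori χ β : ℚ) = coeffXZ e (mapSeries c ori χ 0) := by
  classical
  obtain ⟨n, rfl⟩ := Nat.exists_eq_succ_of_ne_zero h0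
  rw [coeffXZ, hc.coeff_mapSeries, coeff_total_zero, numCubicSchemes, Nat.cast_inj,
    ← Fintype.card_subtype, ← Nat.card_eq_fintype_card]
  symm
  refine Nat.card_congr (Equiv.ofBijective (fun q => ⟨⟨n + 1, q.1⟩,
    (q.1.out.isCubicScheme_iff ori χ β (n + 1) he).2 ⟨rfl, q.2⟩⟩) ⟨?_, ?_⟩)
  · rintro ⟨q, hq⟩ ⟨q', hq'⟩ h
    simpa using h
  · rintro ⟨⟨m, q⟩, h⟩
    have h' := (q.out.isCubicScheme_iff ori χ β (n + 1) he).1 h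
    obtain rfl := h'.1
    exact ⟨⟨q, h'.2⟩, rfl⟩

end NearCubic
-- The proposition
theorem mainTheorem6 :
    ∃ c : NearCubic.CanonicalOrder,
      -- the series `O_{g,k}` are the unique solution of their system
      (NearCubic.SystemO (NearCubic.seriesO c) ∧
        (∀ F : (∀ _ k : ℕ, NearCubic.Series k),
          NearCubic.SystemO F → F = NearCubic.seriesO c) ∧
        ∀ g k : ℕ, NearCubic.coeffX 0 (NearCubic.seriesO c g k) = NearCubic.c₀ g k) ∧
      -- the series `Q_{g,k}` are the unique solution of their system
      (NearCubic.SystemQ (NearCubic.seriesQ c) ∧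
        (∀ F : (∀ _ k : ℕ, NearCubic.Series k),
          NearCubic.SystemQ F → F = NearCubic.seriesQ c) ∧
        ∀ g k : ℕ, NearCubic.coeffX 0 (NearCubic.seriesQ c g k) = NearCubic.c₀ g k) ∧
      -- `a(S)` for the orientable surface `S` of genus `g` with `β` boundary components, not a disc
      (∀ g β : ℕ, 1 ≤ β → (g, β) ≠ (0, 1) →
        ∃ e : ℕ, (e : ℤ) = 2 - 3 * (2 - 2 * (g : ℤ) - β) ∧
          (NearCubic.numCubicSchemes true (2 - 2 * (g : ℤ)) β : ℚ) =
            NearCubic.coeffXZ e (NearCubic.seriesO c g 0)) ∧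
      -- `a(S)` for the non-orientable surface `S` of genus `g` with `β` boundary components
      (∀ g β : ℕ, 1 ≤ g → 1 ≤ β →
        ∃ e : ℕ, (e : ℤ) = 2 - 3 * (2 - (g : ℤ) - β) ∧
          (NearCubic.numCubicSchemes false (2 - (g : ℤ)) β : ℚ) =
            NearCubic.coeffXZ e (NearCubic.seriesP c g 0)) := by
  obtain ⟨c, hc⟩ := NearCubic.MarkedMap.exists_canonicalOrder
  replace hc : c.Good := hc
  have hO := hc.seriesO_eq
  have hQ := hc.seriesQ_eq
  refine ⟨c, ⟨?_, ?_, ?_⟩, ⟨?_, ?_, ?_⟩, ?_, ?_⟩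
  · rw [hO]
    exact NearCubic.CanonicalOrder.Good.systemO_codeSeries
  · rw [hO]
    exact fun F hF => hF.eq NearCubic.CanonicalOrder.Good.systemO_codeSeries
  · rw [hO]
    exact NearCubic.coeffX_zero_codeSeries NearCubic.CanonicalOrder.Good.graded_selO.sphere
  · rw [hQ]
    exact NearCubic.CanonicalOrder.Good.systemQ_codeSeries
  · rw [hQ]
    exact fun F hF => hF.eq NearCubic.CanonicalOrder.Good.systemQ_codeSeries
  · rw [hQ]
    exact NearCubic.coeffX_zero_codeSeries NearCubic.CanonicalOrder.Good.graded_selQ.sphere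
  · intro g β hβ hg
    have h : ¬ (g = 0 ∧ β = 1) := fun h => hg (by rw [h.1, h.2])
    -- The disc would give exponent `-1`; the other surfaces have nonpositive Euler characteristic,
    -- so the exponent is at least 2.
    refine ⟨(2 - 3 * (2 - 2 * (g : ℤ) - β)).toNat, by omega, ?_⟩
    exact NearCubic.card_cubicSchemes hc _ _ _ _ (by omega) (by omega)
  · intro g β hg hβ
    refine ⟨(2 - 3 * (2 - (g : ℤ) - β)).toNat, by omega, ?_⟩
    exact NearCubic.card_cubicSchemes hc _ _ _ _ (by omega) (by omega)
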